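/- Let $\pi=\mathbb{C}[b_{-1},b_{-2},\dots]|0\rangle$ be the Heisenberg vertex algebra of rank one: $b_n$ acts by multiplication for $n<0$, by $0$ for $n=0$ and by $n\,\partial/\partial b_{-n}$ for $n>0$; $b_{-n}$ has weight $n$; $T$ is the derivation with $Tb_{-n}=n\,b_{-n-1}$; and $Y(b_{-k_1-1}\cdots b_{-k_r-1}|0\rangle,z)={:}\tfrac{1}{k_1!}\partial^{k_1}b(z)\cdots\tfrac{1}{k_r!}\partial^{k_r}b(z){:}$ with $b(z)=\sum_n b_nz^{-n-1}$. Write $Y(a,z)=\sum_n a_{(n)}z^{-n-1}$. Let $\mathfrak{L}=(\pi\otimes\mathbb{C}[t,t^{-1}])/\mathrm{Im}(T\otimes 1+1\otimes\tfrac{d}{dt})$, let $a_{[n]}$ be the class of $a\otimes t^n$, of degree $\deg a-n-1$ for homogeneous $a$, with Lie bracket $[a_{[m]},b_{[n]}]=\sum_{k\ge0}\binom{m}{k}(a_{(k)}b)_{[m+n-k]}$. Let $U=\bigoplus_d U_d$ be the universal enveloping algebra of $\mathfrak{L}$, with the topology in which the left ideals $N^nU=U\cdot U_{\le -n}$ form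 a basis of neighbourhoods of $0$, and let $\widehat U=\bigoplus_d\widehat U_d$ with $\widehat U_d=\varprojlim_n U_d/(N^nU\cap U_d)$ be its graded completion, where $N^n\widehat U$ is the closure of $N^nU$ in $\widehat U$. Let $\bar J$ be the closure of the two-sided ideal of $\widehat U$ generated by $|0\rangle_{[-1]}-1$ and by the Jacobi relations $$\sum_{i\ge 0}(-1)^i\binom{\ell}{i}\left(a_{[m+\ell-i]}b_{[n+i]}-(-1)^{\ell}b_{[n+\ell-i]}a_{[m+i]}\right)-\sum_{i\ge 0}\binom{m}{i}(a_{(\ell+i)}b)_{[m+n-i]}\qquad(a,b\in\pi,\ \ell,m,n\in\mathbb{Z}),$$ and put $\mathscr{U}=\widehat U/\bar J$, graded by the images $\mathscr{U}_d$ of $\widehat U_d$, with $N^n\mathscr{U}_0$ the intersection of $\mathscr{U}_0$ with the image of $N^n\widehat U$. For $d\in\mathbb{Z}$ the $d$-th higher level Zhu algebra is $\mathsf{A}_d(\pi)=\mathscr{U}_0/N^{d+1}\mathscr{U}_0$; it is zero for $d<0$. Then for every integer $d\ge0$ there are isomorphisms of $\mathbb{C}$-algebras $$\mathsf{A}_d(\pi)\cong\mathrm{Mat}_{p(d)}(\mathbb{C}[x])\oplus\mathsf{A}_{d-1}(\pi)\qquad\text{and}\qquad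 \mathsf{A}_d(\pi)\cong\prod_{j=0}^d\mathrm{Mat}_{p(j)}(\mathbb{C}[x]),$$ where $p(j)$ is the number of partitions of $j$ into positive integers, $p(0)=1$, and $\oplus$ denotes the direct product of algebras. -/

import Mathlib

open scoped Polynomial

noncomputable section

namespace Heisenberg

/-! ### The Heisenberg vertex algebra -/

/-- The Fock space `π = ℂ[b₋₁, b₋₂, …]|0⟩`. The variable `X k` stands for the creation operator
`b₋₍ₖ₊₁₎`, so that the monomial `X k₁ ⋯ X kᵣ` is the state `b₋ₖ₁₋₁ ⋯ b₋ₖᵣ₋₁|0⟩`. -/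
abbrev Fock : Type := MvPolynomial ℕ ℂ

/-- The vacuum vector `|0⟩`. -/
def vacuum : Fock := 1

/-- The oscillators `bₙ` acting on `π`: multiplication by the variable `b₋ₙ` for `n < 0`, zero for
`n = 0`, and `n ∂/∂b₋ₙ` for `n > 0`, so that `[bₘ, bₙ] = m δ_{m+n,0}`. -/
def oscillator : ℤ → Module.End ℂ Fock
  | Int.ofNat 0 => 0
  | Int.ofNat (k + 1) => ((k : ℂ) + 1) • (MvPolynomial.pderiv k).toLinearMap
  | Int.negSucc k => LinearMap.mulLeft ℂ (MvPolynomial.X k)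

/-- The piece `π_n` of conformal weight `n`, where `b₋₍ₖ₊₁₎` has weight `k + 1`. -/
def weightSpace (n : ℕ) : Submodule ℂ Fock :=
  MvPolynomial.weightedHomogeneousSubmodule ℂ (fun k : ℕ => k + 1) n

/-- The translation operator `T = L₋₁` of `π`: the derivation with `T|0⟩ = 0` and
`T b₋ₙ = n b₋ₙ₋₁`. -/
def translation : Module.End ℂ Fock :=
  (MvPolynomial.mkDerivation ℂ fun k : ℕ =>
    ((k : ℂ) + 1) • (MvPolynomial.X (k + 1) : Fock)).toLinearMap

/-- A family of modes `(Aₙ)` with `Aₙ v = 0` for `n ≫ 0` gives the field `∑ₙ Aₙ z⁻ⁿ⁻¹`. -/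
def ofModes (A : ℤ → Module.End ℂ Fock) (hA : ∀ v, ∃ N : ℤ, ∀ n, N ≤ n → A n v = 0) :
    VertexOperator ℂ Fock :=
  VertexOperator.of_coeff (fun k => A (-k - 1)) fun v => by
    obtain ⟨N, hN⟩ := hA v
    refine ⟨-N, fun k hk => ?_⟩
    by_contra h
    exact hk (hN _ (by omega))

/-- Fields are truncated: `Aₙ v = 0` for `n ≫ 0`. -/
theorem exists_ncoeff_eq_zero (A : VertexOperator ℂ Fock) (v : Fock) :
    ∃ N : ℤ, ∀ n, N ≤ n → VertexOperator.ncoeff A n v = 0 :=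
  ⟨-((HahnModule.of ℂ).symm (A v)).order, fun n hn =>
    VertexOperator.ncoeff_eq_zero_of_lt_order A n v (by omega)⟩

theorem exists_oscillator_eq_zero (v : Fock) :
    ∃ N : ℤ, ∀ n, N ≤ n → oscillator n v = 0 := by
  refine ⟨(v.vars.sup id : ℕ) + 2, fun n hn => ?_⟩
  match n, hn with
  | Int.ofNat 0, _ => simp [oscillator]
  | Int.ofNat (k + 1), hn =>
    have hk : k ∉ v.vars := fun h => by
      have h1 : k ≤ v.vars.sup id := Finset.le_sup (f := id) h
      simp only [Int.ofNat_eq_natCast] at hn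
      push_cast at hn
      omega
    simp [oscillator, MvPolynomial.pderiv_eq_zero_of_notMem_vars hk]
  | Int.negSucc k, hn => omega

/-- The field `Y(b₋₍ₖ₊₁₎|0⟩, z) = (1/k!) ∂ᵏ b(z)`, where `b(z) = ∑ₙ bₙ z⁻ⁿ⁻¹`. Its coefficient at
`z⁻ⁿ⁻¹` is `(-1)ᵏ (n choose k) bₙ₋ₖ`. -/
def oscillatorField (k : ℕ) : VertexOperator ℂ Fock :=
  ofModes (fun n => ((-1 : ℤ) ^ k * Ring.choose n k) • oscillator (n - k)) fun v => by
    obtain ⟨N, hN⟩ := exists_oscillator_eq_zero v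
    exact ⟨N + k, fun n hn => by simp [hN (n - k) (by omega)]⟩

theorem finite_support_nat {v : ℤ → Fock} (h : ∃ N : ℤ, ∀ n, N ≤ n → v n = 0) (c : ℤ)
    {F : ℤ → Module.End ℂ Fock} :
    (Function.support fun i : ℕ => F i (v (c + i))).Finite := by
  obtain ⟨N, hN⟩ := h
  refine (Set.finite_lt_nat (N - c).toNat).subset fun i hi => ?_
  by_contra h'
  simp only [Set.mem_ofPred_eq, not_lt] at h'
  exact hi (by simp [hN (c + i) (by omega)])

/-- The `n`-th mode of the normally ordered product `:A(z)B(z): = A(z)₊B(z) + B(z)A(z)₋`, where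
`A(z)₊ = ∑_{j < 0} Aⱼ z⁻ʲ⁻¹` and `A(z)₋ = ∑_{j ≥ 0} Aⱼ z⁻ʲ⁻¹`. Both sums are finite on each vector. -/
def normalOrderMode (A B : VertexOperator ℂ Fock) (n : ℤ) : Module.End ℂ Fock where
  toFun v :=
    (∑ᶠ i : ℕ, VertexOperator.ncoeff A (-1 - i) (VertexOperator.ncoeff B (n + i) v)) +
      ∑ᶠ i : ℕ, VertexOperator.ncoeff B (n - 1 - i) (VertexOperator.ncoeff A (0 + i) v)
  map_add' v w := by
    have hB := fun u => finite_support_nat (exists_ncoeff_eq_zero B u) n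
      (F := fun i => VertexOperator.ncoeff A (-1 - i))
    have hA := fun u => finite_support_nat (exists_ncoeff_eq_zero A u) 0
      (F := fun i => VertexOperator.ncoeff B (n - 1 - i))
    simp only [map_add]
    rw [finsum_add_distrib (hB v) (hB w), finsum_add_distrib (hA v) (hA w)]
    abel
  map_smul' c v := by
    have hB := finite_support_nat (exists_ncoeff_eq_zero B v) n
      (F := fun i => VertexOperator.ncoeff A (-1 - i))
    have hA := finite_support_nat (exists_ncoeff_eq_zero A v) 0
      (F := fun i => VertexOperator.ncoeff B (n - 1 - i))
    simp only [map_smul, RingHom.id_apply, smul_add]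
    rw [smul_finsum' c hB, smul_finsum' c hA]

/-- The normally ordered product `:A(z)B(z):` of two fields. -/
def normalOrder (A B : VertexOperator ℂ Fock) : VertexOperator ℂ Fock :=
  ofModes (normalOrderMode A B) fun v => by
    obtain ⟨NA, hNA⟩ := exists_ncoeff_eq_zero A v
    obtain ⟨NB, hNB⟩ := exists_ncoeff_eq_zero B v
    choose M hM using fun i : ℕ =>
      exists_ncoeff_eq_zero B (VertexOperator.ncoeff A (0 + (i : ℤ)) v)
    obtain ⟨K, hK⟩ : ∃ K : ℤ, ∀ i ∈ Finset.range NA.toNat, M i + i + 1 ≤ K := by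
      refine ⟨∑ i ∈ Finset.range NA.toNat, |M i + i + 1|, fun i hi => ?_⟩
      exact (le_abs_self _).trans
        (Finset.single_le_sum (f := fun i : ℕ => |M i + (i : ℤ) + 1|)
          (fun j _ => abs_nonneg _) hi)
    refine ⟨max NB K, fun n hn => ?_⟩
    have h1 : ∀ i : ℕ, VertexOperator.ncoeff A (-1 - (i : ℤ))
        (VertexOperator.ncoeff B (n + i) v) = 0 := fun i => by
      rw [hNB (n + i) (by have := le_max_left NB K; omega), map_zero]
    have h2 : ∀ i : ℕ, VertexOperator.ncoeff B (n - 1 - (i : ℤ))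
        (VertexOperator.ncoeff A (0 + (i : ℤ)) v) = 0 := fun i => by
      by_cases hi : i < NA.toNat
      · have := hK i (Finset.mem_range.2 hi)
        have := le_max_right NB K
        exact hM i _ (by omega)
      · rw [hNA (0 + i) (by omega), map_zero]
    simp only [normalOrderMode, LinearMap.coe_mk, AddHom.coe_mk, h1, h2, finsum_zero, add_zero]

/-- The identity field `Y(|0⟩, z) = id`. -/
def identityField : VertexOperator ℂ Fock :=
  ofModes (fun n => if n = -1 then LinearMap.id else 0) fun _ =>
    ⟨0, fun n hn => by rw [if_neg (by omega)]; rfl⟩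

/-- The state-field correspondence of `π`, with
`Y(b₋ₖ₁₋₁ ⋯ b₋ₖᵣ₋₁|0⟩, z) = :(1/k₁!)∂ᵏ¹b(z) ⋯ (1/kᵣ!)∂ᵏʳb(z):`
(normally ordered products nested to the right). -/
def Y : Fock →ₗ[ℂ] VertexOperator ℂ Fock :=
  (MvPolynomial.basisMonomials ℕ ℂ).constr ℂ fun s : ℕ →₀ ℕ =>
    ((Finsupp.toMultiset s).sort).foldr (fun k A => normalOrder (oscillatorField k) A)
      identityField

/-- The `n`-th product `a₍ₙ₎b`, where `Y(a, z) = ∑ₙ a₍ₙ₎ z⁻ⁿ⁻¹`. -/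
def nthProduct (n : ℤ) (a b : Fock) : Fock := VertexOperator.ncoeff (Y a) n b

/-! ### The finite ancillary Lie algebra and its enveloping algebra -/

/-- The operator `∇ = L₋₁ ⊗ id + id ⊗ d/dt` on `π ⊗ ℂ[t, t⁻¹]`. The element `∑ₙ aₙ ⊗ tⁿ` of this
tensor product is the finitely supported function `n ↦ aₙ`. -/
def nabla : (ℤ →₀ Fock) →ₗ[ℂ] (ℤ →₀ Fock) :=
  Finsupp.lsum ℂ fun n : ℤ =>
    Finsupp.lsingle n ∘ₗ translation + (n : ℂ) • Finsupp.lsingle (n - 1)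

/-- The vector space `𝔏(π)ᶠ = (π ⊗ ℂ[t, t⁻¹]) / Im ∇`. -/
abbrev Ancillary : Type := (ℤ →₀ Fock) ⧸ LinearMap.range nabla

/-- The class `a_[n]` of `a ⊗ tⁿ` in `𝔏(π)ᶠ`. -/
def bracketMode (a : Fock) (n : ℤ) : Ancillary :=
  (LinearMap.range nabla).mkQ (Finsupp.single n a)

/-- The Lie bracket `[a_[m], b_[n]] = ∑_{k ≥ 0} (m choose k) (a₍ₖ₎b)_[m+n-k]` of `𝔏(π)ᶠ`, on
generators. -/
def lieBracket (a b : Fock) (m n : ℤ) : Ancillary :=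
  ∑ᶠ k : ℕ, Ring.choose m k • bracketMode (nthProduct k a b) (m + n - k)

/-- The relations `xy = yx + [x, y]` that define the universal enveloping algebra of `𝔏(π)ᶠ` as a
quotient of its tensor algebra. -/
inductive EnvelopingRel : TensorAlgebra ℂ Ancillary → TensorAlgebra ℂ Ancillary → Prop
  | lie (a b : Fock) (m n : ℤ) : EnvelopingRel
      (TensorAlgebra.ι ℂ (bracketMode a m) * TensorAlgebra.ι ℂ (bracketMode b n))
      (TensorAlgebra.ι ℂ (bracketMode b n) * TensorAlgebra.ι ℂ (bracketMode a m) +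
        TensorAlgebra.ι ℂ (lieBracket a b m n))

/-- The universal enveloping algebra `U` of the Lie algebra `𝔏(π)ᶠ`. -/
def Enveloping : Type := RingQuot EnvelopingRel

instance : Ring Enveloping := inferInstanceAs (Ring (RingQuot EnvelopingRel))

instance : Algebra ℂ Enveloping := inferInstanceAs (Algebra ℂ (RingQuot EnvelopingRel))

/-- The projection of the tensor algebra onto `U`. -/
def envProj : TensorAlgebra ℂ Ancillary →ₐ[ℂ] Enveloping := RingQuot.mkAlgHom ℂ EnvelopingRel

/-- The canonical map `𝔏(π)ᶠ → U`. -/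
def envι : Ancillary →ₗ[ℂ] Enveloping := envProj.toLinearMap ∘ₗ TensorAlgebra.ι ℂ

/-- Products of homogeneous generators: `a_[n]` has degree `wt a - n - 1`. -/
inductive IsMonomial : ℤ → Enveloping → Prop
  | one : IsMonomial 0 1
  | mul {w : ℕ} {a : Fock} (ha : a ∈ weightSpace w) (n : ℤ) {d : ℤ} {u : Enveloping}
      (hu : IsMonomial d u) : IsMonomial (w - n - 1 + d) (envι (bracketMode a n) * u)

/-- The graded piece `U_d` of the enveloping algebra. -/
def gradedPiece (d : ℤ) : Submodule ℂ Enveloping := Submodule.span ℂ {u | IsMonomial d u}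

/-- The left ideal `N_L^n U = U · U_{≤ -n}`. -/
def leftNhd (n : ℤ) : Ideal Enveloping := Ideal.span {u | ∃ j : ℤ, j ≤ -n ∧ u ∈ gradedPiece j}

theorem leftNhd_anti {m n : ℤ} (h : m ≤ n) : leftNhd n ≤ leftNhd m :=
  Ideal.span_mono fun _ ⟨j, hj, hu⟩ => ⟨j, by omega, hu⟩

theorem IsMonomial.mul_mul {d e : ℤ} {u v : Enveloping} (hu : IsMonomial d u)
    (hv : IsMonomial e v) : IsMonomial (d + e) (u * v) := by
  induction hu with
  | one => simpa using hv
  | mul ha n _ ih =>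
    rw [mul_assoc, add_assoc]
    exact IsMonomial.mul ha n ih

theorem mul_mem_gradedPiece {d e : ℤ} {u v : Enveloping} (hu : u ∈ gradedPiece d)
    (hv : v ∈ gradedPiece e) : u * v ∈ gradedPiece (d + e) := by
  have h := Submodule.mul_mem_mul hu hv
  rw [gradedPiece, gradedPiece, Submodule.span_mul_span] at h
  refine Submodule.span_mono ?_ h
  rintro _ ⟨x, hx, y, hy, rfl⟩
  exact IsMonomial.mul_mul hx hy

theorem mul_mem_leftNhd {n e : ℤ} {u v : Enveloping} (hu : u ∈ leftNhd n)
    (hv : v ∈ gradedPiece e) : u * v ∈ leftNhd (n - e) := by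
  induction hu using Submodule.span_induction with
  | mem x hx =>
    obtain ⟨j, hj, hx⟩ := hx
    exact Ideal.subset_span ⟨j + e, by omega, mul_mem_gradedPiece hx hv⟩
  | zero => simp
  | add x y _ _ hx hy => rw [add_mul]; exact add_mem hx hy
  | smul c x _ hx => rw [smul_eq_mul, mul_assoc]; exact Ideal.mul_mem_left _ _ hx

/-- The degree zero subalgebra `U₀`. -/
def degreeZero : Subalgebra ℂ Enveloping :=
  (gradedPiece 0).toSubalgebra (Submodule.subset_span IsMonomial.one) fun _ _ hu hv => by
    simpa using mul_mem_gradedPiece hu hv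

/-- Right multiplication by a fixed element is continuous for the left ideals `N_L^n U`. -/
theorem exists_mul_mem_leftNhd (x : Enveloping) (i : ℤ) :
    ∃ j : ℤ, ∀ u ∈ leftNhd j, u * x ∈ leftNhd i := by
  obtain ⟨y, rfl⟩ : ∃ y, envProj y = x := RingQuot.mkAlgHom_surjective ℂ EnvelopingRel x
  revert i
  have hadd : ∀ x y : Enveloping, (∀ i, ∃ j : ℤ, ∀ u ∈ leftNhd j, u * x ∈ leftNhd i) →
      (∀ i, ∃ j : ℤ, ∀ u ∈ leftNhd j, u * y ∈ leftNhd i) →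
      ∀ i, ∃ j : ℤ, ∀ u ∈ leftNhd j, u * (x + y) ∈ leftNhd i := by
    intro x y hx hy i
    obtain ⟨j, hj⟩ := hx i
    obtain ⟨k, hk⟩ := hy i
    refine ⟨max j k, fun u hu => ?_⟩
    rw [mul_add]
    exact add_mem (hj _ (leftNhd_anti (le_max_left _ _) hu))
      (hk _ (leftNhd_anti (le_max_right _ _) hu))
  induction y using TensorAlgebra.induction with
  | algebraMap r =>
    intro i
    refine ⟨i, fun u hu => ?_⟩
    rw [AlgHom.commutes]
    exact (Algebra.commutes r u) ▸ Ideal.mul_mem_left _ _ hu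
  | ι z =>
    obtain ⟨f, rfl⟩ := Submodule.mkQ_surjective _ z
    induction f using Finsupp.induction_linear with
    | zero => intro i; exact ⟨i, fun u hu => by simp⟩
    | add f g hf hg => simpa only [map_add] using hadd _ _ hf hg
    | single n a =>
      induction a using MvPolynomial.induction_on' with
      | add p q hp hq =>
        simpa only [Finsupp.single_add, map_add] using hadd _ _ hp hq
      | monomial s c =>
        intro i
        have hs : MvPolynomial.monomial s c ∈
            weightSpace (Finsupp.weight (fun k : ℕ => k + 1) s) :=
          MvPolynomial.isWeightedHomogeneous_monomial _ _ _ rfl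
        have hm : envι (bracketMode (MvPolynomial.monomial s c) n) ∈ gradedPiece _ :=
          Submodule.subset_span (by simpa using IsMonomial.mul hs n IsMonomial.one)
        exact ⟨i + (_ : ℤ), fun u hu => by
          have := mul_mem_leftNhd hu hm
          rwa [add_sub_cancel_right] at this⟩
  | mul p q hp hq =>
    intro i
    obtain ⟨j, hj⟩ := hq i
    obtain ⟨k, hk⟩ := hp j
    refine ⟨k, fun u hu => ?_⟩
    rw [map_mul]
    exact (mul_assoc u _ _) ▸ hj _ (hk u hu)
  | add p q hp hq => simpa only [map_add] using hadd _ _ hp hq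

theorem leftNhd_basis :
    RingSubgroupsBasis fun n : ℤ => Submodule.toAddSubgroup (leftNhd n) where
  inter i j := ⟨max i j, fun _ hu =>
    ⟨leftNhd_anti (le_max_left _ _) hu, leftNhd_anti (le_max_right _ _) hu⟩⟩
  mul i := ⟨i, by
    rintro _ ⟨x, _, y, hy, rfl⟩
    exact Ideal.mul_mem_left _ _ hy⟩
  leftMul _ i := ⟨i, fun _ hu => Ideal.mul_mem_left _ _ hu⟩
  rightMul x i := exists_mul_mem_leftNhd x i

/-! ### Completion -/

/-- The topology of `U` for which the left ideals `N_L^n U` are a basis of neighbourhoods of `0`. -/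
instance : TopologicalSpace Enveloping := leftNhd_basis.topology

instance : IsTopologicalRing Enveloping :=
  leftNhd_basis.toRingFilterBasis.isTopologicalRing

instance : UniformSpace Enveloping := IsTopologicalAddGroup.rightUniformSpace Enveloping

instance : IsUniformAddGroup Enveloping := isUniformAddGroup_of_addCommGroup

instance : UniformContinuousConstSMul ℂ Enveloping where
  uniformContinuous_const_smul c := by
    simp only [Algebra.smul_def]
    exact uniformContinuous_addMonoidHom_of_continuous
      (f := AddMonoidHom.mulLeft (algebraMap ℂ Enveloping c)) (continuous_const_mul _)

/-- The separated completion of `U`. It contains the graded completion of `U`. -/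
abbrev Completed : Type := UniformSpace.Completion Enveloping

/-- The canonical map `U → lim U / N_L^n U`. -/
def toCompleted : Enveloping →ₐ[ℂ] Completed :=
  { UniformSpace.Completion.coeRingHom with commutes' := fun _ => rfl }

/-- The piece `Û_d = lim U_d / N_L^n U_d`, as the closure of `U_d` in the completion. -/
def completedPiece (d : ℤ) : Set Completed := closure (toCompleted '' gradedPiece d)

/-- The graded completion `Û = ⨁_d Û_d`, as the subalgebra generated by the pieces `Û_d`. -/
abbrev GradedCompletion : Type :=
  Algebra.adjoin ℂ (⋃ d : ℤ, completedPiece d)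

instance : IsTopologicalRing GradedCompletion :=
  (Algebra.adjoin ℂ (⋃ d : ℤ, completedPiece d)).toSubring.instIsTopologicalRing

/-! ### The universal enveloping algebra of the vertex algebra -/

/-- The generator `a_[n]`, in `U`. -/
def mode (a : Fock) (n : ℤ) : Enveloping := envι (bracketMode a n)

/-- The `i`-th term of the left-hand side of the Jacobi identity,
`(-1)^i (ℓ choose i) (a_[m+ℓ-i] b_[n+i] - (-1)^ℓ b_[n+ℓ-i] a_[m+i])`. -/
def jacobiTerm (a b : Fock) (l m n : ℤ) (i : ℕ) : Enveloping :=
  ((-1 : ℤ) ^ i * Ring.choose l i) •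
    (mode a (m + l - i) * mode b (n + i) -
      (l.negOnePow : ℤ) • (mode b (n + l - i) * mode a (m + i)))

/-- The right-hand side of the Jacobi identity, `∑_{i ≥ 0} (m choose i) (a₍ₗ₊ᵢ₎b)_[m+n-i]`. -/
def jacobiRight (a b : Fock) (l m n : ℤ) : Enveloping :=
  envι (∑ᶠ i : ℕ, Ring.choose m i • bracketMode (nthProduct (l + i) a b) (m + n - i))

/-- The relations imposed on `Û`: the differences of the two sides of the Jacobi identities (the
left-hand side being a convergent series), and the vacuum relation `|0⟩_[-1] = 1`. -/
def relations : Set GradedCompletion :=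
  {x | (∃ (a b : Fock) (l m n : ℤ) (s : Completed),
      HasSum (fun i : ℕ => toCompleted (jacobiTerm a b l m n i)) s ∧
        (x : Completed) = s - toCompleted (jacobiRight a b l m n)) ∨
    (x : Completed) = toCompleted (mode vacuum (-1)) - 1}

/-- The closure in `Û` of the two-sided ideal generated by the relations. -/
def closedIdeal : Ideal GradedCompletion :=
  Ideal.closure (TwoSidedIdeal.asIdeal (TwoSidedIdeal.span relations))

instance : closedIdeal.IsTwoSided where
  mul_mem_of_left y hx :=
    map_mem_closure (f := fun z => z * y) (continuous_mul_const y) hx fun _ hz =>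
      TwoSidedIdeal.mul_mem_right _ _ _ hz

/-- The (finite) universal enveloping algebra `𝒰 = Û / J̄` of the vertex algebra `π`. -/
abbrev UEA : Type := GradedCompletion ⧸ closedIdeal

/-- The degree zero subalgebra `Û₀`, the closure of `U₀`. -/
def completedZero : Subalgebra ℂ GradedCompletion :=
  ((degreeZero.map toCompleted).topologicalClosure).comap (Subalgebra.val _)

/-- The degree zero subalgebra `𝒰₀`, the image of `Û₀`. -/
def UEAZero : Subalgebra ℂ UEA := completedZero.map (Ideal.Quotient.mkₐ ℂ closedIdeal)

/-- The neighbourhood `N^n Û`, the closure of `N_L^n U`. -/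
def completedNhd (n : ℤ) : Set Completed := closure (toCompleted '' leftNhd n)

theorem add_mem_completedNhd {n : ℤ} {x y : Completed} (hx : x ∈ completedNhd n)
    (hy : y ∈ completedNhd n) : x + y ∈ completedNhd n :=
  map_mem_closure₂ continuous_add hx hy (by
    rintro _ ⟨u, hu, rfl⟩ _ ⟨v, hv, rfl⟩
    exact ⟨u + v, add_mem hu hv, map_add _ _ _⟩)

theorem mul_mem_completedNhd {n : ℤ} (x : Completed) {y : Completed} (hy : y ∈ completedNhd n) :
    x * y ∈ completedNhd n := by
  refine map_mem_closure₂ (s := Set.range toCompleted) continuous_mul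
    (UniformSpace.Completion.denseRange_coe x) hy ?_
  rintro _ ⟨u, rfl⟩ _ ⟨v, hv, rfl⟩
  exact ⟨u * v, Ideal.mul_mem_left _ _ hv, map_mul _ _ _⟩

theorem completedNhd_mul_mem {n : ℤ} {x y : Completed} (hx : x ∈ completedNhd n)
    (hy : y ∈ (degreeZero.map toCompleted).topologicalClosure) : x * y ∈ completedNhd n := by
  refine map_mem_closure₂ continuous_mul hx hy ?_
  rintro _ ⟨u, hu, rfl⟩ _ ⟨v, hv, rfl⟩
  exact ⟨u * v, by simpa using mul_mem_leftNhd hu hv, map_mul _ _ _⟩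

/-- The neighbourhood `N^n 𝒰₀ = N^n 𝒰 ∩ 𝒰₀`, where `N^n 𝒰` is the image of `N^n Û`. It is a
two-sided ideal of `𝒰₀`. -/
def nhdZero (n : ℤ) : Ideal UEAZero where
  carrier := {x | ∃ y : GradedCompletion, (y : Completed) ∈ completedNhd n ∧
    Ideal.Quotient.mk closedIdeal y = x}
  zero_mem' := ⟨0, subset_closure ⟨0, zero_mem _, map_zero _⟩, map_zero _⟩
  add_mem' := by
    rintro a b ⟨y, hy, hya⟩ ⟨z, hz, hzb⟩
    exact ⟨y + z, add_mem_completedNhd hy hz, by simp [hya, hzb]⟩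
  smul_mem' := by
    rintro a b ⟨y, hy, hyb⟩
    obtain ⟨z, hz⟩ := Ideal.Quotient.mk_surjective (a : UEA)
    exact ⟨z * y, mul_mem_completedNhd _ hy, by simp [hyb, hz]⟩

instance (n : ℤ) : (nhdZero n).IsTwoSided where
  mul_mem_of_left {a} b := by
    rintro ⟨y, hy, hya⟩
    obtain ⟨z, hz, hzb⟩ := b.2
    exact ⟨y * z, completedNhd_mul_mem hy hz, by rw [map_mul, hya]; exact congrArg _ hzb⟩

/-- The `d`-th higher level Zhu algebra `A_d(π) = 𝒰₀ / N^{d+1} 𝒰₀`. For `d < 0` it is zero. -/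
abbrev HigherZhu (d : ℤ) : Type := UEAZero ⧸ nhdZero (d + 1)

end Heisenberg

end

/-!
The Fock module `π` and the free parameter `x`, the eigenvalue of `b₀`, combine into the universal
Fock module `ℂ[x] ⊗ π`, which is the ring of polynomials with `X 0 = b₀` adjoined as a variable. The
modes of the fields attached to its oscillators satisfy the Jacobi identity: the defect of the
identity commutes with all multiplications and derivatives, by induction on the degrees of the two
states, so it is a scalar, and its vacuum expectation vanishes by translation covariance, skew
symmetry and a binomial identity. Hence `𝒰` acts on the universal Fock module, and `N^n 𝒰` kills all
vectors of degree less than `n`.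

Conversely, the Jacobi relations in `𝒰` express the class of every state through the oscillators,
and modulo `N^n 𝒰` an element of degree zero becomes a finite sum of normally ordered products of
creation operators, powers of `b₀` and annihilation operators. The piece of degree `j` of the
universal Fock module is free over `ℂ[x]` with a basis indexed by the partitions of `j`. In these
bases a normally ordered product which annihilates degree `j` vanishes on all smaller degrees and is
a multiple of a matrix unit in degree `j`, so the matrices on the pieces of degree `j < m` define a
surjection from `𝒰₀` to `∏_{j < m} Mat_{p(j)}(ℂ[x])` with kernel `N^m 𝒰₀`.
-/

noncomputable section

namespace Heisenberg

open Filter Finset MvPolynomial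
open VertexOperator (ncoeff)

/-! ### Finite sums -/

theorem eventually_finsum_eq_sum_range {M : Type*} [AddCommMonoid M] {f : ℕ → M}
    (hf : (Function.support f).Finite) : ∀ᶠ N in atTop, ∑ᶠ i, f i = ∑ i ∈ range N, f i := by
  obtain ⟨N, hN⟩ := hf.bddAbove
  filter_upwards [eventually_gt_atTop N] with K hK
  exact finsum_eq_sum_of_support_subset _ fun i hi => by
    simpa using (hN hi).trans_lt hK

theorem eventually_sum_range_ite_eq {M : Type*} [AddCommMonoid M] (p : ℤ) (f : ℤ → M) :
    ∀ᶠ N in atTop, ∑ i ∈ range N, ((if -1 - (i : ℤ) = p then f (-1 - i) else 0) +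
      if (i : ℤ) = p then f i else 0) = f p := by
  filter_upwards [eventually_gt_atTop p.natAbs] with N hN
  rcases le_or_gt 0 p with hp | hp
  · rw [sum_eq_single p.toNat]
    · rw [if_neg (by omega), if_pos (by omega), zero_add, Int.toNat_of_nonneg hp]
    · intro i _ hi
      rw [if_neg (by omega), if_neg (by omega), zero_add]
    · exact fun h => absurd (mem_range.2 (by omega)) h
  · obtain ⟨q, hq⟩ : ∃ q : ℕ, -1 - (q : ℤ) = p := ⟨(-1 - p).toNat, by omega⟩
    rw [sum_eq_single q]
    · rw [if_pos hq, if_neg (by omega), add_zero, hq]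
    · intro i _ hi
      rw [if_neg (by omega), if_neg (by omega), zero_add]
    · exact fun h => absurd (mem_range.2 (by omega)) h

/-! ### Binomial coefficients -/

section Choose

variable {R : Type*} [CommRing R] [BinomialRing R]

theorem succ_mul_choose_succ (r : R) (k : ℕ) :
    ((k : R) + 1) * Ring.choose r (k + 1) = (r - k) * Ring.choose r k := by
  have h := Ring.choose_smul_choose r (Nat.le_succ k)
  simp only [Nat.succ_eq_add_one, Nat.choose_succ_self_right, add_tsub_cancel_left,
    Ring.choose_one_right, nsmul_eq_mul] at h
  push_cast at h
  rw [h, mul_comm]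

theorem succ_mul_choose_succ' (r : R) (k : ℕ) :
    ((k : R) + 1) * Ring.choose r (k + 1) = r * Ring.choose (r - 1) k := by
  have h := Ring.choose_smul_choose r (Nat.succ_le_succ (Nat.zero_le k))
  simp only [Nat.succ_eq_add_one, zero_add, Nat.choose_one_right, add_tsub_cancel_right,
    Ring.choose_one_right, nsmul_eq_mul] at h
  push_cast at h
  rw [h]

theorem sub_mul_choose (r : R) (k : ℕ) :
    (r - k) * Ring.choose r k = r * Ring.choose (r - 1) k := by
  rw [← succ_mul_choose_succ, succ_mul_choose_succ']

theorem negOnePow_natCast (n : ℕ) : ((n : ℤ).negOnePow : ℤ) = (-1) ^ n := by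
  simp [Int.negOnePow]

theorem neg_one_pow_mul_choose_sub_one_sub (r : R) (k : ℕ) :
    (-1 : R) ^ k * Ring.choose ((k : R) - 1 - r) k = Ring.choose r k := by
  have h := Ring.choose_neg (-r) k
  rw [neg_neg, Units.smul_def, negOnePow_natCast, zsmul_eq_mul] at h
  rw [h, show -r + (k : R) - 1 = k - 1 - r by ring]
  push_cast
  rfl

theorem choose_eq_zero_of_lt {n : ℤ} {k : ℕ} (h0 : 0 ≤ n) (h : n < k) : Ring.choose n k = 0 := by
  lift n to ℕ using h0
  rw [Ring.choose_natCast, Nat.choose_eq_zero_of_lt (by exact_mod_cast h), Nat.cast_zero]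

end Choose

/-! ### Polynomials -/

section Polynomial

variable {σ R : Type*}

theorem exponent_induction_on_min [LinearOrder σ] {P : (σ →₀ ℕ) → Prop} (zero : P 0)
    (single_add : ∀ k s, (∀ j ∈ s.support, k ≤ j) → P s → P (Finsupp.single k 1 + s))
    (s : σ →₀ ℕ) : P s := by
  induction s using Finsupp.induction_on_min with
  | zero => exact zero
  | single_add k e s hs _ ih =>
    clear * - hs ih single_add
    induction e with
    | zero => simpa using ih
    | succ e ihe =>
      rw [add_comm e, Finsupp.single_add, add_assoc]
      refine single_add k _ (fun j hj => ?_) ihe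
      rcases mem_union.1 (Finsupp.support_add hj) with h | h
      · exact (mem_singleton.1 (Finsupp.support_single_subset h)).ge
      · exact (hs j h).le

section CommSemiring

variable [CommSemiring R]

theorem X_mul_monomial (k : σ) (s : σ →₀ ℕ) (c : R) :
    X k * monomial s c = monomial (Finsupp.single k 1 + s) c := by
  rw [X, monomial_mul, one_mul]

theorem monomial_eq_smul_monomial_one (s : σ →₀ ℕ) (c : R) :
    monomial s c = c • monomial s (1 : R) := by
  rw [smul_monomial, smul_eq_mul, mul_one]

theorem pderiv_X_mul [DecidableEq σ] (j k : σ) (f : MvPolynomial σ R) :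
    pderiv k (X j * f) = X j * pderiv k f + if j = k then f else 0 := by
  rw [Derivation.leibniz, smul_eq_mul, smul_eq_mul]
  congr 1
  split_ifs with h
  · rw [h, pderiv_X_self, mul_one]
  · rw [pderiv_X_of_ne h, mul_zero]

theorem monomial_induction_on_min [LinearOrder σ] {P : MvPolynomial σ R → Prop} (one : P 1)
    (X_mul : ∀ k s, (∀ j ∈ s.support, k ≤ j) → P (monomial s 1) → P (X k * monomial s 1))
    (s : σ →₀ ℕ) : P (monomial s 1) := by
  induction s using exponent_induction_on_min with
  | zero => exact one
  | single_add k s hs ih => exact X_mul_monomial k s (1 : R) ▸ X_mul k s hs ih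

theorem induction_on_min [LinearOrder σ] {P : MvPolynomial σ R → Prop} (one : P 1)
    (X_mul : ∀ k s, (∀ j ∈ s.support, k ≤ j) → P (monomial s 1) → P (X k * monomial s 1))
    (add : ∀ p q, P p → P q → P (p + q)) (smul : ∀ (c : R) p, P p → P (c • p))
    (p : MvPolynomial σ R) : P p := by
  induction p using MvPolynomial.induction_on' with
  | add p q hp hq => exact add p q hp hq
  | monomial s c =>
    exact monomial_eq_smul_monomial_one s c ▸ smul c _ (monomial_induction_on_min one X_mul s)

theorem weightedHomogeneous_induction_on_min [LinearOrder σ] {M : Type*} [AddCommMonoid M]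
    {w : σ → M} {P : M → MvPolynomial σ R → Prop} (one : P 0 1)
    (X_mul : ∀ m k s, (∀ j ∈ s.support, k ≤ j) → P m (monomial s 1) →
      P (w k + m) (X k * monomial s 1))
    (zero : ∀ m, P m 0) (add : ∀ m p q, P m p → P m q → P m (p + q))
    (smul : ∀ m (c : R) p, P m p → P m (c • p)) {m : M} {p : MvPolynomial σ R}
    (hp : IsWeightedHomogeneous w p m) : P m p := by
  have hmon : ∀ s, P (Finsupp.weight w s) (monomial s 1) := fun s => by
    induction s using exponent_induction_on_min with
    | zero => rwa [map_zero, monomial_zero', C_1]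
    | single_add k s hs ih =>
      rw [map_add, Finsupp.weight_single, one_smul, ← X_mul_monomial]
      exact X_mul _ k s hs ih
  induction hp using IsWeightedHomogeneous.induction_on with
  | zero => exact zero m
  | add p q _ _ hp hq => exact add m p q hp hq
  | monomial s c hs =>
    exact monomial_eq_smul_monomial_one s c ▸ smul m c _ (hs ▸ hmon s)

theorem isWeightedHomogeneous_natCast_iff {w : σ → ℕ} {n : ℕ} {p : MvPolynomial σ R} :
    IsWeightedHomogeneous (fun k => (w k : ℤ)) p n ↔ IsWeightedHomogeneous w p n := by
  have h (s : σ →₀ ℕ) : Finsupp.weight (fun k => (w k : ℤ)) s = (Finsupp.weight w s : ℤ) := by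
    simp [Finsupp.weight_apply, Finsupp.sum]
  simp only [IsWeightedHomogeneous, h, Nat.cast_inj]

theorem eventually_pderiv_eq_zero (a : MvPolynomial ℕ R) :
    ∀ᶠ k in atTop, pderiv k a = 0 := by
  filter_upwards [eventually_gt_atTop (a.vars.sup id)] with k hk
  exact pderiv_eq_zero_of_notMem_vars fun h => (Finset.le_sup (f := id) h).not_gt hk

theorem eq_zero_of_isWeightedHomogeneous_of_neg {w : σ → ℤ} (hw : ∀ k, 0 ≤ w k) {z : ℤ}
    (hz : z < 0) {a : MvPolynomial σ R} (ha : IsWeightedHomogeneous w a z) : a = 0 := by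
  ext s
  by_contra h
  have hs : 0 ≤ Finsupp.weight w s := by
    rw [Finsupp.weight_apply]
    exact Finset.sum_nonneg fun k _ => nsmul_nonneg (hw k) _
  exact hz.not_ge (ha h ▸ hs)

end CommSemiring

theorem pderiv_comm [CommRing R] (j k : σ) (f : MvPolynomial σ R) :
    pderiv j (pderiv k f) = pderiv k (pderiv j f) := by
  classical
  induction f using MvPolynomial.induction_on with
  | C a => simp only [pderiv_C, map_zero]
  | add p q hp hq => simp only [map_add, hp, hq]
  | mul_X p i hp =>
    simp only [mul_comm p, pderiv_X_mul, map_add, hp, apply_ite (pderiv _), map_zero]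
    abel

theorem eq_C_of_forall_pderiv_eq_zero [CommRing R] [IsDomain R] [CharZero R]
    {f : MvPolynomial σ R} (h : ∀ k, pderiv k f = 0) : f = C (constantCoeff f) := by
  classical
  ext s
  rw [coeff_C, constantCoeff_eq]
  split_ifs with hs
  · rw [hs]
  · obtain ⟨k, hk⟩ := Finsupp.ne_iff.1 (Ne.symm hs)
    have hcoeff := congrArg (coeff (s - Finsupp.single k 1)) (h k)
    rw [coeff_pderiv, tsub_add_cancel_of_le (Finsupp.single_le_iff.2
      (Nat.one_le_iff_ne_zero.2 hk)), coeff_zero] at hcoeff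
    exact (mul_eq_zero.1 hcoeff).resolve_right (Nat.cast_add_one_ne_zero _)

end Polynomial

/-! ### Modes of fields -/

theorem eventually_ncoeff_add_eq_zero (A : VertexOperator ℂ Fock) (v : Fock) (c : ℤ) :
    ∀ᶠ i : ℕ in atTop, ncoeff A (c + i) v = 0 := by
  obtain ⟨N, hN⟩ := exists_ncoeff_eq_zero A v
  filter_upwards [eventually_ge_atTop (N - c).toNat] with i hi
  exact hN _ (by omega)

theorem ncoeff_ofModes (A : ℤ → Module.End ℂ Fock) (hA) (n : ℤ) :
    ncoeff (ofModes A hA) n = A n := by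
  rw [ofModes, VertexOperator.ncoeff_of_coeff]
  congr 1
  ring

theorem ncoeff_identityField (n : ℤ) :
    ncoeff identityField n = if n = -1 then LinearMap.id else 0 :=
  ncoeff_ofModes _ _ _

theorem eventually_ncoeff_normalOrder (A B : VertexOperator ℂ Fock) (n : ℤ) (v : Fock) :
    ∀ᶠ N in atTop, ncoeff (normalOrder A B) n v =
      ∑ i ∈ range N, (ncoeff A (-1 - i) (ncoeff B (n + i) v) +
        ncoeff B (n - 1 - i) (ncoeff A i v)) := by
  have hAB := eventually_finsum_eq_sum_range <| finite_support_nat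
    (exists_ncoeff_eq_zero B v) n (F := fun i => ncoeff A (-1 - i))
  have hBA := eventually_finsum_eq_sum_range <| finite_support_nat
    (exists_ncoeff_eq_zero A v) 0 (F := fun i => ncoeff B (n - 1 - i))
  filter_upwards [hAB, hBA] with N hAB hBA
  rw [normalOrder, ncoeff_ofModes]
  simp only [zero_add] at hBA
  simp only [normalOrderMode, LinearMap.coe_mk, AddHom.coe_mk, zero_add, hAB, hBA,
    sum_add_distrib]

theorem ncoeff_normalOrder_smul (A B : VertexOperator ℂ Fock) (c : ℂ) (n : ℤ) (v : Fock) :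
    ncoeff (normalOrder A (c • B)) n v = c • ncoeff (normalOrder A B) n v := by
  obtain ⟨N, h1, h2⟩ := ((eventually_ncoeff_normalOrder A (c • B) n v).and
    (eventually_ncoeff_normalOrder A B n v)).exists
  simp only [h1, h2, map_smul, Pi.smul_apply, LinearMap.smul_apply, smul_sum, smul_add]

theorem commutator_normalOrder {ι : Type*} {O : Module.End ℂ Fock} {A B : VertexOperator ℂ Fock}
    {g : ℂ} {p e₀ : ℤ} {S : Finset ι} {e d : ι → ℤ} {D : ι → VertexOperator ℂ Fock}
    (hA : ∀ n v, O (ncoeff A n v) = ncoeff A n (O v) + if n = p then g • e₀ • v else 0)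
    (hB : ∀ n v, O (ncoeff B n v) =
      ncoeff B n (O v) + g • ∑ j ∈ S, e j • ncoeff (D j) (n + d j) v) (n : ℤ) (v : Fock) :
    O (ncoeff (normalOrder A B) n v) = ncoeff (normalOrder A B) n (O v) +
      g • (e₀ • ncoeff B (n - 1 - p) v +
        ∑ j ∈ S, e j • ncoeff (normalOrder A (D j)) (n + d j) v) := by
  obtain ⟨N, ⟨h1, h2⟩, h3, h4⟩ := (((eventually_ncoeff_normalOrder A B n v).and
    (eventually_ncoeff_normalOrder A B n (O v))).and
    ((eventually_sum_range_ite_eq p fun q => g • e₀ • ncoeff B (n - 1 - q) v).and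
    ((Filter.eventually_all_finset S).2 fun j _ =>
      eventually_ncoeff_normalOrder A (D j) (n + d j) v))).exists
  have h5 : ∑ j ∈ S, e j • ncoeff (normalOrder A (D j)) (n + d j) v = ∑ i ∈ range N, ∑ j ∈ S,
      e j • (ncoeff A (-1 - i) (ncoeff (D j) (n + i + d j) v) +
        ncoeff (D j) (n - 1 - i + d j) (ncoeff A i v)) := by
    rw [sum_comm]
    refine sum_congr rfl fun j hj => ?_
    rw [h4 j hj, smul_sum]
    refine sum_congr rfl fun i _ => ?_
    rw [add_right_comm, show n + d j - 1 - (i : ℤ) = n - 1 - i + d j by ring]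
  rw [smul_add, ← h3, h5, h1, h2, map_sum, smul_sum, ← sum_add_distrib, ← sum_add_distrib]
  refine sum_congr rfl fun i _ => ?_
  rw [map_add, hA, hB, hB, hA, map_add, map_add, apply_ite (ncoeff B (n - 1 - i)),
    show n - 1 - (-1 - (i : ℤ)) = n + i by ring]
  simp only [map_smul, map_sum, map_zsmul, map_zero, smul_add, sum_add_distrib]
  abel

/-! ### Families of oscillators -/

/-- A family of operators `bₙ` with `bₙ v = 0` for `n ≫ 0`, so that `∑ₙ bₙ z⁻ⁿ⁻¹` is a field. The
underlying space is always the space of polynomials in countably many variables, so that the fields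
of the vertex algebra and of its modules are treated alike. -/
structure OscillatorFamily where
  /-- The oscillators `bₙ`. -/
  osc : ℤ → Module.End ℂ Fock
  exists_osc_eq_zero : ∀ v, ∃ N : ℤ, ∀ n, N ≤ n → osc n v = 0

namespace OscillatorFamily

/-- The field `(1/k!) ∂ᵏ b(z)`, where `b(z) = ∑ₙ bₙ z⁻ⁿ⁻¹`. -/
def field (ρ : OscillatorFamily) (k : ℕ) : VertexOperator ℂ Fock :=
  ofModes (fun n => ((-1 : ℤ) ^ k * Ring.choose n k) • ρ.osc (n - k)) fun v => by
    obtain ⟨N, hN⟩ := ρ.exists_osc_eq_zero v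
    exact ⟨N + k, fun n hn => by simp [hN (n - k) (by omega)]⟩

/-- The fields `Y(a, z)` of states `a ∈ π` acting through a family of oscillators: the state-field
correspondence with `b(z)` replaced by the field of the family. -/
def Y (ρ : OscillatorFamily) : Fock →ₗ[ℂ] VertexOperator ℂ Fock :=
  (basisMonomials ℕ ℂ).constr ℂ fun s : ℕ →₀ ℕ =>
    ((Finsupp.toMultiset s).sort).foldr (fun k A => normalOrder (ρ.field k) A) identityField

/-- The mode `a₍ₙ₎` of `Y(a, z) = ∑ₙ a₍ₙ₎ z⁻ⁿ⁻¹` for a family of oscillators. -/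
def act (ρ : OscillatorFamily) (n : ℤ) : Fock →ₗ[ℂ] Module.End ℂ Fock :=
  LinearMap.proj n ∘ₗ ncoeff ∘ₗ ρ.Y

variable (ρ : OscillatorFamily)

theorem ncoeff_field (k : ℕ) (n : ℤ) :
    ncoeff (ρ.field k) n = ((-1 : ℤ) ^ k * Ring.choose n k) • ρ.osc (n - k) :=
  ncoeff_ofModes _ _ _

theorem ncoeff_Y (a : Fock) (n : ℤ) : ncoeff (ρ.Y a) n = ρ.act n a := rfl

theorem Y_monomial_one (s : ℕ →₀ ℕ) : ρ.Y (monomial s 1) = ((Finsupp.toMultiset s).sort).foldr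
    (fun k A => normalOrder (ρ.field k) A) identityField := by
  have h := (basisMonomials ℕ ℂ).constr_basis ℂ (fun s : ℕ →₀ ℕ =>
    ((Finsupp.toMultiset s).sort).foldr (fun k A => normalOrder (ρ.field k) A) identityField) s
  rwa [coe_basisMonomials] at h

theorem Y_one : ρ.Y 1 = identityField := by
  simpa using ρ.Y_monomial_one 0

theorem act_one (n : ℤ) : ρ.act n 1 = if n = -1 then LinearMap.id else 0 := by
  rw [← ncoeff_Y, Y_one, ncoeff_identityField]

theorem exists_act_eq_zero (a v : Fock) : ∃ N : ℤ, ∀ n, N ≤ n → ρ.act n a v = 0 :=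
  exists_ncoeff_eq_zero (ρ.Y a) v

theorem Y_X_mul_monomial_one {k : ℕ} {s : ℕ →₀ ℕ} (h : ∀ j ∈ s.support, k ≤ j) :
    ρ.Y (X k * monomial s 1) = normalOrder (ρ.field k) (ρ.Y (monomial s 1)) := by
  rw [X_mul_monomial, Y_monomial_one, Y_monomial_one, Finsupp.toMultiset_add,
    Finsupp.toMultiset_single, one_smul, Multiset.singleton_add, Multiset.sort_cons,
    List.foldr_cons]
  exact fun j hj => h j ((Finsupp.mem_toMultiset _ _).1 hj)

theorem act_X_mul_monomial {k : ℕ} {s : ℕ →₀ ℕ} (h : ∀ j ∈ s.support, k ≤ j) (c : ℂ) (n : ℤ)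
    (v : Fock) : ρ.act n (X k * monomial s c) v =
      ncoeff (normalOrder (ρ.field k) (ρ.Y (monomial s c))) n v := by
  rw [monomial_eq_smul_monomial_one, map_smul, ncoeff_normalOrder_smul,
    ← Y_X_mul_monomial_one ρ h, mul_smul_comm, map_smul]
  rfl

theorem eventually_act_X_mul_monomial {k : ℕ} {s : ℕ →₀ ℕ} (h : ∀ j ∈ s.support, k ≤ j) (n : ℤ)
    (v : Fock) : ∀ᶠ N in atTop, ρ.act n (X k * monomial s 1) v =
      ∑ i ∈ range N, (ncoeff (ρ.field k) (-1 - i) (ρ.act (n + i) (monomial s 1) v) +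
        ρ.act (n - 1 - i) (monomial s 1) (ncoeff (ρ.field k) i v)) := by
  filter_upwards [eventually_ncoeff_normalOrder (ρ.field k) (ρ.Y (monomial s 1)) n v] with N hN
  rw [act_X_mul_monomial ρ h, hN]
  rfl

/-! ### Operators with scalar commutators -/

/-- The relation `[O, b(z)] = g zʳ`, that is `[O, bₙ] = g δ_{n,-1-r}`. Annihilation and creation
operators satisfy it, and all commutators with modes are computed from it. -/
def HasCommutator (O : Module.End ℂ Fock) (g : ℂ) (r : ℤ) : Prop :=
  ∀ n v, O (ρ.osc n v) = ρ.osc n (O v) + if n = -1 - r then g • v else 0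

variable {ρ} {O : Module.End ℂ Fock} {g : ℂ} {r : ℤ}

theorem HasCommutator.field (h : ρ.HasCommutator O g r) (k : ℕ) (n : ℤ) (v : Fock) :
    O (ncoeff (ρ.field k) n v) = ncoeff (ρ.field k) n (O v) +
      if n = k - 1 - r then g • Ring.choose r k • v else 0 := by
  simp only [ncoeff_field, LinearMap.smul_apply, map_zsmul, h (n - k) v, smul_add]
  congr 1
  by_cases hn : n = k - 1 - r
  · rw [if_pos (by omega), if_pos hn, hn, smul_comm g,
      ← neg_one_pow_mul_choose_sub_one_sub r k]
  · rw [if_neg (by omega), if_neg hn, smul_zero]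

theorem HasCommutator.act (h : ρ.HasCommutator O g r) (a : Fock) :
    ∀ᶠ K in atTop, ∀ n v, O (ρ.act n a v) = ρ.act n a (O v) +
      g • ∑ k ∈ range K, Ring.choose r k • ρ.act (n + r - k) (pderiv k a) v := by
  induction a using induction_on_min with
  | one =>
    refine Eventually.of_forall fun K n v => ?_
    rw [act_one]
    split_ifs <;> simp
  | add p q hp hq =>
    filter_upwards [hp, hq] with K hp hq n v
    simp only [map_add, LinearMap.add_apply, hp, hq, smul_add, sum_add_distrib]
    abel
  | smul c p hp =>
    filter_upwards [hp] with K hp n v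
    simp only [Derivation.map_smul, map_smul, LinearMap.smul_apply, hp, smul_add, smul_sum,
      smul_comm c]
  | X_mul k s hs ih =>
    filter_upwards [ih, eventually_gt_atTop k] with K ih hK n v
    have hmul : ∀ j n v, ρ.act n (X k * pderiv j (monomial s 1)) v =
        ncoeff (normalOrder (ρ.field k) (ρ.Y (pderiv j (monomial s 1)))) n v := fun j n v => by
      rw [pderiv_monomial]
      exact ρ.act_X_mul_monomial (fun i hi => hs i (Finsupp.support_tsub hi)) _ _ _
    have key := commutator_normalOrder (A := ρ.field k) (B := ρ.Y (monomial s 1)) (h.field k)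
      (S := range K) (e := fun j => Ring.choose r j) (d := fun j => r - j)
      (D := fun j => ρ.Y (pderiv j (monomial s 1)))
      (fun n v => by
        simp only [← add_sub_assoc]
        exact ih n v) n v
    rw [← Y_X_mul_monomial_one ρ hs, ncoeff_Y] at key
    simp only [← hmul, ncoeff_Y, ← add_sub_assoc] at key
    rw [key]
    simp only [pderiv_X_mul, map_add, LinearMap.add_apply, apply_ite (ρ.act _),
      apply_ite (fun f : Module.End ℂ Fock => f v), map_zero, LinearMap.zero_apply, smul_add,
      smul_ite, smul_zero, sum_add_distrib, sum_ite_eq, mem_range.2 hK, if_true]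
    rw [show n - 1 - ((k : ℤ) - 1 - r) = n + r - k by ring, add_comm (g • Ring.choose r k • _)]

end OscillatorFamily

/-! ### Gradings -/

/-- The conformal weight of the variable `X k = b₋₍ₖ₊₁₎`, as an integer. -/
def conformalWeight (k : ℕ) : ℤ := k + 1

theorem conformalWeight_nonneg (k : ℕ) : 0 ≤ conformalWeight k := by
  rw [conformalWeight]
  omega

theorem mem_weightSpace {n : ℕ} {a : Fock} :
    a ∈ weightSpace n ↔ IsWeightedHomogeneous conformalWeight a n := by
  rw [weightSpace, mem_weightedHomogeneousSubmodule, ← isWeightedHomogeneous_natCast_iff]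
  push_cast
  rfl

namespace OscillatorFamily

/-- A family of oscillators is graded by a weight `w` of the variables when `bₙ` lowers the weight
by `n`. -/
def IsGraded (ρ : OscillatorFamily) (w : ℕ → ℤ) : Prop :=
  ∀ n z v, IsWeightedHomogeneous w v z → IsWeightedHomogeneous w (ρ.osc n v) (z - n)

variable {ρ : OscillatorFamily} {w : ℕ → ℤ}

theorem IsGraded.field (h : ρ.IsGraded w) (k : ℕ) {n z : ℤ} {v : Fock}
    (hv : IsWeightedHomogeneous w v z) :
    IsWeightedHomogeneous w (ncoeff (ρ.field k) n v) (z + k - n) := by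
  rw [ncoeff_field, LinearMap.smul_apply, ← sub_sub_eq_add_sub]
  exact (weightedHomogeneousSubmodule ℂ w _).toAddSubgroup.zsmul_mem (h (n - k) z v hv) _

theorem IsGraded.act (h : ρ.IsGraded w) {i n z : ℤ} {a v : Fock}
    (ha : IsWeightedHomogeneous conformalWeight a i) (hv : IsWeightedHomogeneous w v z) :
    IsWeightedHomogeneous w (ρ.act n a v) (z + i - n - 1) := by
  refine weightedHomogeneous_induction_on_min (P := fun i a => ∀ n z v,
    IsWeightedHomogeneous w v z → IsWeightedHomogeneous w (ρ.act n a v) (z + i - n - 1))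
    (fun n z v hv => ?_) (fun i k s hs ih n z v hv => ?_) (fun i n z v _ => ?_)
    (fun i p q hp hq n z v hv => ?_) (fun i c p hp n z v hv => ?_) ha n z v hv
  · rw [act_one]
    split_ifs with hn
    · simpa [hn] using hv
    · exact isWeightedHomogeneous_zero _ _ _
  · obtain ⟨N, hN⟩ := (ρ.eventually_act_X_mul_monomial hs n v).exists
    rw [hN, conformalWeight]
    refine IsWeightedHomogeneous.sum _ _ _ fun j _ => .add ?_ ?_
    · convert h.field k (n := -1 - j) (ih (n + j) z v hv) using 1
      ring
    · convert ih (n - 1 - j) _ _ (h.field k (n := j) hv) using 1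
      ring
  · rw [map_zero]
    exact isWeightedHomogeneous_zero _ _ _
  · rw [map_add]
    exact (hp n z v hv).add (hq n z v hv)
  · rw [map_smul]
    exact (weightedHomogeneousSubmodule ℂ w _).smul_mem c (hp n z v hv)

theorem map_act {ρ τ : OscillatorFamily} (f : Fock →ₗ[ℂ] Fock)
    (hf : ∀ n v, f (ρ.osc n v) = τ.osc n (f v)) (n : ℤ) (a v : Fock) :
    f (ρ.act n a v) = τ.act n a (f v) := by
  have hfield (k : ℕ) (n : ℤ) (v : Fock) :
      f (ncoeff (ρ.field k) n v) = ncoeff (τ.field k) n (f v) := by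
    simp only [ncoeff_field, LinearMap.smul_apply, map_zsmul, hf]
  induction a using induction_on_min generalizing n v with
  | one =>
    rw [act_one, act_one]
    split_ifs
    · rfl
    · exact map_zero f
  | add p q hp hq => simp only [map_add, LinearMap.add_apply, hp, hq]
  | smul c p hp => simp only [map_smul, LinearMap.smul_apply, hp]
  | X_mul k s hs ih =>
    obtain ⟨N, hρ, hτ⟩ := ((ρ.eventually_act_X_mul_monomial hs n v).and
      (τ.eventually_act_X_mul_monomial hs n (f v))).exists
    simp only [hρ, hτ, map_sum, map_add, hfield, ih]

end OscillatorFamily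

/-! ### The vacuum -/

/-- The oscillators of the vertex algebra `π` itself. -/
def fockFamily : OscillatorFamily := ⟨oscillator, exists_oscillator_eq_zero⟩

theorem nthProduct_eq_act (n : ℤ) (a b : Fock) : nthProduct n a b = fockFamily.act n a b := rfl

theorem oscillator_nonneg_one {n : ℤ} (hn : 0 ≤ n) : oscillator n 1 = 0 := by
  match n, hn with
  | Int.ofNat 0, _ => rfl
  | Int.ofNat (k + 1), _ => simp [oscillator]

theorem ncoeff_field_nonneg_one (k : ℕ) {n : ℤ} (hn : 0 ≤ n) :
    ncoeff (fockFamily.field k) n 1 = 0 := by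
  rw [OscillatorFamily.ncoeff_field, LinearMap.smul_apply]
  rcases lt_or_ge n k with h | h
  · rw [choose_eq_zero_of_lt hn h, mul_zero, zero_smul]
  · exact (congrArg _ (oscillator_nonneg_one (by omega))).trans (smul_zero _)

theorem ncoeff_field_neg (k i : ℕ) (v : Fock) :
    ncoeff (fockFamily.field k) (-1 - i) v = Ring.choose (k + i : ℤ) k • (X (k + i) * v) := by
  rw [OscillatorFamily.ncoeff_field, LinearMap.smul_apply,
    ← neg_one_pow_mul_choose_sub_one_sub (k + i : ℤ),
    show (k - 1 - (k + i) : ℤ) = -1 - i by ring,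
    show (-1 - i - k : ℤ) = Int.negSucc (k + i) by rw [Int.negSucc_eq]; push_cast; ring]
  rfl

theorem ncoeff_field_neg_one (k : ℕ) (v : Fock) :
    ncoeff (fockFamily.field k) (-1) v = X k * v := by
  simpa [Ring.choose_natCast] using ncoeff_field_neg k 0 v

theorem act_nonneg_vacuum (a : Fock) {n : ℤ} (hn : 0 ≤ n) : fockFamily.act n a 1 = 0 := by
  induction a using induction_on_min generalizing n with
  | one =>
    rw [OscillatorFamily.act_one, if_neg (by omega)]
    rfl
  | add p q hp hq => rw [map_add, LinearMap.add_apply, hp hn, hq hn, add_zero]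
  | smul c p hp => rw [map_smul, LinearMap.smul_apply, hp hn, smul_zero]
  | X_mul k s hs ih =>
    obtain ⟨N, hN⟩ := (fockFamily.eventually_act_X_mul_monomial hs n 1).exists
    rw [hN]
    refine sum_eq_zero fun i _ => ?_
    rw [ih (by omega), ncoeff_field_nonneg_one k (by omega), map_zero, map_zero, add_zero]

theorem act_neg_one_vacuum (a : Fock) : fockFamily.act (-1) a 1 = a := by
  induction a using induction_on_min with
  | one =>
    rw [OscillatorFamily.act_one, if_pos rfl]
    rfl
  | add p q hp hq => rw [map_add, LinearMap.add_apply, hp, hq]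
  | smul c p hp => rw [map_smul, LinearMap.smul_apply, hp]
  | X_mul k s hs ih =>
    obtain ⟨N, hN, h0⟩ := ((fockFamily.eventually_act_X_mul_monomial hs (-1) 1).and
      (eventually_gt_atTop 0)).exists
    rw [hN, sum_eq_single_of_mem 0 (mem_range.2 h0) fun i _ hi => ?_]
    · rw [ncoeff_field_nonneg_one k (Int.natCast_nonneg 0), map_zero, Nat.cast_zero, sub_zero,
        add_zero, add_zero, ih, ncoeff_field_neg_one]
    · rw [act_nonneg_vacuum _ (by omega), ncoeff_field_nonneg_one k (by omega), map_zero, map_zero,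
        add_zero]

/-! ### Translation covariance -/

theorem translation_X (k : ℕ) : translation (X k) = ((k : ℂ) + 1) • X (k + 1) := by
  simp [translation]

theorem translation_mul (f g : Fock) :
    translation (f * g) = f * translation g + g * translation f := by
  simp [translation, Derivation.leibniz]

theorem translation_C (c : ℂ) : translation (C c) = 0 := by simp [translation]

theorem translation_one : translation 1 = 0 := translation_C 1

theorem constantCoeff_translation (f : Fock) : constantCoeff (translation f) = 0 := by
  induction f using MvPolynomial.induction_on with
  | C a => rw [translation_C, map_zero]
  | add p q hp hq => rw [map_add, map_add, hp, hq, add_zero]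
  | mul_X p k hp => simp [translation_mul, translation_X, hp]

theorem pderiv_translation_X (k j : ℕ) :
    pderiv k (translation (X j)) = (k : ℂ) • pderiv (k - 1) (X j : Fock) := by
  rw [translation_X, Derivation.map_smul]
  rcases k with _ | k
  · rw [pderiv_X_of_ne j.succ_ne_zero, smul_zero, Nat.cast_zero, zero_smul]
  · rcases eq_or_ne j k with rfl | h
    · rw [pderiv_X_self, Nat.add_sub_cancel, pderiv_X_self, Nat.cast_succ]
    · rw [pderiv_X_of_ne (by omega), Nat.add_sub_cancel, pderiv_X_of_ne h, smul_zero, smul_zero]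

theorem pderiv_translation (k : ℕ) (f : Fock) :
    pderiv k (translation f) = translation (pderiv k f) + (k : ℂ) • pderiv (k - 1) f := by
  induction f using MvPolynomial.induction_on with
  | C a => simp only [translation_C, pderiv_C, map_zero, smul_zero, add_zero]
  | add p q hp hq =>
    simp only [map_add, hp, hq, smul_add]
    abel
  | mul_X p j hp =>
    have h : translation (pderiv k (X j : Fock)) = 0 := by
      rcases eq_or_ne j k with rfl | h
      · rw [pderiv_X_self, translation_one]
      · rw [pderiv_X_of_ne h, map_zero]
    simp only [translation_mul, Derivation.leibniz, map_add, hp, pderiv_translation_X, smul_eq_mul,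
      h, mul_zero, smul_add, Algebra.mul_smul_comm, mul_add]
    ring

/-- The relation `[T, A(z)] = ∂A(z)` for a field `A(z)`. -/
def IsTranslationCovariant (A : VertexOperator ℂ Fock) : Prop :=
  ∀ (n : ℤ) (v : Fock),
    translation (ncoeff A n v) = ncoeff A n (translation v) - n • ncoeff A (n - 1) v

theorem translation_oscillator (n : ℤ) (v : Fock) :
    translation (oscillator n v) = oscillator n (translation v) - n • oscillator (n - 1) v := by
  match n with
  | Int.ofNat 0 => simp [oscillator]
  | Int.ofNat (k + 1) =>
    have hk : oscillator (Int.ofNat (k + 1) - 1) v = (k : ℂ) • pderiv (k - 1) v := by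
      rcases k with _ | k
      · simp [oscillator]
      · rw [show (Int.ofNat (k + 1 + 1) - 1 : ℤ) = Int.ofNat (k + 1) by simp]
        simp [oscillator]
    rw [hk, ← Int.cast_smul_eq_zsmul ℂ]
    simp [oscillator, pderiv_translation]
  | Int.negSucc k =>
    rw [show (Int.negSucc k - 1 : ℤ) = Int.negSucc (k + 1) by
      rw [Int.negSucc_eq, Int.negSucc_eq]; push_cast; ring]
    simp only [oscillator, LinearMap.mulLeft_apply, translation_mul, translation_X]
    rw [← Int.cast_smul_eq_zsmul ℂ, Int.negSucc_eq]
    push_cast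
    rw [neg_smul, sub_neg_eq_add, mul_smul_comm, mul_comm v]

theorem isTranslationCovariant_field (k : ℕ) : IsTranslationCovariant (fockFamily.field k) := by
  intro n v
  simp only [OscillatorFamily.ncoeff_field, LinearMap.smul_apply, map_zsmul]
  rw [fockFamily, translation_oscillator, smul_sub, smul_smul, smul_smul, sub_right_comm n 1,
    mul_assoc, mul_comm (Ring.choose n k), sub_mul_choose, mul_left_comm]

theorem isTranslationCovariant_identityField : IsTranslationCovariant identityField := by
  intro n v
  rw [ncoeff_identityField, ncoeff_identityField]
  rcases eq_or_ne n 0 with rfl | h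
  · simp
  · rw [if_neg (show ¬n - 1 = -1 by omega), LinearMap.zero_apply, smul_zero, sub_zero]
    split_ifs
    · rfl
    · exact map_zero translation

/-- The sum of the `i`-th terms telescopes. -/
theorem IsTranslationCovariant.normalOrder {A B : VertexOperator ℂ Fock}
    (hA : IsTranslationCovariant A) (hB : IsTranslationCovariant B) :
    IsTranslationCovariant (normalOrder A B) := by
  intro n v
  set h : ℕ → Fock := fun i => i • (ncoeff A (-1 - i) (ncoeff B (n - 1 + i) v) +
    ncoeff B (n - 1 - i) (ncoeff A (-1 + i) v)) with hh
  have hstep (i : ℕ) : translation (ncoeff A (-1 - i) (ncoeff B (n + i) v) +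
      ncoeff B (n - 1 - i) (ncoeff A i v)) =
        ncoeff A (-1 - i) (ncoeff B (n + i) (translation v)) +
          ncoeff B (n - 1 - i) (ncoeff A i (translation v)) -
        n • (ncoeff A (-1 - i) (ncoeff B (n - 1 + i) v) +
          ncoeff B (n - 1 - 1 - i) (ncoeff A i v)) + (h (i + 1) - h i) := by
    have e1 := hA (-1 - i) (ncoeff B (n + i) v)
    have e2 := hB (n - 1 - i) (ncoeff A i v)
    rw [hB, map_sub, map_zsmul] at e1
    rw [hA, map_sub, map_zsmul] at e2
    simp only [hh, map_add, e1, e2, Nat.cast_succ]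
    rw [show -1 - (i : ℤ) - 1 = -1 - (i + 1) by ring, show n + (i : ℤ) - 1 = n - 1 + i by ring,
      show n - 1 + ((i : ℤ) + 1) = n + i by ring,
      show n - 1 - (i : ℤ) - 1 = n - 1 - (i + 1) by ring,
      show n - 1 - 1 - (i : ℤ) = n - 1 - (i + 1) by ring, show -1 + ((i : ℤ) + 1) = i by ring,
      show (i : ℤ) - 1 = -1 + i by ring]
    module
  obtain ⟨N, ⟨h1, h2, h3⟩, h4, h5⟩ := (((eventually_ncoeff_normalOrder A B n v).and
    ((eventually_ncoeff_normalOrder A B n (translation v)).and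
    (eventually_ncoeff_normalOrder A B (n - 1) v))).and
    ((eventually_ncoeff_add_eq_zero B v (n - 1)).and
    (eventually_ncoeff_add_eq_zero A v (-1)))).exists
  have h0 : h 0 = 0 := zero_smul ℕ _
  have hN : h N = 0 := by simp only [hh, h4, h5, map_zero, add_zero, smul_zero]
  rw [h1, map_sum, sum_congr rfl fun i _ => hstep i, sum_add_distrib, sum_range_sub, h0, hN,
    sub_zero, add_zero, sum_sub_distrib, ← smul_sum, ← h2, ← h3]

theorem translation_act (a : Fock) : IsTranslationCovariant (fockFamily.Y a) := by
  induction a using induction_on_min with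
  | one => exact fockFamily.Y_one ▸ isTranslationCovariant_identityField
  | add p q hp hq =>
    intro n v
    simp only [map_add, Pi.add_apply, LinearMap.add_apply, hp n v, hq n v, smul_add]
    abel
  | smul c p hp =>
    intro n v
    simp only [map_smul, Pi.smul_apply, LinearMap.smul_apply, hp n v, smul_sub, smul_comm c]
  | X_mul k s hs ih =>
    exact fockFamily.Y_X_mul_monomial_one hs ▸ (isTranslationCovariant_field k).normalOrder ih

theorem constantCoeff_act_act_vacuum (a v : Fock) (p : ℤ) (t : ℕ) :
    constantCoeff (fockFamily.act p a (fockFamily.act (-1 - t) v 1)) =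
      (Ring.choose p t : ℤ) * constantCoeff (fockFamily.act (p - t) a v) := by
  induction t generalizing p with
  | zero => simp [act_neg_one_vacuum]
  | succ t ih =>
    have h1 := translation_act v (-1 - t) 1
    rw [translation_one, map_zero, zero_sub, ← neg_smul] at h1
    have h2 := congrArg constantCoeff (translation_act a p (fockFamily.act (-1 - t) v 1))
    simp only [OscillatorFamily.ncoeff_Y] at h1 h2
    rw [constantCoeff_translation, map_sub, h1, map_zsmul, map_zsmul, map_zsmul, ih] at h2
    have h3 := congrArg (Int.cast (R := ℂ)) (succ_mul_choose_succ' p t)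
    rw [show (-1 - (t : ℤ) - 1) = -1 - ((t + 1 : ℕ) : ℤ) by push_cast; ring,
      show (p - 1 - t : ℤ) = p - ((t + 1 : ℕ) : ℤ) by push_cast; ring] at h2
    refine mul_left_cancel₀ (Nat.cast_add_one_ne_zero t : (t : ℂ) + 1 ≠ 0) ?_
    simp only [zsmul_eq_mul] at h2
    push_cast at h2 h3 ⊢
    rw [← mul_assoc, h3]
    linear_combination -h2

/-! ### Creation and annihilation operators -/

theorem fockFamily_hasCommutator_pderiv (k : ℕ) :
    fockFamily.HasCommutator (pderiv k).toLinearMap 1 k := by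
  intro n v
  match n with
  | Int.ofNat 0 =>
    rw [if_neg (by simp; omega)]
    simp [fockFamily, oscillator]
  | Int.ofNat (j + 1) =>
    rw [if_neg (by simp; omega)]
    simp only [fockFamily, oscillator, LinearMap.smul_apply, map_smul, Derivation.coeFn_coe,
      pderiv_comm k j, add_zero]
  | Int.negSucc j =>
    simp only [fockFamily, oscillator, LinearMap.mulLeft_apply, Derivation.coeFn_coe,
      pderiv_X_mul j k v, one_smul]
    congr 1
    refine if_congr ?_ rfl rfl
    rw [Int.negSucc_eq]
    omega

theorem fockFamily_hasCommutator_mulLeft_X (k : ℕ) :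
    fockFamily.HasCommutator (LinearMap.mulLeft ℂ (X k)) (-((k : ℂ) + 1)) (-2 - k) := by
  intro n v
  match n with
  | Int.ofNat 0 =>
    rw [if_neg (by simp; omega)]
    simp [fockFamily, oscillator]
  | Int.ofNat (j + 1) =>
    simp only [fockFamily, oscillator, LinearMap.mulLeft_apply, LinearMap.smul_apply,
      Derivation.coeFn_coe, pderiv_X_mul k j v, mul_smul_comm, smul_add, Int.ofNat_eq_natCast]
    rcases eq_or_ne k j with rfl | h
    · rw [if_pos rfl, if_pos (by push_cast; ring)]
      module
    · rw [if_neg h, if_neg (by push_cast; omega)]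
      simp
  | Int.negSucc j =>
    rw [if_neg (by rw [Int.negSucc_eq]; omega)]
    simp only [fockFamily, oscillator, LinearMap.mulLeft_apply]
    ring

/-! ### Skew symmetry -/

theorem constantCoeff_X_mul {σ R : Type*} [CommSemiring R] (k : σ) (f : MvPolynomial σ R) :
    constantCoeff (X k * f) = 0 := by
  rw [map_mul, constantCoeff_X, zero_mul]

theorem succ_mul_choose_neg_two_sub (k t : ℕ) :
    ((k : ℤ) + 1) * Ring.choose (-2 - k : ℤ) t =
      (-1) ^ t * Ring.choose ((k + 1 + t : ℕ) : ℤ) k * (t + 1) := by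
  have hreflect := neg_one_pow_mul_choose_sub_one_sub (-2 - k : ℤ) t
  have hsucc := succ_mul_choose_succ ((k + 1 + t : ℕ) : ℤ) k
  rw [Ring.choose_natCast, Ring.choose_natCast] at hsucc
  rw [show (t : ℤ) - 1 - (-2 - k) = ((k + 1 + t : ℕ) : ℤ) by push_cast; ring,
    Ring.choose_natCast, ← Nat.choose_symm_add] at hreflect
  rw [← hreflect, Ring.choose_natCast]
  push_cast at hsucc ⊢
  linear_combination (-1) ^ t * hsucc

theorem ncoeff_field_eq_zero {k t : ℕ} (h : t < k + 1) : ncoeff (fockFamily.field k) t = 0 := by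
  rw [OscillatorFamily.ncoeff_field]
  rcases (Nat.lt_succ_iff.1 h).lt_or_eq with h | rfl
  · rw [choose_eq_zero_of_lt (by omega) (by omega), mul_zero, zero_smul]
  · rw [sub_self]
    exact smul_zero _

theorem ncoeff_field_add (k t : ℕ) (v : Fock) :
    ncoeff (fockFamily.field k) ((k + 1 + t : ℕ) : ℤ) v =
      ((-1) ^ k * Ring.choose ((k + 1 + t : ℕ) : ℤ) k) • ((t : ℂ) + 1) • pderiv t v := by
  rw [OscillatorFamily.ncoeff_field,
    show ((k + 1 + t : ℕ) : ℤ) - k = Int.ofNat (t + 1) by simp; omega]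
  rfl

theorem eventually_constantCoeff_act_X_mul_monomial {k : ℕ} {s : ℕ →₀ ℕ}
    (hs : ∀ j ∈ s.support, k ≤ j) (n : ℤ) (v : Fock) : ∀ᶠ K in atTop,
      constantCoeff (fockFamily.act n (X k * monomial s 1) v) = ∑ t ∈ range K,
        ((-1) ^ k * (Ring.choose ((k + 1 + t : ℕ) : ℤ) k : ℤ) * ((t : ℂ) + 1)) *
          constantCoeff (fockFamily.act (n - 2 - k - t) (monomial s 1) (pderiv t v)) := by
  obtain ⟨N, hN⟩ := eventually_atTop.1 (fockFamily.eventually_act_X_mul_monomial hs n v)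
  filter_upwards [eventually_ge_atTop N] with K hK
  have hcreation (i : ℕ) (u : Fock) :
      constantCoeff (ncoeff (fockFamily.field k) (-1 - i) u) = 0 := by
    rw [ncoeff_field_neg, map_zsmul, constantCoeff_X_mul, smul_zero]
  simp only [hN (k + 1 + K) (by omega), map_sum, map_add, hcreation, zero_add]
  rw [sum_range_add, sum_eq_zero fun t ht => ?_, zero_add]
  · refine sum_congr rfl fun t _ => ?_
    rw [ncoeff_field_add, map_zsmul, map_zsmul, map_smul, constantCoeff_smul, zsmul_eq_mul,
      smul_eq_mul, show n - 1 - ((k + 1 + t : ℕ) : ℤ) = n - 2 - k - t by push_cast; ring]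
    push_cast
    ring
  · rw [ncoeff_field_eq_zero (mem_range.1 ht), LinearMap.zero_apply, map_zero, map_zero]

theorem eventually_constantCoeff_act_mul_X (k : ℕ) (n : ℤ) (a v : Fock) : ∀ᶠ K in atTop,
    constantCoeff (fockFamily.act n v (X k * a)) =
      ∑ t ∈ range K, ((k : ℂ) + 1) * (Ring.choose (-2 - k : ℤ) t : ℤ) *
        constantCoeff (fockFamily.act (n - 2 - k - t) (pderiv t v) a) := by
  filter_upwards [(fockFamily_hasCommutator_mulLeft_X k).act v] with K hK
  have h := congrArg constantCoeff (hK n a)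
  simp only [LinearMap.mulLeft_apply, constantCoeff_X_mul, map_add, constantCoeff_smul, map_sum,
    map_zsmul] at h
  simp only [show ∀ t : ℕ, n + (-2 - (k : ℤ)) - t = n - 2 - k - t from fun t => by ring,
    zsmul_eq_mul, smul_eq_mul] at h
  simp only [mul_assoc, ← mul_sum]
  linear_combination -h

theorem negOnePow_sub_natCast_sub_natCast_sub_two (z : ℤ) (k t : ℕ) :
    ((z - k - t - 2).negOnePow : ℤ) = (z.negOnePow : ℤ) * (-1) ^ k * (-1) ^ t := by
  rw [Int.negOnePow_sub, Int.negOnePow_sub, Int.negOnePow_sub, show Int.negOnePow 2 = 1 from rfl]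
  push_cast
  rw [negOnePow_natCast, negOnePow_natCast, mul_one]

theorem constantCoeff_act_comm {i j : ℤ} {a v : Fock}
    (ha : IsWeightedHomogeneous conformalWeight a i)
    (hv : IsWeightedHomogeneous conformalWeight v j) :
    constantCoeff (fockFamily.act (i + j - 1) v a) =
      ((i + j).negOnePow : ℤ) * constantCoeff (fockFamily.act (i + j - 1) a v) := by
  refine weightedHomogeneous_induction_on_min (P := fun i a => ∀ j v,
    IsWeightedHomogeneous conformalWeight v j → constantCoeff (fockFamily.act (i + j - 1) v a) =
      ((i + j).negOnePow : ℤ) * constantCoeff (fockFamily.act (i + j - 1) a v))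
    (fun j v hv => ?_) (fun i k s hs ih j v hv => ?_) (fun i j v _ => by simp)
    (fun i p q hp hq j v hv => by simp only [map_add, LinearMap.add_apply, hp j v hv, hq j v hv,
      mul_add])
    (fun i c p hp j v hv => by simp only [map_smul, LinearMap.smul_apply, constantCoeff_smul,
      hp j v hv, mul_smul_comm]) ha j v hv
  · rw [OscillatorFamily.act_one, zero_add]
    rcases lt_trichotomy j 0 with h | rfl | h
    · rw [eq_zero_of_isWeightedHomogeneous_of_neg conformalWeight_nonneg h hv]
      simp
    · simp [act_neg_one_vacuum]
    · rw [act_nonneg_vacuum _ (by omega), if_neg (by omega)]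
      simp
  · obtain ⟨K, hleft, hright⟩ :=
      ((eventually_constantCoeff_act_X_mul_monomial hs (conformalWeight k + i + j - 1) v).and
      (eventually_constantCoeff_act_mul_X k (conformalWeight k + i + j - 1)
        (monomial s 1) v)).exists
    rw [hleft, hright, mul_sum]
    refine sum_congr rfl fun t _ => ?_
    have hih := ih (j - conformalWeight t) (pderiv t v) (hv.pderiv (sub_add_cancel _ _))
    rw [show i + (j - conformalWeight t) = conformalWeight k + i + j - k - t - 2 by
      simp only [conformalWeight]; ring, negOnePow_sub_natCast_sub_natCast_sub_two,
      show conformalWeight k + i + j - k - t - 2 - 1 = conformalWeight k + i + j - 1 - 2 - k - t by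
        ring] at hih
    have hchoose := congrArg (Int.cast (R := ℂ)) (succ_mul_choose_neg_two_sub k t)
    have ht : (-1 : ℂ) ^ t * (-1) ^ t = 1 := by rw [← mul_pow]; simp
    push_cast at hih hchoose
    rw [hih, hchoose]
    push_cast
    linear_combination (((conformalWeight k + i + j).negOnePow : ℤ) * (-1 : ℂ) ^ k *
      (Ring.choose ((k : ℤ) + 1 + t) k : ℤ) * (t + 1) * constantCoeff (fockFamily.act
        (conformalWeight k + i + j - 1 - 2 - k - t) (monomial s 1) (pderiv t v))) * ht

/-! ### The universal Fock module -/

/-- The oscillators of the universal Fock module `ℂ[b₀] ⊗ π`, encoded as the polynomials in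
`X 0 = b₀` and `X k = b₋ₖ` for `k > 0`. -/
def universalOscillator : ℤ → Module.End ℂ Fock
  | Int.ofNat 0 => LinearMap.mulLeft ℂ (X 0)
  | Int.ofNat (k + 1) => ((k : ℂ) + 1) • (pderiv (k + 1)).toLinearMap
  | Int.negSucc k => LinearMap.mulLeft ℂ (X (k + 1))

/-- The universal Fock module as a family of oscillators: the module over which all Fock modules
are obtained by specializing the central parameter `b₀`. -/
def universalFamily : OscillatorFamily where
  osc := universalOscillator
  exists_osc_eq_zero v := by
    obtain ⟨K, hK⟩ := eventually_atTop.1 (eventually_pderiv_eq_zero v)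
    refine ⟨K + 1, fun n hn => ?_⟩
    match n, hn with
    | Int.ofNat 0, hn => simp only [Int.ofNat_eq_natCast] at hn; omega
    | Int.ofNat (k + 1), hn =>
      have := hK (k + 1) (by simp only [Int.ofNat_eq_natCast] at hn; omega)
      simp [universalOscillator, this]
    | Int.negSucc k, hn => omega

theorem universalFamily_hasCommutator_pderiv (k : ℕ) :
    universalFamily.HasCommutator (pderiv k).toLinearMap 1 (k - 1) := by
  intro n v
  match n with
  | Int.ofNat 0 =>
    simp only [universalFamily, universalOscillator, LinearMap.mulLeft_apply,
      Derivation.coeFn_coe, pderiv_X_mul 0 k v, one_smul]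
    congr 1
    refine if_congr ?_ rfl rfl
    simp only [Int.ofNat_eq_natCast]
    omega
  | Int.ofNat (j + 1) =>
    rw [if_neg (by simp; omega)]
    simp only [universalFamily, universalOscillator, LinearMap.smul_apply, map_smul,
      Derivation.coeFn_coe, pderiv_comm k (j + 1), add_zero]
  | Int.negSucc j =>
    simp only [universalFamily, universalOscillator, LinearMap.mulLeft_apply,
      Derivation.coeFn_coe, pderiv_X_mul (j + 1) k v, one_smul]
    congr 1
    refine if_congr ?_ rfl rfl
    rw [Int.negSucc_eq]
    omega

theorem universalFamily_hasCommutator_mulLeft_X (k : ℕ) :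
    universalFamily.HasCommutator (LinearMap.mulLeft ℂ (X k)) (-k) (-1 - k) := by
  intro n v
  match n with
  | Int.ofNat 0 =>
    simp only [universalFamily, universalOscillator, LinearMap.mulLeft_apply,
      mul_left_comm (X k) (X 0), left_eq_add, ite_eq_right_iff]
    intro h
    rw [show k = 0 by simp only [Int.ofNat_eq_natCast] at h; omega, Nat.cast_zero, neg_zero,
      zero_smul]
  | Int.ofNat (j + 1) =>
    simp only [universalFamily, universalOscillator, LinearMap.mulLeft_apply,
      LinearMap.smul_apply, Derivation.coeFn_coe, pderiv_X_mul k (j + 1) v, mul_smul_comm,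
      smul_add, Int.ofNat_eq_natCast]
    rcases eq_or_ne k (j + 1) with rfl | h
    · rw [if_pos rfl, if_pos (by push_cast; ring)]
      push_cast
      module
    · rw [if_neg h, if_neg (by push_cast; omega), smul_zero, add_zero, add_zero]
  | Int.negSucc j =>
    rw [if_neg (by rw [Int.negSucc_eq]; omega)]
    simp only [universalFamily, universalOscillator, LinearMap.mulLeft_apply]
    ring

/-- Specialization of the central parameter `b₀` of the universal Fock module to zero. -/
def specialize : Fock →ₐ[ℂ] Fock := aeval fun k => match k with
  | 0 => 0
  | k + 1 => X k

theorem specialize_X_zero : specialize (X 0) = 0 := aeval_X _ _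

theorem specialize_X_succ (k : ℕ) : specialize (X (k + 1)) = X k := aeval_X _ _

theorem specialize_pderiv (k : ℕ) (f : Fock) :
    specialize (pderiv (k + 1) f) = pderiv k (specialize f) := by
  induction f using MvPolynomial.induction_on with
  | C a => simp [specialize]
  | add p q hp hq => simp only [map_add, hp, hq]
  | mul_X p j hp =>
    rw [mul_comm, pderiv_X_mul, map_add, map_mul specialize, map_mul specialize, hp]
    match j with
    | 0 => simp [specialize_X_zero]
    | j + 1 =>
      rw [specialize_X_succ, pderiv_X_mul, apply_ite specialize, map_zero]
      simp only [add_left_inj]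

theorem specialize_oscillator (n : ℤ) (v : Fock) :
    specialize (universalOscillator n v) = oscillator n (specialize v) := by
  match n with
  | Int.ofNat 0 => simp [universalOscillator, oscillator, specialize_X_zero]
  | Int.ofNat (k + 1) => simp [universalOscillator, oscillator, specialize_pderiv]
  | Int.negSucc k => simp [universalOscillator, oscillator, specialize_X_succ]

theorem specialize_act (n : ℤ) (a v : Fock) :
    specialize (universalFamily.act n a v) = fockFamily.act n a (specialize v) :=
  OscillatorFamily.map_act (ρ := universalFamily) (τ := fockFamily) specialize.toLinearMap
    (fun n v => specialize_oscillator n v) n a v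

/-! ### Binomial identities -/

/-- The binomial coefficient `(m choose k)` with an integral lower index, equal to `0` for `k < 0`:
the coefficient of `xᵏ` in `(1 + x)ᵐ`. -/
def intChoose (m k : ℤ) : ℤ := if 0 ≤ k then Ring.choose m k.toNat else 0

theorem intChoose_natCast (m : ℤ) (k : ℕ) : intChoose m k = Ring.choose m k := if_pos (by omega)

theorem intChoose_of_neg (m : ℤ) {k : ℤ} (hk : k < 0) : intChoose m k = 0 := if_neg (by omega)

theorem intChoose_reflect (m k : ℤ) : intChoose m k = k.negOnePow * intChoose (k - 1 - m) k := by
  rcases lt_or_ge k 0 with hk | hk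
  · rw [intChoose_of_neg _ hk, intChoose_of_neg _ hk, mul_zero]
  · lift k to ℕ using hk
    rw [intChoose_natCast, intChoose_natCast, negOnePow_natCast,
      ← neg_one_pow_mul_choose_sub_one_sub]

theorem intChoose_symm {m : ℤ} (hm : 0 ≤ m) (k : ℤ) : intChoose m (m - k) = intChoose m k := by
  lift m to ℕ using hm
  have hzero {j : ℤ} (hj : j < 0) : intChoose m (m - j) = 0 := by
    obtain ⟨i, hi⟩ := Int.eq_ofNat_of_zero_le (show 0 ≤ m - j by omega)
    rw [hi, intChoose_natCast, choose_eq_zero_of_lt (by omega) (by omega)]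
  rcases lt_or_ge k 0 with hk | hk
  · rw [intChoose_of_neg _ hk, hzero hk]
  · rcases lt_or_ge (m - k : ℤ) 0 with hmk | hmk
    · rw [intChoose_of_neg _ hmk, ← sub_sub_cancel (m : ℤ) k, hzero hmk]
    · lift k to ℕ using hk
      rw [← Nat.cast_sub (by omega), intChoose_natCast, intChoose_natCast, Ring.choose_natCast,
        Ring.choose_natCast, Nat.choose_symm (by omega)]

theorem intChoose_add_add_one (m n : ℤ) : intChoose m (m + n + 1) =
    intChoose m (-1 - n) - (m + n).negOnePow * intChoose n (-1 - m) := by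
  rcases lt_or_ge m 0 with hm | hm
  · rcases lt_or_ge n 0 with hn | hn
    · rw [intChoose_of_neg _ (by omega), intChoose_reflect m, intChoose_reflect n,
        show -1 - n - 1 - m = -1 - n + (-1 - m) by ring,
        show -1 - m - 1 - n = -1 - n + (-1 - m) by ring,
        ← intChoose_symm (k := -1 - m) (by omega), add_sub_cancel_right, ← mul_assoc,
        ← Units.val_mul, ← Int.negOnePow_add, show m + n + (-1 - m) = -1 - n + (n + n) by ring,
        Int.negOnePow_add _ (n + n), Int.negOnePow_add n, Int.units_mul_self, mul_one, sub_self]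
    · rw [intChoose_of_neg m (show -1 - n < 0 by omega), zero_sub, intChoose_reflect m,
        show m + n + 1 - 1 - m = n by ring, ← intChoose_symm hn (-1 - m),
        show n - (-1 - m) = m + n + 1 by ring, Int.negOnePow_succ, Units.val_neg, neg_mul]
  · rw [intChoose_of_neg n (show -1 - m < 0 by omega), mul_zero, sub_zero, ← intChoose_symm hm]
    congr 1
    ring

theorem eventually_sum_choose_mul_intChoose (l m k : ℤ) : ∀ᶠ N in atTop,
    ∑ t ∈ range N, (-1) ^ t * Ring.choose l t * intChoose (m + l - t) (k - t) = intChoose m k := by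
  rcases lt_or_ge k 0 with hk | hk
  · refine Eventually.of_forall fun N => ?_
    rw [intChoose_of_neg m hk]
    exact sum_eq_zero fun t _ => by rw [intChoose_of_neg _ (by omega), mul_zero]
  · lift k to ℕ using hk
    filter_upwards [eventually_ge_atTop (k + 1)] with N hN
    rw [← sum_subset (range_mono hN) fun t _ ht => by
      rw [intChoose_of_neg _ (by rw [mem_range] at ht; omega), mul_zero], intChoose_natCast,
      ← neg_one_pow_mul_choose_sub_one_sub m k,
      show (k : ℤ) - 1 - m = l + (k - 1 - m - l) by ring, Ring.add_choose_eq k (Commute.all _ _),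
      Nat.sum_antidiagonal_eq_sum_range_succ_mk, mul_sum]
    refine sum_congr rfl fun t ht => ?_
    obtain ⟨u, rfl⟩ := Nat.exists_eq_add_of_le (Nat.lt_succ_iff.1 (mem_range.1 ht))
    rw [show ((t + u : ℕ) : ℤ) - t = u by push_cast; ring, intChoose_natCast,
      add_tsub_cancel_left, ← neg_one_pow_mul_choose_sub_one_sub (m + l - t) u, pow_add]
    push_cast
    rw [show (u : ℤ) - 1 - (m + l - t) = t + u - 1 - m - l by ring]
    ring

section Convolution

variable {R M : Type*} [CommRing R] [AddCommGroup M] [Module R M]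

theorem sum_convolution (c d : ℕ → R) {G : ℕ → M} {T : ℕ} (hG : ∀ t, T ≤ t → G t = 0) :
    ∑ i ∈ range T, ∑ k ∈ range T, (c i * d k) • G (i + k) =
      ∑ t ∈ range T, (∑ p ∈ antidiagonal t, c p.1 * d p.2) • G t := by
  have hfiber (t : ℕ) (ht : t ∈ range T) : (∑ p ∈ antidiagonal t, c p.1 * d p.2) • G t =
      ∑ p ∈ range T ×ˢ range T, if p.1 + p.2 = t then (c p.1 * d p.2) • G t else 0 := by
    rw [sum_smul, ← sum_filter]
    refine sum_congr ?_ fun _ _ => rfl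
    ext p
    simp only [HasAntidiagonal.mem_antidiagonal, mem_filter, mem_product, mem_range] at *
    omega
  rw [sum_congr rfl hfiber, sum_comm (s := range T) (t := _ ×ˢ _), sum_product]
  refine sum_congr rfl fun i _ => sum_congr rfl fun k _ => ?_
  rw [sum_ite_eq]
  split_ifs with h
  · rfl
  · rw [hG _ (by simpa using h), smul_zero]

theorem sum_choose_convolution [BinomialRing R] (m r : R) {s T K : ℕ} (hK : s + T ≤ K) {G : ℤ → M}
    (hG : ∀ t : ℕ, T ≤ t → G t = 0) : ∑ i ∈ range T, ∑ k ∈ range K,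
      (Ring.choose m i * (Ring.choose r k * Ring.choose (k : R) s)) • G (i + k - s) =
    Ring.choose r s • ∑ t ∈ range T, Ring.choose (m + r - s) t • G t := by
  obtain ⟨L, rfl⟩ : ∃ L, K = s + L := ⟨K - s, by omega⟩
  have hvandermonde (t : ℕ) : Ring.choose (m + r - s) t =
      ∑ p ∈ antidiagonal t, Ring.choose m p.1 * Ring.choose (r - s) p.2 := by
    rw [← Ring.add_choose_eq t (Commute.all m (r - s)), add_sub_assoc]
  have hchoose (k : ℕ) : Ring.choose r (s + k) * Ring.choose ((s + k : ℕ) : R) s =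
      Ring.choose r s * Ring.choose (r - s) k := by
    have h := Ring.choose_smul_choose r (Nat.le_add_right s k)
    rw [nsmul_eq_mul, add_tsub_cancel_left] at h
    rw [Ring.choose_natCast, mul_comm, h]
  simp only [hvandermonde]
  rw [← sum_convolution _ _ hG, smul_sum]
  refine sum_congr rfl fun i _ => ?_
  rw [sum_range_add, sum_eq_zero fun k hk => ?_, zero_add, smul_sum]
  · refine ((sum_subset (range_mono (show T ≤ L by omega)) fun k _ hk => ?_).trans ?_).symm
    · rw [hG _ (by rw [mem_range] at hk; omega), smul_zero, smul_zero]
    · refine sum_congr rfl fun k _ => ?_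
      rw [hchoose, smul_smul, mul_left_comm,
        show (i + (s + k : ℕ) - s : ℤ) = ((i + k : ℕ) : ℤ) by push_cast; ring]
  · rw [Ring.choose_natCast, Nat.choose_eq_zero_of_lt (mem_range.1 hk), Nat.cast_zero, mul_zero,
      mul_zero, zero_smul]

end Convolution

/-! ### Commutators with the Jacobi identity -/

theorem smul_sub_smul_add_smul_sum {ι R M : Type*} [CommRing R] [AddCommGroup M] [Module R M]
    (c e : ℤ) (g : R) (s : Finset ι) (z : ι → ℤ) (x y : M) (p q : ι → M) :
    c • (x + g • ∑ k ∈ s, z k • p k - e • (y + g • ∑ k ∈ s, z k • q k)) =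
      c • (x - e • y) + g • ∑ k ∈ s, z k • c • (p k - e • q k) := by
  have hsum : ∑ k ∈ s, z k • c • (p k - e • q k) =
      c • (∑ k ∈ s, z k • p k - e • ∑ k ∈ s, z k • q k) := by
    rw [smul_sum, ← sum_sub_distrib, smul_sum]
    exact sum_congr rfl fun k _ => by module
  rw [hsum]
  module

namespace OscillatorFamily

/-- The `i`-th term of the left-hand side of the Jacobi identity for the modes of a family of
oscillators. -/
def jacobiLeftTerm (ρ : OscillatorFamily) (a v : Fock) (l m n : ℤ) (i : ℕ) : Module.End ℂ Fock :=
  ((-1) ^ i * Ring.choose l i) • (ρ.act (m + l - i) a * ρ.act (n + i) v -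
    (l.negOnePow : ℤ) • (ρ.act (n + l - i) v * ρ.act (m + i) a))

/-- The `i`-th term of the right-hand side of the Jacobi identity for the modes of a family of
oscillators. -/
def jacobiRightTerm (ρ : OscillatorFamily) (a v : Fock) (l m n : ℤ) (i : ℕ) : Module.End ℂ Fock :=
  Ring.choose m i • ρ.act (m + n - i) (fockFamily.act (l + i) a v)

/-- The difference of the two sides of the Jacobi identity, truncated at the first `N` terms. On
each vector it is eventually independent of `N`. -/
def jacobiDefect (ρ : OscillatorFamily) (a v : Fock) (l m n : ℤ) (N : ℕ) : Module.End ℂ Fock :=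
  ∑ i ∈ range N, (ρ.jacobiLeftTerm a v l m n i - ρ.jacobiRightTerm a v l m n i)

variable {ρ : OscillatorFamily} {O : Module.End ℂ Fock} {g : ℂ} {r : ℤ}

theorem HasCommutator.act_eq (h : ρ.HasCommutator O g r) {a : Fock} {K : ℕ}
    (hK : ∀ k ≥ K, pderiv k a = 0) (n : ℤ) (v : Fock) : O (ρ.act n a v) = ρ.act n a (O v) +
      g • ∑ k ∈ range K, Ring.choose r k • ρ.act (n + r - k) (pderiv k a) v := by
  obtain ⟨L, hL, hKL⟩ := ((h.act a).and (eventually_ge_atTop K)).exists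
  rw [hL, sum_subset (range_mono hKL) fun k _ hk => ?_]
  rw [hK k (by simpa using hk), map_zero, LinearMap.zero_apply, smul_zero]

theorem HasCommutator.act_act (h : ρ.HasCommutator O g r) {a v : Fock} {K : ℕ}
    (ha : ∀ k ≥ K, pderiv k a = 0) (hv : ∀ k ≥ K, pderiv k v = 0) (p q : ℤ) (w : Fock) :
    O (ρ.act p a (ρ.act q v w)) = ρ.act p a (ρ.act q v (O w)) +
      g • ∑ k ∈ range K, Ring.choose r k • (ρ.act (p + r - k) (pderiv k a) (ρ.act q v w) +
        ρ.act p a (ρ.act (q + r - k) (pderiv k v) w)) := by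
  rw [h.act_eq ha, h.act_eq hv]
  simp only [map_add, map_smul, map_sum, map_zsmul, smul_add, sum_add_distrib]
  abel

theorem HasCommutator.jacobiLeftTerm (h : ρ.HasCommutator O g r) {a v : Fock} {K : ℕ}
    (ha : ∀ k ≥ K, pderiv k a = 0) (hv : ∀ k ≥ K, pderiv k v = 0) (l m n : ℤ) (i : ℕ) (w : Fock) :
    O (ρ.jacobiLeftTerm a v l m n i w) = ρ.jacobiLeftTerm a v l m n i (O w) +
      g • ∑ k ∈ range K, Ring.choose r k • (ρ.jacobiLeftTerm (pderiv k a) v l (m + r - k) n i w +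
        ρ.jacobiLeftTerm a (pderiv k v) l m (n + r - k) i w) := by
  have hshift (p q : ℤ) (k : ℕ) : p + q + r - k = p + r - k + q := by ring
  have hshift' (p : ℤ) (k : ℕ) : p + l - i + r - k = p + r - k + l - i := by ring
  simp only [OscillatorFamily.jacobiLeftTerm, LinearMap.smul_apply, LinearMap.sub_apply,
    Module.End.mul_apply, map_zsmul, map_sub, h.act_act ha hv, h.act_act hv ha, hshift', hshift]
  rw [smul_sub_smul_add_smul_sum]
  congr 2
  refine sum_congr rfl fun k _ => ?_
  module

theorem HasCommutator.jacobiRightTerm (h : ρ.HasCommutator O g r) {a : Fock} {K : ℕ}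
    (ha : ∀ k ≥ K, pderiv k a = 0) (v : Fock) (l m n : ℤ) (i : ℕ) (w : Fock) :
    ∀ᶠ L in atTop, O (ρ.jacobiRightTerm a v l m n i w) = ρ.jacobiRightTerm a v l m n i (O w) +
      g • (∑ k ∈ range L, Ring.choose r k • ρ.jacobiRightTerm a (pderiv k v) l m (n + r - k) i w +
        ∑ s ∈ range K, ∑ k ∈ range L,
          (Ring.choose m i * (Ring.choose r k * Ring.choose (k : ℤ) s)) •
            ρ.act (m + n + r - s - (i + k - s)) (fockFamily.act (l + (i + k - s)) (pderiv s a) v)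
              w) := by
  filter_upwards [h.act (fockFamily.act (l + i) a v)] with L hL
  have hpderiv (k : ℕ) : (pderiv k).toLinearMap (fockFamily.act (l + i) a v) =
      fockFamily.act (l + i) a ((pderiv k).toLinearMap v) + ∑ s ∈ range K,
        Ring.choose (k : ℤ) s • fockFamily.act (l + (i + k - s)) (pderiv s a) v := by
    simpa only [one_smul, ← add_sub_assoc, ← add_assoc] using
      (fockFamily_hasCommutator_pderiv k).act_eq ha (l + i) v
  simp only [Derivation.coeFn_coe] at hpderiv
  simp only [OscillatorFamily.jacobiRightTerm, LinearMap.smul_apply, map_zsmul, hL, hpderiv]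
  rw [sum_comm (s := range K), ← sum_add_distrib, smul_add, smul_comm _ g, smul_sum]
  congr 2
  refine sum_congr rfl fun k _ => ?_
  rw [map_add, map_sum, LinearMap.add_apply, LinearMap.sum_apply, smul_add, smul_add, smul_sum,
    smul_sum, smul_comm (Ring.choose r k), show m + n - i + r - k = m + (n + r - k) - i by ring]
  congr 1
  refine sum_congr rfl fun s _ => ?_
  rw [map_zsmul, LinearMap.smul_apply, smul_smul, smul_smul, mul_assoc,
    show m + n + r - s - (i + k - s) = m + (n + r - k) - i by ring]

theorem HasCommutator.eventually_sum_jacobiRightTerm (h : ρ.HasCommutator O g r) {a v : Fock}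
    {K : ℕ} (ha : ∀ k ≥ K, pderiv k a = 0) (hv : ∀ k ≥ K, pderiv k v = 0) (l m n : ℤ) (w : Fock) :
    ∀ᶠ T in atTop, O (∑ i ∈ range T, ρ.jacobiRightTerm a v l m n i w) =
      ∑ i ∈ range T, ρ.jacobiRightTerm a v l m n i (O w) +
      g • ∑ k ∈ range K, Ring.choose r k • ∑ i ∈ range T,
        (ρ.jacobiRightTerm (pderiv k a) v l (m + r - k) n i w +
        ρ.jacobiRightTerm a (pderiv k v) l m (n + r - k) i w) := by
  have hzero : ∀ᶠ T : ℕ in atTop, ∀ s ∈ range K, ∀ t ≥ T,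
      fockFamily.act (l + t) (pderiv s a) v = 0 :=
    (Filter.eventually_all_finset _).2 fun s _ => Filter.eventually_forall_ge_atTop.2 <|
      eventually_ncoeff_add_eq_zero (fockFamily.Y (pderiv s a)) v l
  filter_upwards [hzero] with T hT
  obtain ⟨L, hL, hKL⟩ := (((Filter.eventually_all_finset (range T)).2 fun i _ =>
    h.jacobiRightTerm ha v l m n i w).and (eventually_ge_atTop (K + T))).exists
  have hv_sum (i : ℕ) : ∑ k ∈ range L,
      Ring.choose r k • ρ.jacobiRightTerm a (pderiv k v) l m (n + r - k) i w = ∑ k ∈ range K,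
      Ring.choose r k • ρ.jacobiRightTerm a (pderiv k v) l m (n + r - k) i w := by
    refine (sum_subset (range_mono (by omega)) fun k _ hk => ?_).symm
    simp [OscillatorFamily.jacobiRightTerm, hv k (by simpa using hk)]
  have ha_sum (s : ℕ) (hs : s ∈ range K) : ∑ i ∈ range T, ∑ k ∈ range L,
      (Ring.choose m i * (Ring.choose r k * Ring.choose (k : ℤ) s)) •
        ρ.act (m + n + r - s - (i + k - s)) (fockFamily.act (l + (i + k - s)) (pderiv s a) v) w =
      Ring.choose r s • ∑ i ∈ range T, ρ.jacobiRightTerm (pderiv s a) v l (m + r - s) n i w := by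
    rw [sum_choose_convolution m r (by rw [mem_range] at hs; omega) (G := fun t =>
      ρ.act (m + n + r - s - t) (fockFamily.act (l + t) (pderiv s a) v) w) fun t ht => by
        rw [hT s hs t ht, map_zero, LinearMap.zero_apply]]
    simp only [OscillatorFamily.jacobiRightTerm, LinearMap.smul_apply,
      show m + n + r - s = m + r - s + n by ring]
  rw [map_sum, sum_congr rfl hL]
  simp only [hv_sum, sum_add_distrib, ← smul_sum, smul_add]
  rw [sum_comm (s := range T) (t := range K), sum_comm (s := range T) (t := range K),
    sum_congr rfl ha_sum]
  simp only [← smul_sum]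
  abel

theorem HasCommutator.eventually_jacobiDefect (h : ρ.HasCommutator O g r) (a v : Fock)
    (l m n : ℤ) (w : Fock) : ∃ K, ∀ᶠ N in atTop, O (ρ.jacobiDefect a v l m n N w) =
      ρ.jacobiDefect a v l m n N (O w) +
      g • ∑ k ∈ range K, Ring.choose r k • (ρ.jacobiDefect (pderiv k a) v l (m + r - k) n N w +
        ρ.jacobiDefect a (pderiv k v) l m (n + r - k) N w) := by
  obtain ⟨K, hK⟩ := ((Filter.eventually_forall_ge_atTop.2 (eventually_pderiv_eq_zero a)).and
    (Filter.eventually_forall_ge_atTop.2 (eventually_pderiv_eq_zero v))).exists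
  refine ⟨K, ?_⟩
  filter_upwards [h.eventually_sum_jacobiRightTerm hK.1 hK.2 l m n w] with N hN
  simp only [jacobiDefect, LinearMap.sum_apply, LinearMap.sub_apply, sum_sub_distrib] at hN ⊢
  rw [map_sub, hN, map_sum, sum_congr rfl fun i _ => h.jacobiLeftTerm hK.1 hK.2 l m n i w]
  simp only [sum_add_distrib, ← smul_sum, smul_add, smul_sub, sum_sub_distrib]
  rw [sum_comm (s := range N) (t := range K), sum_comm (s := range N) (t := range K)]
  simp only [← smul_sum]
  abel

end OscillatorFamily

/-! ### Vacuum expectation values -/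

theorem constantCoeff_eq_zero_of_isWeightedHomogeneous {σ R M : Type*} [CommSemiring R]
    [AddCommMonoid M] {w : σ → M} {z : M} {f : MvPolynomial σ R}
    (hf : IsWeightedHomogeneous w f z) (hz : z ≠ 0) : constantCoeff f = 0 := by
  rw [constantCoeff_eq]
  exact hf.coeff_eq_zero 0 (by rwa [map_zero, ne_comm])

theorem fockFamily_isGraded : fockFamily.IsGraded conformalWeight := by
  intro n z v hv
  match n with
  | Int.ofNat 0 => simpa [fockFamily, oscillator] using isWeightedHomogeneous_zero _ _ _
  | Int.ofNat (k + 1) =>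
    exact (weightedHomogeneousSubmodule ℂ _ _).smul_mem _
      (hv.pderiv (by simp only [conformalWeight, Int.ofNat_eq_natCast]; push_cast; ring))
  | Int.negSucc k =>
    have h := (isWeightedHomogeneous_X ℂ conformalWeight k).mul hv
    rwa [show conformalWeight k + z = z - Int.negSucc k by
      rw [Int.negSucc_eq, conformalWeight]; ring] at h

theorem constantCoeff_act_vacuum (a : Fock) (n : ℤ) :
    constantCoeff (fockFamily.act n a 1) = if n = -1 then constantCoeff a else 0 := by
  rcases lt_or_ge n 0 with hn | hn
  · obtain ⟨t, rfl⟩ : ∃ t : ℕ, n = -1 - t := ⟨(-1 - n).toNat, by omega⟩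
    have h := constantCoeff_act_act_vacuum 1 a (-1) t
    rw [OscillatorFamily.act_one, OscillatorFamily.act_one, if_pos rfl] at h
    rw [LinearMap.id_apply] at h
    rw [h]
    rcases eq_or_ne t 0 with rfl | ht
    · simp
    · rw [if_neg (by omega), if_neg (by omega), LinearMap.zero_apply, map_zero, mul_zero]
  · rw [act_nonneg_vacuum a hn, if_neg (by omega), map_zero]

section Homogeneous

variable {i j : ℤ} {a v : Fock}

theorem constantCoeff_act_act_one (ha : IsWeightedHomogeneous conformalWeight a i)
    (hv : IsWeightedHomogeneous conformalWeight v j) (p q : ℤ) :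
    constantCoeff (fockFamily.act p a (fockFamily.act q v 1)) = if p + q = i + j - 2 then
      (intChoose p (-1 - q) : ℤ) * constantCoeff (fockFamily.act (i + j - 1) a v) else 0 := by
  split_ifs with h
  · rcases lt_or_ge q 0 with hq | hq
    · obtain ⟨t, rfl⟩ : ∃ t : ℕ, q = -1 - t := ⟨(-1 - q).toNat, by omega⟩
      rw [constantCoeff_act_act_vacuum, sub_sub_cancel, intChoose_natCast,
        show p - (t : ℤ) = i + j - 1 by omega]
    · rw [act_nonneg_vacuum v hq, map_zero, map_zero, intChoose_of_neg _ (by omega),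
        Int.cast_zero, zero_mul]
  · exact constantCoeff_eq_zero_of_isWeightedHomogeneous
      (fockFamily_isGraded.act ha (fockFamily_isGraded.act hv (isWeightedHomogeneous_one ℂ _)))
      (by omega)

theorem constantCoeff_act_act_one' (ha : IsWeightedHomogeneous conformalWeight a i)
    (hv : IsWeightedHomogeneous conformalWeight v j) (p q : ℤ) :
    constantCoeff (fockFamily.act p (fockFamily.act q a v) 1) =
      if p = -1 ∧ q = i + j - 1 then constantCoeff (fockFamily.act (i + j - 1) a v) else 0 := by
  rw [constantCoeff_act_vacuum, ite_and]
  refine ite_congr rfl (fun _ => ?_) fun _ => rfl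
  split_ifs with hq
  · rw [hq]
  · exact constantCoeff_eq_zero_of_isWeightedHomogeneous (fockFamily_isGraded.act ha hv) (by omega)

theorem negOnePow_mul_negOnePow_add (l : ℤ) {m n : ℤ} (h : l + m + n = i + j - 2) :
    (l.negOnePow : ℤ) * (i + j).negOnePow = (m + n).negOnePow := by
  rw [← Units.val_mul, ← Int.negOnePow_add, show l + (i + j) = m + n + (l + l) + 2 by omega,
    Int.negOnePow_add, Int.negOnePow_add, Int.negOnePow_add l, show Int.negOnePow 2 = 1 from rfl,
    Int.units_mul_self, mul_one, mul_one]

theorem eventually_constantCoeff_sum_jacobiLeftTerm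
    (ha : IsWeightedHomogeneous conformalWeight a i)
    (hv : IsWeightedHomogeneous conformalWeight v j) {l m n : ℤ} (h : l + m + n = i + j - 2) :
    ∀ᶠ N in atTop, ∑ t ∈ range N, constantCoeff (fockFamily.jacobiLeftTerm a v l m n t 1) =
      (intChoose m (m + n + 1) : ℤ) * constantCoeff (fockFamily.act (i + j - 1) a v) := by
  have hterm (t : ℕ) : constantCoeff (fockFamily.jacobiLeftTerm a v l m n t 1) =
      (((-1) ^ t * Ring.choose l t * intChoose (m + l - t) (-1 - n - t) - (m + n).negOnePow *
        ((-1) ^ t * Ring.choose l t * intChoose (n + l - t) (-1 - m - t)) : ℤ) : ℂ) *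
          constantCoeff (fockFamily.act (i + j - 1) a v) := by
    rw [OscillatorFamily.jacobiLeftTerm]
    simp only [LinearMap.smul_apply, LinearMap.sub_apply, Module.End.mul_apply, map_zsmul, map_sub]
    rw [constantCoeff_act_act_one ha hv, constantCoeff_act_act_one hv ha, if_pos (by omega),
      if_pos (by omega), add_comm j i, constantCoeff_act_comm ha hv,
      ← negOnePow_mul_negOnePow_add l h, ← sub_sub, ← sub_sub, zsmul_eq_mul, zsmul_eq_mul]
    push_cast
    ring
  filter_upwards [eventually_sum_choose_mul_intChoose l m (-1 - n),
    eventually_sum_choose_mul_intChoose l n (-1 - m)] with N h1 h2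
  simp only [hterm]
  rw [← sum_mul, ← Int.cast_sum, sum_sub_distrib, ← mul_sum, h1, h2, ← intChoose_add_add_one]

theorem eventually_constantCoeff_sum_jacobiRightTerm
    (ha : IsWeightedHomogeneous conformalWeight a i)
    (hv : IsWeightedHomogeneous conformalWeight v j) {l m n : ℤ} (h : l + m + n = i + j - 2) :
    ∀ᶠ N in atTop, ∑ t ∈ range N, constantCoeff (fockFamily.jacobiRightTerm a v l m n t 1) =
      (intChoose m (m + n + 1) : ℤ) * constantCoeff (fockFamily.act (i + j - 1) a v) := by
  have hterm (t : ℕ) : constantCoeff (fockFamily.jacobiRightTerm a v l m n t 1) =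
      if (t : ℤ) = m + n + 1 then
        (intChoose m t : ℤ) * constantCoeff (fockFamily.act (i + j - 1) a v) else 0 := by
    rw [OscillatorFamily.jacobiRightTerm, LinearMap.smul_apply, map_zsmul,
      constantCoeff_act_act_one' ha hv, smul_ite, smul_zero, zsmul_eq_mul, intChoose_natCast]
    exact if_congr (by omega) rfl rfl
  simp only [hterm]
  rcases lt_or_ge (m + n + 1) 0 with hmn | hmn
  · refine Eventually.of_forall fun N => ?_
    rw [intChoose_of_neg m hmn, Int.cast_zero, zero_mul]
    exact sum_eq_zero fun t _ => if_neg (by omega)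
  · lift m + n + 1 to ℕ using hmn with k
    filter_upwards [eventually_gt_atTop k] with N hN
    simp only [Nat.cast_inj, sum_ite_eq', mem_range, hN, if_true]

theorem eventually_constantCoeff_jacobiDefect (ha : IsWeightedHomogeneous conformalWeight a i)
    (hv : IsWeightedHomogeneous conformalWeight v j) (l m n : ℤ) :
    ∀ᶠ N in atTop, constantCoeff (fockFamily.jacobiDefect a v l m n N 1) = 0 := by
  simp only [OscillatorFamily.jacobiDefect, LinearMap.sum_apply, LinearMap.sub_apply, map_sum,
    map_sub, sum_sub_distrib]
  by_cases h : l + m + n = i + j - 2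
  · filter_upwards [eventually_constantCoeff_sum_jacobiLeftTerm ha hv h,
      eventually_constantCoeff_sum_jacobiRightTerm ha hv h] with N h1 h2
    rw [h1, h2, sub_self]
  · refine Eventually.of_forall fun N => ?_
    rw [sum_eq_zero fun t _ => ?_, sum_eq_zero fun t _ => ?_, sub_zero]
    · rw [OscillatorFamily.jacobiRightTerm, LinearMap.smul_apply, map_zsmul,
        constantCoeff_act_act_one' ha hv, if_neg (by omega), smul_zero]
    · simp only [OscillatorFamily.jacobiLeftTerm, LinearMap.smul_apply, LinearMap.sub_apply,
        Module.End.mul_apply, map_zsmul, map_sub]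
      rw [constantCoeff_act_act_one ha hv, constantCoeff_act_act_one hv ha, if_neg (by omega),
        if_neg (by omega), smul_zero, sub_zero, smul_zero]

end Homogeneous

/-! ### The Jacobi identity -/

namespace OscillatorFamily

variable (ρ : OscillatorFamily) (a v w : Fock) (l m n : ℤ)

theorem jacobiDefect_add_left (a' : Fock) (N : ℕ) : ρ.jacobiDefect (a + a') v l m n N =
    ρ.jacobiDefect a v l m n N + ρ.jacobiDefect a' v l m n N := by
  rw [jacobiDefect, jacobiDefect, jacobiDefect, ← sum_add_distrib]
  refine sum_congr rfl fun i _ => ?_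
  simp only [jacobiLeftTerm, jacobiRightTerm, map_add, LinearMap.add_apply, add_mul, mul_add]
  module

theorem jacobiDefect_add_right (v' : Fock) (N : ℕ) : ρ.jacobiDefect a (v + v') l m n N =
    ρ.jacobiDefect a v l m n N + ρ.jacobiDefect a v' l m n N := by
  rw [jacobiDefect, jacobiDefect, jacobiDefect, ← sum_add_distrib]
  refine sum_congr rfl fun i _ => ?_
  simp only [jacobiLeftTerm, jacobiRightTerm, map_add, add_mul, mul_add]
  module

theorem jacobiDefect_zero_left (N : ℕ) : ρ.jacobiDefect 0 v l m n N = 0 := by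
  simp [jacobiDefect, jacobiLeftTerm, jacobiRightTerm]

theorem jacobiDefect_zero_right (N : ℕ) : ρ.jacobiDefect a 0 l m n N = 0 := by
  simp [jacobiDefect, jacobiLeftTerm, jacobiRightTerm]

theorem eventually_jacobiLeftTerm_eq_zero :
    ∀ᶠ i in atTop, ρ.jacobiLeftTerm a v l m n i w = 0 := by
  filter_upwards [eventually_ncoeff_add_eq_zero (ρ.Y v) w n,
    eventually_ncoeff_add_eq_zero (ρ.Y a) w m] with i hv ha
  rw [ncoeff_Y] at hv ha
  simp [jacobiLeftTerm, hv, ha]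

theorem eventually_jacobiRightTerm_eq_zero : ∀ᶠ i in atTop, ρ.jacobiRightTerm a v l m n i = 0 := by
  filter_upwards [eventually_ncoeff_add_eq_zero (fockFamily.Y a) v l] with i h
  rw [ncoeff_Y] at h
  rw [jacobiRightTerm, h, map_zero, smul_zero]

theorem exists_eventually_jacobiDefect_eq :
    ∃ u, ∀ᶠ N in atTop, ρ.jacobiDefect a v l m n N w = u := by
  obtain ⟨N, hN⟩ := eventually_atTop.1 ((ρ.eventually_jacobiLeftTerm_eq_zero a v w l m n).and
    (ρ.eventually_jacobiRightTerm_eq_zero a v l m n))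
  refine ⟨ρ.jacobiDefect a v l m n N w, ?_⟩
  filter_upwards [eventually_ge_atTop N] with K hK
  simp only [jacobiDefect, LinearMap.sum_apply, LinearMap.sub_apply]
  refine (sum_subset (range_mono hK) fun i _ hi => ?_).symm
  have h := hN i (by simpa using hi)
  rw [h.1, h.2, LinearMap.zero_apply, sub_zero]

end OscillatorFamily

theorem constantCoeff_specialize (f : Fock) : constantCoeff (specialize f) = constantCoeff f := by
  induction f using MvPolynomial.induction_on with
  | C a => simp [specialize]
  | add p q hp hq => simp only [map_add, hp, hq]
  | mul_X p k _ =>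
    match k with
    | 0 => simp [specialize_X_zero]
    | k + 1 => simp [specialize_X_succ]

theorem specialize_jacobiDefect (a v : Fock) (l m n : ℤ) (N : ℕ) (w : Fock) :
    specialize (universalFamily.jacobiDefect a v l m n N w) =
      fockFamily.jacobiDefect a v l m n N (specialize w) := by
  simp only [OscillatorFamily.jacobiDefect, OscillatorFamily.jacobiLeftTerm,
    OscillatorFamily.jacobiRightTerm, LinearMap.sum_apply, LinearMap.sub_apply,
    LinearMap.smul_apply, Module.End.mul_apply, map_sum, map_sub, map_zsmul, specialize_act]

/-- By Schur's lemma for the universal Fock module: what commutes with all creation and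
annihilation operators is determined by its vacuum expectation value. -/
theorem eventually_eq_zero_of_eventually_commute {J : ℕ → Module.End ℂ Fock}
    (hX : ∀ k w, ∀ᶠ N in atTop, X k * J N w = J N (X k * w))
    (hpderiv : ∀ k, ∀ᶠ N in atTop, pderiv k (J N 1) = J N (pderiv k 1))
    (hconst : ∃ u, ∀ᶠ N in atTop, J N 1 = u)
    (hvacuum : ∀ᶠ N in atTop, constantCoeff (J N 1) = 0) (w : Fock) :
    ∀ᶠ N in atTop, J N w = 0 := by
  obtain ⟨u, hu⟩ := hconst
  have hu_zero : u = 0 := by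
    have hpderiv_u (k : ℕ) : pderiv k u = 0 := by
      obtain ⟨N, h1, h2⟩ := (hu.and (hpderiv k)).exists
      rw [← h1, h2, pderiv_one, map_zero]
    obtain ⟨N, h1, h2⟩ := (hu.and hvacuum).exists
    rw [eq_C_of_forall_pderiv_eq_zero hpderiv_u, ← h1, h2, map_zero]
  induction w using MvPolynomial.induction_on with
  | C c =>
    filter_upwards [hu] with N hN
    rw [C_eq_smul_one, map_smul, hN, hu_zero, smul_zero]
  | add p q hp hq =>
    filter_upwards [hp, hq] with N hp hq
    rw [map_add, hp, hq, add_zero]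
  | mul_X p k hp =>
    filter_upwards [hp, hX k p] with N hp hX
    rw [mul_comm, ← hX, hp, mul_zero]

theorem eventually_jacobiDefect_eq_zero_of_isWeightedHomogeneous {d : ℕ} {i j : ℤ} {a v : Fock}
    (hd : i + j < d) (ha : IsWeightedHomogeneous conformalWeight a i)
    (hv : IsWeightedHomogeneous conformalWeight v j) (l m n : ℤ) (w : Fock) :
    ∀ᶠ N in atTop, universalFamily.jacobiDefect a v l m n N w = 0 := by
  induction d generalizing i j a v l m n w with
  | zero =>
    refine Eventually.of_forall fun N => ?_
    rcases lt_or_ge i 0 with hi | hi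
    · rw [eq_zero_of_isWeightedHomogeneous_of_neg conformalWeight_nonneg hi ha,
        OscillatorFamily.jacobiDefect_zero_left, LinearMap.zero_apply]
    · rw [eq_zero_of_isWeightedHomogeneous_of_neg conformalWeight_nonneg (by omega) hv,
        OscillatorFamily.jacobiDefect_zero_right, LinearMap.zero_apply]
  | succ d ih =>
    have hcommute {O : Module.End ℂ Fock} {g : ℂ} {r : ℤ} (hO : universalFamily.HasCommutator O g r)
        (w : Fock) : ∀ᶠ N in atTop, O (universalFamily.jacobiDefect a v l m n N w) =
          universalFamily.jacobiDefect a v l m n N (O w) := by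
      obtain ⟨K, hK⟩ := hO.eventually_jacobiDefect a v l m n w
      have hleft (k : ℕ) (_ : k ∈ range K) := ih (by simp only [conformalWeight]; omega)
        (ha.pderiv (sub_add_cancel i (conformalWeight k))) hv l (m + r - k) n w
      have hright (k : ℕ) (_ : k ∈ range K) := ih (by simp only [conformalWeight]; omega) ha
        (hv.pderiv (sub_add_cancel j (conformalWeight k))) l m (n + r - k) w
      filter_upwards [hK, (Filter.eventually_all_finset _).2 hleft,
        (Filter.eventually_all_finset _).2 hright] with N hN hleft hright
      rw [hN, sum_eq_zero fun k hk => ?_, smul_zero, add_zero]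
      rw [hleft k hk, hright k hk, add_zero, smul_zero]
    refine eventually_eq_zero_of_eventually_commute
      (fun k w => hcommute (universalFamily_hasCommutator_mulLeft_X k) w)
      (fun k => hcommute (universalFamily_hasCommutator_pderiv k) 1)
      (universalFamily.exists_eventually_jacobiDefect_eq a v 1 l m n) ?_ w
    filter_upwards [eventually_constantCoeff_jacobiDefect ha hv l m n] with N hN
    rwa [← constantCoeff_specialize, specialize_jacobiDefect, map_one]

theorem eventually_jacobiDefect_eq_zero (a v : Fock) (l m n : ℤ) (w : Fock) :
    ∀ᶠ N in atTop, universalFamily.jacobiDefect a v l m n N w = 0 := by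
  induction a using MvPolynomial.induction_on' with
  | add p q hp hq =>
    filter_upwards [hp, hq] with N hp hq
    rw [OscillatorFamily.jacobiDefect_add_left, LinearMap.add_apply, hp, hq, add_zero]
  | monomial s c =>
    induction v using MvPolynomial.induction_on' with
    | add p q hp hq =>
      filter_upwards [hp, hq] with N hp hq
      rw [OscillatorFamily.jacobiDefect_add_right, LinearMap.add_apply, hp, hq, add_zero]
    | monomial t d =>
      exact eventually_jacobiDefect_eq_zero_of_isWeightedHomogeneous
        (Int.self_le_toNat (_ + _ + 1) |>.trans_lt' (lt_add_one _))
        (isWeightedHomogeneous_monomial _ s c rfl) (isWeightedHomogeneous_monomial _ t d rfl)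
        l m n w

theorem neg_one_pow_mul_choose_neg_two (i : ℕ) :
    (-1 : ℤ) ^ i * Ring.choose (-2 : ℤ) i = i + 1 := by
  have h := neg_one_pow_mul_choose_sub_one_sub ((i : ℤ) + 1) i
  rw [show (i : ℤ) - 1 - (i + 1) = -2 by ring] at h
  rw [h, ← Nat.cast_succ, Ring.choose_natCast, Nat.choose_succ_self_right]

theorem act_neg_two_vacuum (a : Fock) : fockFamily.act (-2) a 1 = translation a := by
  have h := translation_act a (-1) 1
  rw [OscillatorFamily.ncoeff_Y, act_neg_one_vacuum, translation_one, map_zero, zero_sub,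
    neg_one_zsmul, neg_neg] at h
  exact h.symm

namespace OscillatorFamily

variable (ρ : OscillatorFamily)

theorem jacobiLeftTerm_vacuum (a : Fock) (n : ℤ) (i : ℕ) :
    ρ.jacobiLeftTerm a 1 (-2) 0 n i = ((i : ℤ) + 1) •
      ((if n + i = -1 then ρ.act (-2 - i) a else 0) -
        if n - 2 - i = -1 then ρ.act i a else 0) := by
  rw [jacobiLeftTerm, neg_one_pow_mul_choose_neg_two, act_one, act_one]
  simp only [zero_add, Int.negOnePow_neg, Int.negOnePow_even 2 even_two, Units.val_one, one_smul,
    mul_ite, ite_mul, mul_zero, zero_mul, ← Module.End.one_eq_id, mul_one,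
    one_mul]
  rfl

theorem eventually_sum_jacobiLeftTerm_vacuum (a : Fock) (n : ℤ) :
    ∀ᶠ N in atTop, ∑ i ∈ range N, ρ.jacobiLeftTerm a 1 (-2) 0 n i = -n • ρ.act (n - 1) a := by
  filter_upwards [eventually_gt_atTop n.natAbs] with N hN
  simp only [jacobiLeftTerm_vacuum]
  rcases lt_trichotomy n 0 with hn | rfl | hn
  · rw [sum_eq_single_of_mem (-1 - n).toNat (mem_range.2 (by omega)) fun i _ hi => by
      rw [if_neg (by omega), if_neg (by omega), sub_zero, smul_zero]]
    rw [if_pos (by omega), if_neg (by omega), sub_zero, Int.toNat_of_nonneg (by omega)]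
    ring_nf
  · rw [sum_eq_zero fun i _ => ?_, neg_zero, zero_smul]
    rw [if_neg (by omega), if_neg (by omega), sub_zero, smul_zero]
  · rw [sum_eq_single_of_mem (n - 1).toNat (mem_range.2 (by omega)) fun i _ hi => by
      rw [if_neg (by omega), if_neg (by omega), sub_zero, smul_zero]]
    rw [if_neg (by omega), if_pos (by omega), zero_sub, smul_neg, Int.toNat_of_nonneg (by omega),
      sub_add_cancel, neg_smul]

end OscillatorFamily

theorem sum_range_choose_zero_smul {M : Type*} [AddCommGroup M] {N : ℕ} (hN : 0 < N)
    (f : ℕ → M) : ∑ i ∈ range N, Ring.choose (0 : ℤ) i • f i = f 0 := by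
  rw [sum_eq_single_of_mem 0 (mem_range.2 hN) fun i _ hi => ?_, Ring.choose_zero_right, one_smul]
  rw [Ring.choose_zero_pos ℤ (Nat.pos_of_ne_zero hi), zero_smul]

theorem universalFamily_act_translation (n : ℤ) (a : Fock) :
    universalFamily.act n (translation a) = -n • universalFamily.act (n - 1) a := by
  refine LinearMap.ext fun w => ?_
  obtain ⟨N, hdefect, hleft, hN⟩ := ((eventually_jacobiDefect_eq_zero a 1 (-2) 0 n w).and
    ((universalFamily.eventually_sum_jacobiLeftTerm_vacuum a n).and
      (eventually_gt_atTop 0))).exists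
  rw [OscillatorFamily.jacobiDefect, sum_sub_distrib, hleft] at hdefect
  simp only [OscillatorFamily.jacobiRightTerm, sum_range_choose_zero_smul hN, zero_add,
    Nat.cast_zero, sub_zero, add_zero, act_neg_two_vacuum] at hdefect
  exact (sub_eq_zero.1 hdefect).symm

theorem universalFamily_act_mul_act (a b : Fock) (m n : ℤ) (w : Fock) :
    ∀ᶠ N in atTop, universalFamily.act m a (universalFamily.act n b w) =
      universalFamily.act n b (universalFamily.act m a w) + ∑ i ∈ range N,
        Ring.choose m i • universalFamily.act (m + n - i) (fockFamily.act i a b) w := by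
  filter_upwards [eventually_jacobiDefect_eq_zero a b 0 m n w, eventually_gt_atTop 0]
    with N hdefect hN
  have hleft : ∑ i ∈ range N, universalFamily.jacobiLeftTerm a b 0 m n i =
      universalFamily.act m a * universalFamily.act n b -
        universalFamily.act n b * universalFamily.act m a := by
    simp only [OscillatorFamily.jacobiLeftTerm, mul_comm ((-1 : ℤ) ^ _), mul_smul,
      sum_range_choose_zero_smul hN]
    simp
  rw [OscillatorFamily.jacobiDefect, sum_sub_distrib, hleft] at hdefect
  simp only [OscillatorFamily.jacobiRightTerm, zero_add, LinearMap.sub_apply,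
    LinearMap.sum_apply, LinearMap.smul_apply, Module.End.mul_apply, sub_eq_zero] at hdefect
  rw [← hdefect, add_sub_cancel]

/-! ### The enveloping algebra acts on the universal Fock module -/

theorem nabla_single (n : ℤ) (a : Fock) : nabla (Finsupp.single n a) =
    Finsupp.single n (translation a) + (n : ℂ) • Finsupp.single (n - 1) a := by
  simp [nabla]

/-- The action of `𝔏(π)ᶠ` on the universal Fock module: `a_[n]` acts as the mode `a₍ₙ₎`. -/
def ancillaryAct : Ancillary →ₗ[ℂ] Module.End ℂ Fock :=
  (LinearMap.range nabla).liftQ (Finsupp.lsum ℂ universalFamily.act) (by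
    rintro _ ⟨f, rfl⟩
    rw [LinearMap.mem_ker]
    induction f using Finsupp.induction_linear with
    | zero => rw [map_zero, map_zero]
    | add f g hf hg => rw [map_add, map_add, hf, hg, add_zero]
    | single n a =>
      rw [nabla_single, map_add, map_smul, Finsupp.lsum_single, Finsupp.lsum_single,
        universalFamily_act_translation, neg_smul, ← Int.cast_smul_eq_zsmul ℂ n, neg_add_cancel])

theorem ancillaryAct_bracketMode (a : Fock) (n : ℤ) :
    ancillaryAct (bracketMode a n) = universalFamily.act n a := by
  rw [ancillaryAct, bracketMode, Submodule.mkQ_apply, Submodule.liftQ_apply, Finsupp.lsum_single]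

theorem bracketMode_zero (n : ℤ) : bracketMode 0 n = 0 := by simp [bracketMode]

theorem bracketMode_add (a b : Fock) (n : ℤ) :
    bracketMode (a + b) n = bracketMode a n + bracketMode b n := by simp [bracketMode]

theorem bracketMode_smul (c : ℂ) (a : Fock) (n : ℤ) :
    bracketMode (c • a) n = c • bracketMode a n := by
  rw [bracketMode, ← Finsupp.smul_single, map_smul, bracketMode]

theorem finite_support_choose_smul_bracketMode (a b : Fock) (l m n : ℤ) :
    (Function.support fun i : ℕ =>
      Ring.choose m i • bracketMode (nthProduct (l + i) a b) (m + n - i)).Finite := by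
  obtain ⟨K, hK⟩ := fockFamily.exists_act_eq_zero a b
  refine (Set.finite_lt_nat (K - l).toNat).subset fun i hi => ?_
  by_contra h
  rw [Set.mem_ofPred_eq, not_lt] at h
  exact hi (by simp only [nthProduct_eq_act, hK (l + i) (by omega), bracketMode_zero, smul_zero])

/-- The action of `U(𝔏(π)ᶠ)` on the universal Fock module. -/
def envelopingAct : Enveloping →ₐ[ℂ] Module.End ℂ Fock :=
  RingQuot.liftAlgHom ℂ ⟨TensorAlgebra.lift ℂ ancillaryAct, by
    rintro _ _ ⟨a, b, m, n⟩
    simp only [map_mul, map_add, TensorAlgebra.lift_ι_apply, ancillaryAct_bracketMode]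
    refine LinearMap.ext fun w => ?_
    obtain ⟨N, hact, hbracket⟩ := ((universalFamily_act_mul_act a b m n w).and
      (eventually_finsum_eq_sum_range
        (finite_support_choose_smul_bracketMode a b 0 m n))).exists
    simp only [zero_add] at hbracket
    rw [lieBracket, hbracket]
    simp only [LinearMap.add_apply, Module.End.mul_apply, hact, map_sum, map_zsmul,
      ancillaryAct_bracketMode, nthProduct_eq_act, LinearMap.sum_apply, LinearMap.smul_apply]⟩

theorem envelopingAct_envι (x : Ancillary) : envelopingAct (envι x) = ancillaryAct x := by
  have h : envelopingAct (envProj (TensorAlgebra.ι ℂ x)) = TensorAlgebra.lift ℂ ancillaryAct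
      (TensorAlgebra.ι ℂ x) := RingQuot.liftAlgHom_mkAlgHom_apply ..
  rwa [TensorAlgebra.lift_ι_apply] at h

theorem envelopingAct_mode (a : Fock) (n : ℤ) :
    envelopingAct (mode a n) = universalFamily.act n a := by
  rw [mode, envelopingAct_envι, ancillaryAct_bracketMode]

theorem enveloping_induction {P : Enveloping → Prop} (algebraMap : ∀ c : ℂ, P (algebraMap ℂ _ c))
    (mode : ∀ a n, P (mode a n)) (add : ∀ x y, P x → P y → P (x + y))
    (mul : ∀ x y, P x → P y → P (x * y)) (x : Enveloping) : P x := by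
  obtain ⟨y, rfl⟩ : ∃ y, envProj y = x := RingQuot.mkAlgHom_surjective ℂ EnvelopingRel x
  induction y using TensorAlgebra.induction with
  | algebraMap r => rw [AlgHom.commutes]; exact algebraMap r
  | ι z =>
    obtain ⟨f, rfl⟩ := Submodule.mkQ_surjective _ z
    induction f using Finsupp.induction_linear with
    | zero => simpa using algebraMap 0
    | add f g hf hg => simpa only [map_add] using add _ _ hf hg
    | single n a => exact mode a n
  | mul p q hp hq => rw [map_mul]; exact mul _ _ hp hq
  | add p q hp hq => rw [map_add]; exact add _ _ hp hq

theorem universalFamily_isGraded : universalFamily.IsGraded ((↑) : ℕ → ℤ) := by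
  intro n z v hv
  match n with
  | Int.ofNat 0 =>
    have h := (isWeightedHomogeneous_X ℂ ((↑) : ℕ → ℤ) 0).mul hv
    rwa [Nat.cast_zero, zero_add, ← sub_zero z] at h
  | Int.ofNat (k + 1) =>
    exact (weightedHomogeneousSubmodule ℂ _ _).smul_mem ((k : ℂ) + 1)
      (hv.pderiv (sub_add_cancel z ((k + 1 : ℕ) : ℤ)))
  | Int.negSucc k =>
    have h := (isWeightedHomogeneous_X ℂ ((↑) : ℕ → ℤ) (k + 1)).mul hv
    rwa [show ((k + 1 : ℕ) : ℤ) + z = z - Int.negSucc k by rw [Int.negSucc_eq]; push_cast; ring]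
      at h

theorem isWeightedHomogeneous_envelopingAct {d z : ℤ} {u : Enveloping} {v : Fock}
    (hu : u ∈ gradedPiece d) (hv : IsWeightedHomogeneous ((↑) : ℕ → ℤ) v z) :
    IsWeightedHomogeneous ((↑) : ℕ → ℤ) (envelopingAct u v) (z + d) := by
  induction hu using Submodule.span_induction with
  | mem u hu =>
    induction hu with
    | one => simpa using hv
    | @mul w a ha n e u _ ih =>
      rw [map_mul, envelopingAct_envι, ancillaryAct_bracketMode, Module.End.mul_apply]
      convert universalFamily_isGraded.act (n := n) (mem_weightSpace.1 ha) ih using 1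
      ring
  | zero => simpa using isWeightedHomogeneous_zero _ _ _
  | add x y _ _ hx hy => rw [map_add]; exact hx.add hy
  | smul c x _ hx => rw [map_smul]; exact (weightedHomogeneousSubmodule ℂ _ _).smul_mem c hx

theorem envelopingAct_eq_zero_of_mem_leftNhd {N z : ℤ} (hz : z < N) {u : Enveloping} {v : Fock}
    (hu : u ∈ leftNhd N) (hv : IsWeightedHomogeneous ((↑) : ℕ → ℤ) v z) :
    envelopingAct u v = 0 := by
  induction hu using Submodule.span_induction with
  | mem u hu =>
    obtain ⟨j, hj, hu⟩ := hu
    exact eq_zero_of_isWeightedHomogeneous_of_neg Int.natCast_nonneg (by omega)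
      (isWeightedHomogeneous_envelopingAct hu hv)
  | zero => simp
  | add x y _ _ hx hy => rw [map_add, LinearMap.add_apply, hx, hy, add_zero]
  | smul c x _ hx => rw [smul_eq_mul, map_mul, Module.End.mul_apply, hx, map_zero]

theorem exists_forall_mem_leftNhd_envelopingAct_eq_zero (v : Fock) :
    ∃ N : ℤ, ∀ u ∈ leftNhd N, envelopingAct u v = 0 := by
  induction v using MvPolynomial.induction_on' with
  | add p q hp hq =>
    obtain ⟨M, hM⟩ := hp
    obtain ⟨N, hN⟩ := hq
    refine ⟨max M N, fun u hu => ?_⟩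
    rw [map_add, hM u (leftNhd_anti (le_max_left _ _) hu),
      hN u (leftNhd_anti (le_max_right _ _) hu), add_zero]
  | monomial s c =>
    exact ⟨Finsupp.weight ((↑) : ℕ → ℤ) s + 1, fun u hu => envelopingAct_eq_zero_of_mem_leftNhd
      (lt_add_one _) hu (isWeightedHomogeneous_monomial _ s c rfl)⟩

/-! ### Extension of the action to the completion -/

section DiscreteUniformity

/-- The discrete uniformity on the Fock space, for which the orbit maps `u ↦ u v` extend to the
completion of the enveloping algebra. -/
local instance : UniformSpace Fock := ⊥

local instance : DiscreteUniformity Fock := ⟨rfl⟩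

theorem continuous_envelopingAct_apply (v : Fock) :
    Continuous fun u : Enveloping => envelopingAct u v := by
  refine continuous_of_continuousAt_zero ((LinearMap.toAddMonoidHom (LinearMap.applyₗ v)).comp
    (envelopingAct : Enveloping →+ Module.End ℂ Fock)) ?_
  obtain ⟨N, hN⟩ := exists_forall_mem_leftNhd_envelopingAct_eq_zero v
  refine tendsto_nhds_of_eventually_eq ?_
  filter_upwards [leftNhd_basis.hasBasis_nhds_zero.mem_of_mem (i := N) trivial] with u hu
  simpa using hN u hu

/-- The orbit map `c ↦ c v` of a vector of the universal Fock module, on the completion of the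
enveloping algebra. -/
def completedOrbit (v : Fock) : Completed →+ Fock :=
  AddMonoidHom.extension ((LinearMap.toAddMonoidHom (LinearMap.applyₗ v)).comp
    (envelopingAct : Enveloping →+ Module.End ℂ Fock)) (continuous_envelopingAct_apply v)

theorem continuous_completedOrbit (v : Fock) : Continuous (completedOrbit v) :=
  AddMonoidHom.continuous_extension _ _

theorem completedOrbit_toCompleted (v : Fock) (u : Enveloping) :
    completedOrbit v (toCompleted u) = envelopingAct u v :=
  AddMonoidHom.extension_coe _ (continuous_envelopingAct_apply v) u

theorem completed_induction {P : Completed → Prop} (closed : IsClosed {c | P c})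
    (toCompleted : ∀ u, P (toCompleted u)) (c : Completed) : P c :=
  UniformSpace.Completion.induction_on c closed toCompleted

theorem completedOrbit_add (v w : Fock) (c : Completed) :
    completedOrbit (v + w) c = completedOrbit v c + completedOrbit w c := by
  induction c using completed_induction with
  | closed =>
    exact isClosed_eq (continuous_completedOrbit _)
      ((continuous_completedOrbit v).add (continuous_completedOrbit w))
  | toCompleted u => simp only [completedOrbit_toCompleted, map_add]

theorem completedOrbit_smul (r : ℂ) (v : Fock) (c : Completed) :
    completedOrbit (r • v) c = r • completedOrbit v c := by
  induction c using completed_induction with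
  | closed =>
    exact isClosed_eq (continuous_completedOrbit _)
      (continuous_of_discreteTopology.comp (continuous_completedOrbit v))
  | toCompleted u => simp only [completedOrbit_toCompleted, map_smul]

theorem completedOrbit_algebraMap (v : Fock) (r : ℂ) :
    completedOrbit v (algebraMap ℂ Completed r) = r • v := by
  rw [← toCompleted.commutes, completedOrbit_toCompleted, AlgHom.commutes,
    Module.algebraMap_end_apply]

theorem completedOrbit_mul (v : Fock) (c d : Completed) :
    completedOrbit v (c * d) = completedOrbit (completedOrbit v d) c := by
  induction c using completed_induction with
  | closed =>
    exact isClosed_eq ((continuous_completedOrbit v).comp (continuous_mul_const d))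
      (continuous_completedOrbit _)
  | toCompleted x =>
    rw [completedOrbit_toCompleted]
    induction d using completed_induction with
    | closed =>
      exact isClosed_eq ((continuous_completedOrbit v).comp (continuous_const_mul (toCompleted x)))
        (continuous_of_discreteTopology.comp (continuous_completedOrbit v))
    | toCompleted y =>
      rw [← map_mul, completedOrbit_toCompleted, completedOrbit_toCompleted, map_mul,
        Module.End.mul_apply]

/-- The action of the completed enveloping algebra on the universal Fock module. -/
def completedAct : Completed →ₐ[ℂ] Module.End ℂ Fock where
  toFun c := ⟨⟨fun v => completedOrbit v c, fun v w => completedOrbit_add v w c⟩,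
    fun r v => completedOrbit_smul r v c⟩
  map_one' := LinearMap.ext fun v => by
    have h := completedOrbit_algebraMap v 1
    rwa [map_one, one_smul] at h
  map_mul' c d := LinearMap.ext fun v => completedOrbit_mul v c d
  map_zero' := LinearMap.ext fun v => map_zero (completedOrbit v)
  map_add' c d := LinearMap.ext fun v => map_add (completedOrbit v) c d
  commutes' r := LinearMap.ext fun v => completedOrbit_algebraMap v r

theorem completedAct_toCompleted (u : Enveloping) :
    completedAct (toCompleted u) = envelopingAct u :=
  LinearMap.ext fun v => completedOrbit_toCompleted v u

theorem continuous_completedAct_apply (v : Fock) : Continuous fun c => completedAct c v :=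
  continuous_completedOrbit v

theorem completedAct_eq_zero_of_mem_completedNhd {N z : ℤ} (hz : z < N) {c : Completed} {v : Fock}
    (hc : c ∈ completedNhd N) (hv : IsWeightedHomogeneous ((↑) : ℕ → ℤ) v z) :
    completedAct c v = 0 := by
  refine closure_minimal (t := {c | completedAct c v = 0}) ?_
    (isClosed_eq (continuous_completedAct_apply v) continuous_const) hc
  rintro _ ⟨u, hu, rfl⟩
  change completedAct (toCompleted u) v = 0
  rw [completedAct_toCompleted, envelopingAct_eq_zero_of_mem_leftNhd hz hu hv]

theorem isWeightedHomogeneous_completedAct {c : Completed} {v : Fock} {z : ℤ}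
    (hc : c ∈ (degreeZero.map toCompleted).topologicalClosure)
    (hv : IsWeightedHomogeneous ((↑) : ℕ → ℤ) v z) :
    IsWeightedHomogeneous ((↑) : ℕ → ℤ) (completedAct c v) z := by
  refine closure_minimal (t := {c | IsWeightedHomogeneous ((↑) : ℕ → ℤ) (completedAct c v) z}) ?_
    ((isClosed_discrete {w | IsWeightedHomogeneous _ w z}).preimage
      (continuous_completedAct_apply v)) hc
  rintro _ ⟨u, hu, rfl⟩
  change IsWeightedHomogeneous _ (completedAct (toCompleted u) v) z
  rw [completedAct_toCompleted]
  simpa only [add_zero] using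
    isWeightedHomogeneous_envelopingAct (show u ∈ gradedPiece 0 from hu) hv

theorem envelopingAct_X_zero_mul (u : Enveloping) (v : Fock) :
    envelopingAct u (X 0 * v) = X 0 * envelopingAct u v := by
  induction u using enveloping_induction generalizing v with
  | algebraMap c => simp only [AlgHom.commutes, Module.algebraMap_end_apply, mul_smul_comm]
  | mode a n =>
    obtain ⟨K, hK⟩ := ((universalFamily_hasCommutator_mulLeft_X 0).act a).exists
    simpa only [Nat.cast_zero, neg_zero, zero_smul, add_zero, LinearMap.mulLeft_apply,
      ← envelopingAct_mode] using (hK n v).symm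
  | add x y hx hy => simp only [map_add, LinearMap.add_apply, hx, hy, mul_add]
  | mul x y hx hy => simp only [map_mul envelopingAct, Module.End.mul_apply, hx, hy]

theorem completedAct_X_zero_mul (c : Completed) (v : Fock) :
    completedAct c (X 0 * v) = X 0 * completedAct c v := by
  induction c using completed_induction with
  | closed =>
    exact isClosed_eq (continuous_completedAct_apply _)
      (continuous_of_discreteTopology.comp (continuous_completedAct_apply v))
  | toCompleted u => simp only [completedAct_toCompleted, envelopingAct_X_zero_mul]

/-! ### The universal enveloping algebra acts on the universal Fock module -/

theorem envelopingAct_jacobiTerm (a b : Fock) (l m n : ℤ) (i : ℕ) :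
    envelopingAct (jacobiTerm a b l m n i) = universalFamily.jacobiLeftTerm a b l m n i := by
  simp only [jacobiTerm, OscillatorFamily.jacobiLeftTerm, map_zsmul, map_sub, map_mul,
    envelopingAct_mode]

theorem eventually_envelopingAct_jacobiRight (a b : Fock) (l m n : ℤ) :
    ∀ᶠ N in atTop, envelopingAct (jacobiRight a b l m n) =
      ∑ i ∈ range N, universalFamily.jacobiRightTerm a b l m n i := by
  filter_upwards [eventually_finsum_eq_sum_range
    (finite_support_choose_smul_bracketMode a b l m n)] with N hN
  rw [jacobiRight, hN, envelopingAct_envι]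
  simp only [map_sum, map_zsmul, ancillaryAct_bracketMode, OscillatorFamily.jacobiRightTerm,
    nthProduct_eq_act]

theorem completedAct_eq_jacobiRight_of_hasSum {a b : Fock} {l m n : ℤ} {s : Completed}
    (hs : HasSum (fun i : ℕ => toCompleted (jacobiTerm a b l m n i)) s) :
    completedAct s = envelopingAct (jacobiRight a b l m n) := by
  refine LinearMap.ext fun v => ?_
  have hlim : Tendsto (fun N => ∑ i ∈ range N, universalFamily.jacobiLeftTerm a b l m n i v) atTop
      (nhds (completedAct s v)) := by
    have h := ((continuous_completedAct_apply v).tendsto s).comp hs.tendsto_sum_nat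
    simpa only [Function.comp_def, map_sum, LinearMap.sum_apply, completedAct_toCompleted,
      envelopingAct_jacobiTerm] using h
  refine tendsto_nhds_unique hlim (tendsto_nhds_of_eventually_eq ?_)
  filter_upwards [eventually_jacobiDefect_eq_zero a b l m n v,
    eventually_envelopingAct_jacobiRight a b l m n] with N hdefect hright
  rw [hright, LinearMap.sum_apply, ← sub_eq_zero, ← sum_sub_distrib]
  simpa only [OscillatorFamily.jacobiDefect, LinearMap.sum_apply, LinearMap.sub_apply] using hdefect

theorem completedAct_eq_zero_of_mem_relations {x : GradedCompletion} (hx : x ∈ relations) :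
    completedAct (x : Completed) = 0 := by
  obtain ⟨a, b, l, m, n, s, hs, hx⟩ | hx := hx
  · rw [hx, map_sub, completedAct_toCompleted, completedAct_eq_jacobiRight_of_hasSum hs, sub_self]
  · rw [hx, map_sub, completedAct_toCompleted, envelopingAct_mode, vacuum,
      OscillatorFamily.act_one, if_pos rfl, map_one, Module.End.one_eq_id, sub_self]

/-- The action of the graded completion on the universal Fock module. -/
def gradedAct : GradedCompletion →ₐ[ℂ] Module.End ℂ Fock :=
  completedAct.comp (Subalgebra.val _)

theorem gradedAct_eq_zero_of_mem_closedIdeal {x : GradedCompletion} (hx : x ∈ closedIdeal) :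
    gradedAct x = 0 := by
  have hle : TwoSidedIdeal.span relations ≤ TwoSidedIdeal.ker gradedAct :=
    TwoSidedIdeal.span_le.2 fun z hz =>
      (TwoSidedIdeal.mem_ker _).2 (completedAct_eq_zero_of_mem_relations hz)
  refine LinearMap.ext fun v => ?_
  refine closure_minimal (t := {x | gradedAct x v = 0}) (fun y hy => ?_)
    (isClosed_eq ((continuous_completedAct_apply v).comp continuous_subtype_val)
      continuous_const) hx
  have hy' : gradedAct y = 0 := (TwoSidedIdeal.mem_ker _).1 (hle hy)
  exact LinearMap.congr_fun hy' v

end DiscreteUniformity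

/-- The action of the universal enveloping algebra of `π` on the universal Fock module. -/
def ueaAct : UEA →ₐ[ℂ] Module.End ℂ Fock :=
  Ideal.Quotient.liftₐ closedIdeal gradedAct fun _ => gradedAct_eq_zero_of_mem_closedIdeal

theorem ueaAct_mk (x : GradedCompletion) :
    ueaAct (Ideal.Quotient.mk closedIdeal x) = completedAct (x : Completed) := rfl

/-! ### Degrees and neighbourhoods in the universal enveloping algebra -/

theorem mode_zero (n : ℤ) : mode 0 n = 0 := by rw [mode, bracketMode_zero, map_zero]

theorem mode_add (a b : Fock) (n : ℤ) : mode (a + b) n = mode a n + mode b n := by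
  rw [mode, bracketMode_add, map_add, mode, mode]

theorem mode_smul (c : ℂ) (a : Fock) (n : ℤ) : mode (c • a) n = c • mode a n := by
  rw [mode, bracketMode_smul, map_smul, mode]

theorem mode_mem_gradedPiece {z : ℤ} {a : Fock} (ha : IsWeightedHomogeneous conformalWeight a z)
    (n : ℤ) : mode a n ∈ gradedPiece (z - n - 1) := by
  obtain hz | hz := lt_or_ge z 0
  · rw [eq_zero_of_isWeightedHomogeneous_of_neg conformalWeight_nonneg hz ha, mode_zero]
    exact zero_mem _
  · lift z to ℕ using hz
    have h := IsMonomial.mul (mem_weightSpace.2 ha) n IsMonomial.one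
    rw [mul_one, add_zero] at h
    exact Submodule.subset_span h

theorem mem_leftNhd_of_mem_gradedPiece {n e : ℤ} {u : Enveloping} (hu : u ∈ gradedPiece e)
    (he : e ≤ -n) : u ∈ leftNhd n :=
  Ideal.subset_span ⟨e, he, hu⟩

theorem toCompleted_mem_adjoin (u : Enveloping) :
    toCompleted u ∈ Algebra.adjoin ℂ (⋃ d : ℤ, completedPiece d) := by
  induction u using enveloping_induction with
  | algebraMap c => exact toCompleted.commutes c ▸ Subalgebra.algebraMap_mem _ c
  | mode a n =>
    induction a using MvPolynomial.induction_on' with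
    | monomial s c =>
      exact Algebra.subset_adjoin (Set.mem_iUnion.2 ⟨_, subset_closure
        ⟨_, mode_mem_gradedPiece (isWeightedHomogeneous_monomial _ s c rfl) n, rfl⟩⟩)
    | add p q hp hq =>
      rw [mode_add, map_add]
      exact add_mem hp hq
  | add x y hx hy => rw [map_add]; exact add_mem hx hy
  | mul x y hx hy => rw [map_mul]; exact mul_mem hx hy

/-- The canonical map `U → 𝒰` from the universal enveloping algebra of `𝔏(π)ᶠ` to that of `π`. -/
def toUEA : Enveloping →ₐ[ℂ] UEA :=
  (Ideal.Quotient.mkₐ ℂ closedIdeal).comp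
    (toCompleted.codRestrict (Algebra.adjoin ℂ (⋃ d : ℤ, completedPiece d)) toCompleted_mem_adjoin)

theorem toUEA_apply (u : Enveloping) :
    toUEA u = Ideal.Quotient.mk closedIdeal ⟨toCompleted u, toCompleted_mem_adjoin u⟩ := rfl

theorem ueaAct_toUEA (u : Enveloping) : ueaAct (toUEA u) = envelopingAct u := by
  rw [toUEA_apply, ueaAct_mk, completedAct_toCompleted]

/-- The neighbourhood `N^n 𝒰`, the image of `N^n Û`, as a left ideal. -/
def ueaNhd (n : ℤ) : Ideal UEA where
  carrier := {x | ∃ y : GradedCompletion, (y : Completed) ∈ completedNhd n ∧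
    Ideal.Quotient.mk closedIdeal y = x}
  zero_mem' := ⟨0, subset_closure ⟨0, zero_mem _, map_zero _⟩, map_zero _⟩
  add_mem' := by
    rintro a b ⟨y, hy, hya⟩ ⟨z, hz, hzb⟩
    exact ⟨y + z, add_mem_completedNhd hy hz, by rw [map_add, hya, hzb]⟩
  smul_mem' := by
    rintro a b ⟨y, hy, hyb⟩
    obtain ⟨z, hz⟩ := Ideal.Quotient.mk_surjective a
    exact ⟨z * y, mul_mem_completedNhd _ hy, by rw [map_mul, hyb, hz, smul_eq_mul]⟩

theorem mem_nhdZero {n : ℤ} {x : UEAZero} : x ∈ nhdZero n ↔ (x : UEA) ∈ ueaNhd n := Iff.rfl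

theorem toUEA_mem_ueaNhd {n : ℤ} {u : Enveloping} (hu : u ∈ leftNhd n) : toUEA u ∈ ueaNhd n :=
  ⟨_, subset_closure ⟨u, hu, rfl⟩, rfl⟩

theorem mul_toUEA_mem_ueaNhd {n e : ℤ} {x : UEA} {u : Enveloping} (hx : x ∈ ueaNhd n)
    (hu : u ∈ gradedPiece e) : x * toUEA u ∈ ueaNhd (n - e) := by
  obtain ⟨y, hy, rfl⟩ := hx
  refine ⟨y * ⟨toCompleted u, toCompleted_mem_adjoin u⟩,
    map_mem_closure (f := fun z => z * toCompleted u) (continuous_mul_const _) hy ?_, map_mul _ _ _⟩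
  rintro _ ⟨v, hv, rfl⟩
  exact ⟨v * u, mul_mem_leftNhd hv hu, map_mul _ _ _⟩

theorem ueaAct_eq_zero_of_mem_ueaNhd {n z : ℤ} (hz : z < n) {x : UEA} {v : Fock}
    (hx : x ∈ ueaNhd n) (hv : IsWeightedHomogeneous ((↑) : ℕ → ℤ) v z) : ueaAct x v = 0 := by
  obtain ⟨y, hy, rfl⟩ := hx
  rw [ueaAct_mk, completedAct_eq_zero_of_mem_completedNhd hz hy hv]

theorem isWeightedHomogeneous_ueaAct {x : UEA} (hx : x ∈ UEAZero) {z : ℤ} {v : Fock}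
    (hv : IsWeightedHomogeneous ((↑) : ℕ → ℤ) v z) :
    IsWeightedHomogeneous ((↑) : ℕ → ℤ) (ueaAct x v) z := by
  obtain ⟨y, hy, rfl⟩ := hx
  exact isWeightedHomogeneous_completedAct hy hv

theorem ueaAct_X_zero_mul (x : UEA) (v : Fock) : ueaAct x (X 0 * v) = X 0 * ueaAct x v := by
  obtain ⟨y, rfl⟩ := Ideal.Quotient.mk_surjective x
  rw [ueaAct_mk, completedAct_X_zero_mul]

theorem toUEA_mem_UEAZero {u : Enveloping} (hu : u ∈ gradedPiece 0) : toUEA u ∈ UEAZero :=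
  ⟨_, subset_closure ⟨u, hu, rfl⟩, rfl⟩

theorem completedNhd_mem_nhds (N : ℤ) : completedNhd N ∈ nhds (0 : Completed) :=
  UniformSpace.Completion.isDenseInducing_coe.closure_image_mem_nhds
    (leftNhd_basis.hasBasis_nhds_zero.mem_of_mem (i := N) trivial)

theorem eventually_sub_mem_completedNhd {ι : Type*} {l : Filter ι} {f : ι → Completed}
    {c : Completed} (hf : Tendsto f l (nhds c)) (N : ℤ) :
    ∀ᶠ i in l, c - f i ∈ completedNhd N := by
  have h := hf.const_sub c
  rw [sub_self] at h
  exact h.eventually (completedNhd_mem_nhds N)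

theorem exists_sub_toUEA_mem_ueaNhd {x : UEA} (hx : x ∈ UEAZero) (n : ℤ) :
    ∃ u ∈ gradedPiece 0, x - toUEA u ∈ ueaNhd n := by
  obtain ⟨y, hy, rfl⟩ := hx
  have hy' : (y : Completed) ∈ closure (toCompleted '' (gradedPiece 0 : Set Enveloping)) := hy
  obtain ⟨_, hs, u, hu, rfl⟩ := ((mem_closure_iff_frequently.1 hy').and_eventually
    (eventually_sub_mem_completedNhd tendsto_id n)).exists.imp fun _ h => And.symm h
  exact ⟨u, hu, (y : GradedCompletion) - ⟨toCompleted u, toCompleted_mem_adjoin u⟩, hs,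
    map_sub _ _ _⟩

/-- The image in `𝒰` of the graded piece `U_e`. -/
def ueaPiece (e : ℤ) : Submodule ℂ UEA := (gradedPiece e).map toUEA.toLinearMap

theorem toUEA_mem_ueaPiece {e : ℤ} {u : Enveloping} (hu : u ∈ gradedPiece e) :
    toUEA u ∈ ueaPiece e := ⟨u, hu, rfl⟩

instance : SetLike.GradedMonoid ueaPiece where
  one_mem := ⟨1, Submodule.subset_span IsMonomial.one, map_one toUEA⟩
  mul_mem _ _ _ _ := by
    rintro ⟨u, hu, rfl⟩ ⟨v, hv, rfl⟩
    exact ⟨u * v, mul_mem_gradedPiece hu hv, map_mul toUEA u v⟩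

/-! ### The oscillators in the universal enveloping algebra -/

theorem toUEA_mode_vacuum_neg_one : toUEA (mode 1 (-1)) = 1 := by
  rw [← sub_eq_zero, ← map_one toUEA, ← map_sub]
  exact Ideal.Quotient.eq_zero_iff_mem.2 (subset_closure
    (TwoSidedIdeal.subset_span (Or.inr (map_sub toCompleted _ _))))

theorem mode_vacuum {n : ℤ} (hn : n ≠ -1) : mode 1 n = 0 := by
  have hn' : ((n + 1 : ℤ) : ℂ) ≠ 0 := Int.cast_ne_zero.2 (by omega)
  have h : bracketMode 1 n = 0 := by
    rw [bracketMode, Submodule.mkQ_apply, Submodule.Quotient.mk_eq_zero]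
    refine ⟨((n + 1 : ℤ) : ℂ)⁻¹ • Finsupp.single (n + 1) 1, ?_⟩
    rw [map_smul, nabla_single, translation_one, Finsupp.single_zero, zero_add,
      add_sub_cancel_right, inv_smul_smul₀ hn']
  rw [mode, h, map_zero]

theorem mode_mul_mode (a b : Fock) (m n : ℤ) :
    mode a m * mode b n = mode b n * mode a m + envι (lieBracket a b m n) := by
  have h := RingQuot.mkAlgHom_rel ℂ (EnvelopingRel.lie a b m n)
  rwa [map_mul, map_add, map_mul] at h

theorem OscillatorFamily.act_X (ρ : OscillatorFamily) (k : ℕ) (n : ℤ) (v : Fock) :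
    ρ.act n (X k) v = ncoeff (ρ.field k) n v := by
  obtain ⟨N, hact, hsum⟩ := ((ρ.eventually_act_X_mul_monomial (k := k) (s := 0) (by simp) n v).and
    (eventually_sum_range_ite_eq n fun i => ncoeff (ρ.field k) i v)).exists
  rw [← mul_one (X k), ← C_1, C_apply, hact, ← hsum]
  refine sum_congr rfl fun i _ => ?_
  rw [monomial_zero', C_1, ρ.act_one, ρ.act_one]
  split_ifs <;> first | omega | simp

theorem OscillatorFamily.act_X_zero (ρ : OscillatorFamily) (n : ℤ) : ρ.act n (X 0) = ρ.osc n :=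
  LinearMap.ext fun v => by simp [ρ.act_X, ρ.ncoeff_field]

theorem oscillator_natCast_X_zero (k : ℕ) : oscillator k (X 0) = if k = 1 then 1 else 0 := by
  match k with
  | 0 => rfl
  | 1 => simp [oscillator]
  | k + 2 =>
    rw [if_neg (by omega)]
    change (((k + 1 : ℕ) : ℂ) + 1) • pderiv (k + 1) (X 0 : Fock) = 0
    rw [pderiv_X_of_ne (by omega), smul_zero]

theorem lieBracket_X_zero (m n : ℤ) :
    lieBracket (X 0) (X 0) m n = m • bracketMode 1 (m + n - 1) := by
  have hproduct (k : ℕ) : nthProduct k (X 0) (X 0) = if k = 1 then 1 else 0 := by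
    rw [nthProduct_eq_act, OscillatorFamily.act_X_zero]
    exact oscillator_natCast_X_zero k
  rw [lieBracket, finsum_eq_single _ 1 fun k hk => ?_]
  · rw [hproduct, if_pos rfl, Ring.choose_one_right, Nat.cast_one]
  · rw [hproduct, if_neg hk, bracketMode_zero, smul_zero]

/-- The oscillator `b_n` in the universal enveloping algebra of `π`. -/
def ueaOscillator (n : ℤ) : UEA := toUEA (mode (X 0) n)

theorem ueaOscillator_mul (m n : ℤ) : ueaOscillator m * ueaOscillator n =
    ueaOscillator n * ueaOscillator m + if m + n = 0 then (m : ℂ) • 1 else 0 := by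
  have hbracket : toUEA (envι (lieBracket (X 0) (X 0) m n)) = m • toUEA (mode 1 (m + n - 1)) := by
    rw [lieBracket_X_zero, map_zsmul, map_zsmul, mode]
  rw [ueaOscillator, ueaOscillator, ← map_mul, mode_mul_mode, map_add, map_mul, hbracket]
  split_ifs with h
  · rw [h, zero_sub, toUEA_mode_vacuum_neg_one, Int.cast_smul_eq_zsmul]
  · rw [mode_vacuum (by omega), map_zero, smul_zero]

theorem commute_ueaOscillator {m n : ℤ} (h : m + n ≠ 0) :
    Commute (ueaOscillator m) (ueaOscillator n) := by
  rw [Commute, SemiconjBy, ueaOscillator_mul, if_neg h, add_zero]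

theorem ueaOscillator_mem_ueaPiece (n : ℤ) : ueaOscillator n ∈ ueaPiece (-n) := by
  have h := mode_mem_gradedPiece (isWeightedHomogeneous_X ℂ conformalWeight 0) n
  rw [conformalWeight, Nat.cast_zero, zero_add, sub_right_comm, sub_self, zero_sub] at h
  exact toUEA_mem_ueaPiece h

/-! ### Normal ordering -/

section CommAeval

variable {R A σ : Type*} [CommSemiring R] [Semiring A] [Algebra R A]

open scoped IsMulCommutative in
/-- Evaluation of polynomials at pairwise commuting elements of an algebra that need not be
commutative. -/
def commAeval (b : σ → A) (h : ∀ i j, Commute (b i) (b j)) : MvPolynomial σ R →ₐ[R] A :=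
  haveI := Algebra.isMulCommutative_adjoin R (s := Set.range b) <| by
    rintro _ ⟨i, rfl⟩ _ ⟨j, rfl⟩
    exact h i j
  (Algebra.adjoin R (Set.range b)).val.comp
    (aeval fun k => ⟨b k, Algebra.subset_adjoin ⟨k, rfl⟩⟩)

theorem commAeval_X (b : σ → A) (h : ∀ i j, Commute (b i) (b j)) (k : σ) :
    commAeval (R := R) b h (X k) = b k := by
  simp [commAeval]

theorem algHom_mem_of_isWeightedHomogeneous [LinearOrder σ] {M N : Type*} [AddCommMonoid M]
    [AddCommMonoid N] {w : σ → M} (φ : M →+ N) (𝒜 : N → Submodule R A) [SetLike.GradedMonoid 𝒜]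
    {F : MvPolynomial σ R →ₐ[R] A} (hX : ∀ k, F (X k) ∈ 𝒜 (φ (w k))) {m : M}
    {f : MvPolynomial σ R} (hf : IsWeightedHomogeneous w f m) : F f ∈ 𝒜 (φ m) := by
  refine weightedHomogeneous_induction_on_min (P := fun m f => F f ∈ 𝒜 (φ m))
    ?_ ?_ ?_ ?_ ?_ hf
  · rw [map_one, map_zero]
    exact SetLike.GradedOne.one_mem
  · intro m k s _ hs
    rw [map_mul, map_add]
    exact SetLike.GradedMul.mul_mem (hX k) hs
  · intro m
    rw [map_zero]
    exact zero_mem _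
  · intro m p q hp hq
    rw [map_add]
    exact add_mem hp hq
  · intro m c p hp
    rw [map_smul]
    exact Submodule.smul_mem _ c hp

end CommAeval

/-- Polynomials in the creation operators `b₀, b₋₁, …`, where `X k` stands for `b₋ₖ`. The central
element `b₀` is counted among them. -/
def creation : Fock →ₐ[ℂ] UEA :=
  commAeval (fun k => ueaOscillator (-k)) fun i j => by
    by_cases h : -(i : ℤ) + -(j : ℤ) = 0
    · obtain rfl : i = j := by omega
      exact Commute.refl _
    · exact commute_ueaOscillator h

/-- Polynomials in the annihilation operators `b₁, b₂, …`, where `X k` stands for `bₖ₊₁`. -/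
def annihilation : Fock →ₐ[ℂ] UEA :=
  commAeval (fun k => ueaOscillator (k + 1)) fun i j => commute_ueaOscillator (by omega)

theorem creation_X (k : ℕ) : creation (X k) = ueaOscillator (-k) := commAeval_X _ _ k

theorem annihilation_X (k : ℕ) : annihilation (X k) = ueaOscillator (k + 1) := commAeval_X _ _ k

theorem ueaOscillator_mul_creation_X (k j : ℕ) : ueaOscillator (k + 1) * creation (X j) =
    creation (((k : ℂ) + 1) • pderiv (k + 1) (X j)) + creation (X j) * ueaOscillator (k + 1) := by
  rw [creation_X, ueaOscillator_mul, add_comm]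
  congr 1
  obtain rfl | h := eq_or_ne j (k + 1)
  · rw [if_pos (by push_cast; ring), pderiv_X_self, map_smul, map_one]
    push_cast
    rfl
  · rw [if_neg (by omega), pderiv_X_of_ne h, smul_zero, map_zero]

theorem ueaOscillator_mul_creation (k : ℕ) (f : Fock) : ueaOscillator (k + 1) * creation f =
    creation (((k : ℂ) + 1) • pderiv (k + 1) f) + creation f * ueaOscillator (k + 1) := by
  induction f using MvPolynomial.induction_on with
  | C c =>
    rw [pderiv_C, smul_zero, map_zero, zero_add, ← algebraMap_eq, AlgHom.commutes,
      Algebra.commutes]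
  | add p q hp hq =>
    simp only [map_add, smul_add, mul_add, add_mul, hp, hq]
    abel
  | mul_X p j hp =>
    rw [map_mul, ← mul_assoc, hp, add_mul, mul_assoc, ueaOscillator_mul_creation_X, mul_add,
      ← map_mul, ← map_mul, ← mul_assoc, ← map_mul, ← add_assoc, ← map_add, smul_mul_assoc,
      mul_smul_comm, ← smul_add, Derivation.leibniz, smul_eq_mul, smul_eq_mul, mul_comm (X j),
      add_comm (_ * X j)]

theorem creation_mem_ueaPiece {z : ℤ} {f : Fock}
    (hf : IsWeightedHomogeneous ((↑) : ℕ → ℤ) f z) : creation f ∈ ueaPiece z := by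
  refine algHom_mem_of_isWeightedHomogeneous (F := creation) (AddMonoidHom.id ℤ) ueaPiece
    (fun k => ?_) hf
  simpa only [creation_X, neg_neg, AddMonoidHom.id_apply] using ueaOscillator_mem_ueaPiece (-k)

theorem annihilation_mem_ueaPiece {z : ℤ} {f : Fock}
    (hf : IsWeightedHomogeneous conformalWeight f z) : annihilation f ∈ ueaPiece (-z) := by
  refine algHom_mem_of_isWeightedHomogeneous (F := annihilation) (negAddMonoidHom : ℤ →+ ℤ)
    ueaPiece (fun k => ?_) hf
  rw [annihilation_X, negAddMonoidHom_apply, conformalWeight]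
  exact ueaOscillator_mem_ueaPiece (k + 1)

/-- The span of the normally ordered products of degree `e` (creation operators to the left of
annihilation operators) whose annihilation part has degree at most `-m`. -/
def normallyOrdered (m e : ℤ) : Submodule ℂ UEA := Submodule.span ℂ
  {x | ∃ i j : ℤ, i - j = e ∧ m ≤ j ∧ ∃ f g : Fock,
    IsWeightedHomogeneous ((↑) : ℕ → ℤ) f i ∧ IsWeightedHomogeneous conformalWeight g j ∧
      creation f * annihilation g = x}

theorem creation_mul_annihilation_mem_normallyOrdered {m e i j : ℤ} (hij : i - j = e) (hm : m ≤ j)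
    {f g : Fock} (hf : IsWeightedHomogeneous ((↑) : ℕ → ℤ) f i)
    (hg : IsWeightedHomogeneous conformalWeight g j) :
    creation f * annihilation g ∈ normallyOrdered m e :=
  Submodule.subset_span ⟨i, j, hij, hm, f, g, hf, hg, rfl⟩

theorem normallyOrdered_anti {m n : ℤ} (h : m ≤ n) (e : ℤ) :
    normallyOrdered n e ≤ normallyOrdered m e :=
  Submodule.span_mono fun _ ⟨i, j, hij, hj, hx⟩ => ⟨i, j, hij, h.trans hj, hx⟩

theorem normallyOrdered_le_ueaPiece (m e : ℤ) : normallyOrdered m e ≤ ueaPiece e := by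
  refine Submodule.span_le.2 ?_
  rintro _ ⟨i, j, rfl, _, f, g, hf, hg, rfl⟩
  rw [sub_eq_add_neg]
  exact SetLike.GradedMul.mul_mem (creation_mem_ueaPiece hf) (annihilation_mem_ueaPiece hg)

theorem mem_UEAZero_of_mem_normallyOrdered {m : ℤ} {x : UEA} (hx : x ∈ normallyOrdered m 0) :
    x ∈ UEAZero := by
  obtain ⟨u, hu, rfl⟩ := normallyOrdered_le_ueaPiece m 0 hx
  exact toUEA_mem_UEAZero hu

theorem normallyOrdered_le_ueaNhd (m e : ℤ) :
    normallyOrdered m e ≤ (ueaNhd m).restrictScalars ℂ := by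
  refine Submodule.span_le.2 ?_
  rintro _ ⟨i, j, _, hj, f, g, _, hg, rfl⟩
  obtain ⟨u, hu, h⟩ := annihilation_mem_ueaPiece hg
  refine Ideal.mul_mem_left _ _ ?_
  rw [← h]
  exact toUEA_mem_ueaNhd (mem_leftNhd_of_mem_gradedPiece hu (neg_le_neg hj))

theorem one_mem_normallyOrdered : (1 : UEA) ∈ normallyOrdered 0 0 := by
  have h := creation_mul_annihilation_mem_normallyOrdered (sub_zero 0) le_rfl
    (isWeightedHomogeneous_one ℂ ((↑) : ℕ → ℤ)) (isWeightedHomogeneous_one ℂ conformalWeight)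
  rwa [map_one, map_one, one_mul] at h

theorem ueaOscillator_mul_mem_normallyOrdered (n : ℤ) {m e : ℤ} {x : UEA}
    (hx : x ∈ normallyOrdered m e) : ueaOscillator n * x ∈ normallyOrdered m (e - n) := by
  suffices h : normallyOrdered m e ≤
      (normallyOrdered m (e - n)).comap (LinearMap.mulLeft ℂ (ueaOscillator n)) from h hx
  refine Submodule.span_le.2 ?_
  rintro _ ⟨i, j, rfl, hj, f, g, hf, hg, rfl⟩
  change ueaOscillator n * (creation f * annihilation g) ∈ normallyOrdered m (i - j - n)
  obtain hn | hn := le_or_gt n 0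
  · obtain ⟨k, rfl⟩ := Int.exists_eq_neg_ofNat hn
    rw [← creation_X, ← mul_assoc, ← map_mul]
    exact creation_mul_annihilation_mem_normallyOrdered (by ring) hj
      ((isWeightedHomogeneous_X ℂ _ k).mul hf) hg
  · obtain ⟨k, rfl⟩ : ∃ k : ℕ, n = k + 1 := ⟨(n - 1).toNat, by omega⟩
    rw [← mul_assoc, ueaOscillator_mul_creation, add_mul, mul_assoc, ← annihilation_X, ← map_mul]
    refine add_mem ?_ ?_
    · have hpderiv := hf.pderiv (sub_add_cancel i ((k + 1 : ℕ) : ℤ))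
      exact creation_mul_annihilation_mem_normallyOrdered (by push_cast; ring) hj
        ((weightedHomogeneousSubmodule ℂ _ _).smul_mem _ hpderiv) hg
    · exact creation_mul_annihilation_mem_normallyOrdered (by rw [conformalWeight]; ring)
        (by rw [conformalWeight]; omega) hf ((isWeightedHomogeneous_X ℂ _ k).mul hg)

/-! ### Reordering modulo neighbourhoods of zero -/

theorem jacobiTerm_mem_leftNhd {a b : Fock} {y z : ℤ}
    (ha : IsWeightedHomogeneous conformalWeight a y)
    (hb : IsWeightedHomogeneous conformalWeight b z) (l m n N : ℤ) {i : ℕ}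
    (hi : z - n - 1 + N ≤ i) (hi' : y - m - 1 + N ≤ i) : jacobiTerm a b l m n i ∈ leftNhd N := by
  refine zsmul_mem (sub_mem (Ideal.mul_mem_left _ _ ?_)
    (zsmul_mem (Ideal.mul_mem_left _ _ ?_) _)) _
  · exact mem_leftNhd_of_mem_gradedPiece (mode_mem_gradedPiece hb _) (by omega)
  · exact mem_leftNhd_of_mem_gradedPiece (mode_mem_gradedPiece ha _) (by omega)

theorem jacobiTerm_mem_gradedPiece {a b : Fock} {y z : ℤ}
    (ha : IsWeightedHomogeneous conformalWeight a y)
    (hb : IsWeightedHomogeneous conformalWeight b z) (l m n : ℤ) (i : ℕ) :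
    jacobiTerm a b l m n i ∈ gradedPiece (y + z - l - m - n - 2) := by
  have hab := mul_mem_gradedPiece (mode_mem_gradedPiece ha (m + l - i))
    (mode_mem_gradedPiece hb (n + i))
  have hba := mul_mem_gradedPiece (mode_mem_gradedPiece hb (n + l - i))
    (mode_mem_gradedPiece ha (m + i))
  rw [show y - (m + l - i) - 1 + (z - (n + i) - 1) = y + z - l - m - n - 2 by ring] at hab
  rw [show z - (n + l - i) - 1 + (y - (m + i) - 1) = y + z - l - m - n - 2 by ring] at hba
  exact zsmul_mem (sub_mem hab (zsmul_mem hba _)) _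

theorem summable_jacobiTerm {a b : Fock} {y z : ℤ}
    (ha : IsWeightedHomogeneous conformalWeight a y)
    (hb : IsWeightedHomogeneous conformalWeight b z) (l m n : ℤ) :
    Summable fun i : ℕ => toCompleted (jacobiTerm a b l m n i) := by
  have : NonarchimedeanRing Enveloping := leftNhd_basis.nonarchimedean
  have : NonarchimedeanAddGroup Completed := inferInstance
  have hlim : Tendsto (fun i : ℕ => jacobiTerm a b l m n i) atTop (nhds 0) := by
    refine leftNhd_basis.hasBasis_nhds_zero.tendsto_right_iff.2 fun N _ => ?_
    filter_upwards [eventually_ge_atTop (max (z - n - 1 + N) (y - m - 1 + N)).toNat] with i hi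
    exact jacobiTerm_mem_leftNhd ha hb l m n N (by omega) (by omega)
  refine NonarchimedeanAddGroup.summable_of_tendsto_cofinite_zero ?_
  rw [Nat.cofinite_eq_atTop, ← map_zero toCompleted]
  exact ((UniformSpace.Completion.continuous_coe Enveloping).tendsto 0).comp hlim

theorem eventually_toUEA_jacobiRight_sub_mem_ueaNhd {a b : Fock} {y z : ℤ}
    (ha : IsWeightedHomogeneous conformalWeight a y)
    (hb : IsWeightedHomogeneous conformalWeight b z) (l m n N : ℤ) :
    ∀ᶠ T : ℕ in atTop, toUEA (jacobiRight a b l m n) -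
      toUEA (∑ i ∈ range T, jacobiTerm a b l m n i) ∈ ueaNhd N := by
  obtain ⟨s, hs⟩ := summable_jacobiTerm ha hb l m n
  have hmem : s ∈ Algebra.adjoin ℂ (⋃ d : ℤ, completedPiece d) := by
    refine Algebra.subset_adjoin (Set.mem_iUnion.2 ⟨y + z - l - m - n - 2,
      mem_closure_of_tendsto hs.tendsto_sum_nat (Eventually.of_forall fun T => ?_)⟩)
    rw [← map_sum]
    exact ⟨_, sum_mem fun i _ => jacobiTerm_mem_gradedPiece ha hb l m n i, rfl⟩
  have hquot : Ideal.Quotient.mk closedIdeal ⟨s, hmem⟩ = toUEA (jacobiRight a b l m n) := by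
    rw [toUEA_apply, Ideal.Quotient.eq]
    exact subset_closure (TwoSidedIdeal.subset_span (Or.inl ⟨a, b, l, m, n, s, hs, rfl⟩))
  filter_upwards [eventually_sub_mem_completedNhd hs.tendsto_sum_nat N] with T hT
  rw [← map_sum] at hT
  rw [← hquot]
  exact ⟨⟨s, hmem⟩ - ⟨toCompleted (∑ i ∈ range T, jacobiTerm a b l m n i),
    toCompleted_mem_adjoin _⟩, hT, map_sub _ _ _⟩

theorem jacobiRight_X_zero (k : ℕ) (b : Fock) (n : ℤ) :
    jacobiRight (X 0) b (Int.negSucc k) 0 n = mode (X k * b) n := by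
  rw [jacobiRight, finsum_eq_single _ 0 fun i hi => ?_]
  · rw [nthProduct_eq_act, Nat.cast_zero, add_zero, OscillatorFamily.act_X_zero,
      Ring.choose_zero_right, one_smul, zero_add, sub_zero]
    rfl
  · obtain ⟨j, rfl⟩ := Nat.exists_eq_succ_of_ne_zero hi
    rw [Ring.choose_zero_succ, zero_smul]

theorem ueaOscillator_mul_mem_sup (n : ℤ) {m e N : ℤ} {x : UEA}
    (hx : x ∈ normallyOrdered m e ⊔ (ueaNhd N).restrictScalars ℂ) :
    ueaOscillator n * x ∈ normallyOrdered m (e - n) ⊔ (ueaNhd N).restrictScalars ℂ := by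
  obtain ⟨p, hp, q, hq, rfl⟩ := Submodule.mem_sup.1 hx
  rw [mul_add]
  exact Submodule.add_mem_sup (ueaOscillator_mul_mem_normallyOrdered n hp)
    (Ideal.mul_mem_left _ _ hq)

/-- The Jacobi relation for `b₋₁ |0⟩`, `b` and `ℓ = -k - 1` expresses the modes of `b₋ₖ₋₁ b` through
oscillators and modes of `b`. -/
theorem exists_toUEA_mode_X_mul_sub_mem_ueaNhd {z e : ℤ} {b : Fock}
    (hb : IsWeightedHomogeneous conformalWeight b z) (k : ℕ) (n N : ℤ) {p : UEA}
    (hp : p ∈ ueaPiece e) :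
    ∃ T : ℕ, toUEA (mode (X k * b) n) * p -
      ∑ i ∈ range T, toUEA (jacobiTerm (X 0) b (Int.negSucc k) 0 n i) * p ∈ ueaNhd N := by
  obtain ⟨u, hu, rfl⟩ := hp
  obtain ⟨T, hT⟩ := (eventually_toUEA_jacobiRight_sub_mem_ueaNhd
    (isWeightedHomogeneous_X ℂ conformalWeight 0) hb (Int.negSucc k) 0 n (N + e)).exists
  have h := mul_toUEA_mem_ueaNhd hT hu
  rw [jacobiRight_X_zero, add_sub_cancel_right, sub_mul, map_sum, sum_mul] at h
  exact ⟨T, h⟩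

theorem toUEA_mode_vacuum_mul_mem_normallyOrdered (n : ℤ) {m e : ℤ} {p : UEA}
    (hp : p ∈ normallyOrdered m e) : toUEA (mode 1 n) * p ∈ normallyOrdered m (e - n - 1) := by
  obtain rfl | hn := eq_or_ne n (-1)
  · rwa [toUEA_mode_vacuum_neg_one, one_mul, sub_neg_eq_add, add_sub_cancel_right]
  · rw [mode_vacuum hn, map_zero, zero_mul]
    exact zero_mem _

theorem toUEA_jacobiTerm_X_zero_mul_mem_sup {z : ℤ} {b : Fock} {m e N : ℤ}
    (hb : ∀ (n e : ℤ) (p : UEA), p ∈ normallyOrdered m e → toUEA (mode b n) * p ∈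
      normallyOrdered m (e + z - n - 1) ⊔ (ueaNhd N).restrictScalars ℂ)
    (k : ℕ) (n : ℤ) (i : ℕ) {p : UEA} (hp : p ∈ normallyOrdered m e) :
    toUEA (jacobiTerm (X 0) b (Int.negSucc k) 0 n i) * p ∈
      normallyOrdered m (e + (k + 1 + z) - n - 1) ⊔ (ueaNhd N).restrictScalars ℂ := by
  have hab := ueaOscillator_mul_mem_sup (0 + Int.negSucc k - i) (hb (n + i) e p hp)
  have hba := hb (n + Int.negSucc k - i) (e - (0 + i)) _
    (ueaOscillator_mul_mem_normallyOrdered (0 + i) hp)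
  rw [show e + z - (n + i) - 1 - (0 + Int.negSucc k - i) = e + (k + 1 + z) - n - 1 by
    rw [Int.negSucc_eq]; ring, ueaOscillator, ← mul_assoc] at hab
  rw [show e - (0 + (i : ℤ)) + z - (n + Int.negSucc k - i) - 1 = e + (k + 1 + z) - n - 1 by
    rw [Int.negSucc_eq]; ring, ueaOscillator, ← mul_assoc] at hba
  rw [jacobiTerm, map_zsmul, map_sub, map_mul, map_zsmul, map_mul, smul_mul_assoc, sub_mul,
    smul_mul_assoc]
  exact zsmul_mem (sub_mem hab (zsmul_mem hba _)) _

theorem toUEA_mode_mul_mem_sup {z : ℤ} {a : Fock} (ha : IsWeightedHomogeneous conformalWeight a z)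
    (n m e N : ℤ) {p : UEA} (hp : p ∈ normallyOrdered m e) :
    toUEA (mode a n) * p ∈
      normallyOrdered m (e + z - n - 1) ⊔ (ueaNhd N).restrictScalars ℂ := by
  refine (weightedHomogeneous_induction_on_min
    (P := fun z a => IsWeightedHomogeneous conformalWeight a z ∧ ∀ (n e : ℤ) (p : UEA),
      p ∈ normallyOrdered m e → toUEA (mode a n) * p ∈
        normallyOrdered m (e + z - n - 1) ⊔ (ueaNhd N).restrictScalars ℂ)
    ?_ ?_ ?_ ?_ ?_ ha).2 n e p hp
  · refine ⟨isWeightedHomogeneous_one _ _, fun n e p hp => Submodule.mem_sup_left ?_⟩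
    rw [add_zero]
    exact toUEA_mode_vacuum_mul_mem_normallyOrdered n hp
  · rintro z k s _ ⟨hs, ih⟩
    refine ⟨(isWeightedHomogeneous_X ℂ _ k).mul hs, fun n e p hp => ?_⟩
    obtain ⟨T, hT⟩ := exists_toUEA_mode_X_mul_sub_mem_ueaNhd hs k n N
      (normallyOrdered_le_ueaPiece m e hp)
    rw [← sub_add_cancel (toUEA _ * p)]
    exact add_mem (Submodule.mem_sup_right hT)
      (sum_mem fun i _ => toUEA_jacobiTerm_X_zero_mul_mem_sup ih k n i hp)
  · refine fun z => ⟨isWeightedHomogeneous_zero _ _ z, fun n e p _ => ?_⟩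
    rw [mode_zero, map_zero, zero_mul]
    exact zero_mem _
  · rintro z a b ⟨ha, iha⟩ ⟨hb, ihb⟩
    refine ⟨ha.add hb, fun n e p hp => ?_⟩
    rw [mode_add, map_add, add_mul]
    exact add_mem (iha n e p hp) (ihb n e p hp)
  · rintro z c a ⟨ha, iha⟩
    refine ⟨(weightedHomogeneousSubmodule ℂ _ _).smul_mem c ha, fun n e p hp => ?_⟩
    rw [mode_smul, map_smul, smul_mul_assoc]
    exact Submodule.smul_mem _ c (iha n e p hp)

theorem gradedPiece_le_comap_toUEA (d N : ℤ) : gradedPiece d ≤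
    (normallyOrdered 0 d ⊔ (ueaNhd N).restrictScalars ℂ).comap toUEA.toLinearMap := by
  refine Submodule.span_le.2 fun u hu => ?_
  change toUEA u ∈ normallyOrdered 0 d ⊔ (ueaNhd N).restrictScalars ℂ
  induction hu with
  | one =>
    rw [map_one]
    exact Submodule.mem_sup_left one_mem_normallyOrdered
  | @mul w a ha n d u _ ih =>
    obtain ⟨p, hp, q, hq, h⟩ := Submodule.mem_sup.1 ih
    have hmode := toUEA_mode_mul_mem_sup (mem_weightSpace.1 ha) n 0 d N hp
    rw [show d + w - n - 1 = w - n - 1 + d by ring] at hmode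
    rw [map_mul, ← h, mul_add]
    exact add_mem hmode (Submodule.mem_sup_right (Ideal.mul_mem_left _ _ hq))

theorem exists_mem_normallyOrdered_sub_mem_ueaNhd {x : UEA} (hx : x ∈ UEAZero) (N : ℤ) :
    ∃ p ∈ normallyOrdered 0 0, x - p ∈ ueaNhd N := by
  obtain ⟨u, hu, hxu⟩ := exists_sub_toUEA_mem_ueaNhd hx N
  obtain ⟨p, hp, q, hq, hpq⟩ := Submodule.mem_sup.1 (gradedPiece_le_comap_toUEA 0 N hu)
  have hpq' : toUEA u - p = q := sub_eq_of_eq_add' hpq.symm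
  rw [← hpq'] at hq
  exact ⟨p, hp, sub_add_sub_cancel x (toUEA u) p ▸ add_mem hxu hq⟩

/-! ### Partitions -/

theorem conformalWeight_eq_natCast : conformalWeight = fun k => ((k + 1 : ℕ) : ℤ) :=
  _root_.funext fun k => (Nat.cast_succ k).symm

/-- The exponents of the monomials of weight `j`, where the variable `X k` has weight `k + 1`. They
index the bases of the pieces of degree `j` of `π` over `ℂ` and of the universal Fock module over
`ℂ[x]`. -/
abbrev Exponents (j : ℕ) : Type := {s : ℕ →₀ ℕ // Finsupp.weight conformalWeight s = j}

theorem sum_map_succ_toMultiset (s : ℕ →₀ ℕ) :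
    (((s.toMultiset.map (· + 1)).sum : ℕ) : ℤ) = Finsupp.weight conformalWeight s := by
  induction s using Finsupp.induction_linear with
  | zero => simp
  | add s t hs ht => rw [map_add, Multiset.map_add, Multiset.sum_add, Nat.cast_add, hs, ht, map_add]
  | single n a => simp [Multiset.map_nsmul, Multiset.sum_nsmul, Finsupp.weight_single,
      conformalWeight]

theorem map_succ_map_pred {s : Multiset ℕ} (hs : ∀ i ∈ s, 0 < i) :
    (s.map Nat.pred).map (· + 1) = s := by
  rw [Multiset.map_map]
  exact (Multiset.map_congr rfl fun i hi => Nat.succ_pred_eq_of_pos (hs i hi)).trans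
    (Multiset.map_id s)

/-- The bijection between monomials of weight `j` and partitions of `j`: the exponent of `X k` is
the multiplicity of the part `k + 1`. -/
def exponentsEquivPartition (j : ℕ) : Exponents j ≃ Nat.Partition j where
  toFun s :=
    { parts := s.1.toMultiset.map (· + 1)
      parts_pos := fun hi => by
        obtain ⟨k, _, rfl⟩ := Multiset.mem_map.1 hi
        exact k.succ_pos
      parts_sum := by exact_mod_cast (sum_map_succ_toMultiset s.1).trans s.2 }
  invFun p := ⟨Multiset.toFinsupp (p.parts.map Nat.pred), by
    rw [← sum_map_succ_toMultiset, Multiset.toFinsupp_toMultiset,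
      map_succ_map_pred fun _ => p.parts_pos, p.parts_sum]⟩
  left_inv s := Subtype.ext <| by
    simp [Multiset.map_map]
  right_inv p := Nat.Partition.ext <| by
    simp only [Multiset.toFinsupp_toMultiset, map_succ_map_pred fun _ => p.parts_pos]

instance (j : ℕ) : Fintype (Exponents j) := Fintype.ofEquiv _ (exponentsEquivPartition j).symm

theorem eq_zero_of_weight_eq_zero {s : ℕ →₀ ℕ} (hs : Finsupp.weight conformalWeight s = 0) :
    s = 0 := by
  have hempty := sum_map_succ_toMultiset s
  rw [hs, Nat.cast_eq_zero, Multiset.sum_eq_zero_iff] at hempty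
  refine Multiset.toFinsupp.symm.injective (Multiset.eq_zero_of_forall_notMem fun k hk => ?_)
  exact k.succ_ne_zero (hempty _ (Multiset.mem_map_of_mem _ hk))

theorem eq_sum_monomial {R : Type*} [CommSemiring R] {p : MvPolynomial ℕ R} {j : ℕ}
    (hp : IsWeightedHomogeneous conformalWeight p j) :
    p = ∑ s : Exponents j, monomial s.1 (coeff s.1 p) := by
  ext t
  simp only [coeff_sum, coeff_monomial]
  by_cases ht : Finsupp.weight conformalWeight t = j
  · rw [sum_eq_single_of_mem (⟨t, ht⟩ : Exponents j) (mem_univ _)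
      fun s _ hs => if_neg fun h => hs (Subtype.ext h), if_pos rfl]
  · rw [hp.coeff_eq_zero t ht, sum_eq_zero]
    exact fun s _ => if_neg fun h : s.1 = t => ht (h ▸ s.2)

/-! ### Polynomials over the zeroth variable -/

section SeparateZeroth

variable (R : Type*) [CommSemiring R]

/-- The identification of `R[x₀, x₁, …]` with `R[x₀][x₁, x₂, …]`. The variable `x₀` becomes the
polynomial variable of the coefficients, and `X (k + 1)` becomes `X k`. It exhibits the universal
Fock module as a free module over `ℂ[x]`. -/
def separateZeroth : MvPolynomial ℕ R ≃ₐ[R] MvPolynomial ℕ R[X] :=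
  (renameEquiv R
    ((Equiv.optionEquivSumPUnit.{0} ℕ).trans Equiv.natSumPUnitEquivNat).symm).trans
      (optionEquivRight R ℕ)

variable {R}

theorem separateZeroth_X_zero : separateZeroth R (X 0) = C Polynomial.X := by
  rw [separateZeroth, AlgEquiv.trans_apply, renameEquiv_apply, rename_X]
  exact optionEquivRight_X_none R ℕ

theorem separateZeroth_X_succ (k : ℕ) : separateZeroth R (X (k + 1)) = X k := by
  rw [separateZeroth, AlgEquiv.trans_apply, renameEquiv_apply, rename_X]
  exact optionEquivRight_X_some R ℕ k

theorem separateZeroth_symm_C (p : R[X]) :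
    (separateZeroth R).symm (C p) = Polynomial.aeval (X 0) p := by
  have h := Polynomial.aeval_algHom_apply
    (IsScalarTower.toAlgHom R R[X] (MvPolynomial ℕ R[X])) Polynomial.X p
  rw [Polynomial.aeval_X_left_apply] at h
  rw [AlgEquiv.symm_apply_eq, ← Polynomial.aeval_algHom_apply, separateZeroth_X_zero]
  exact h.symm

theorem pderiv_separateZeroth (k : ℕ) (f : MvPolynomial ℕ R) :
    pderiv k (separateZeroth R f) = separateZeroth R (pderiv (k + 1) f) := by
  induction f using induction_on_min with
  | one => simp only [map_one, Derivation.map_one_eq_zero, map_zero]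
  | X_mul i s _ hs =>
    rw [map_mul (separateZeroth R), pderiv_X_mul, map_add,
      map_mul (separateZeroth R) _ (pderiv _ _), ← hs]
    match i with
    | 0 => simp [separateZeroth_X_zero]
    | i + 1 =>
      rw [separateZeroth_X_succ, pderiv_X_mul, apply_ite (separateZeroth R), map_zero]
      simp only [Nat.succ_inj]
  | add p q hp hq => simp only [map_add, hp, hq]
  | smul c p hp =>
    rw [map_smul, Derivation.map_smul_of_tower, hp, Derivation.map_smul, map_smul]

variable {M : Type*} [AddCommMonoid M] {w : ℕ → M}

theorem isWeightedHomogeneous_separateZeroth (hw : w 0 = 0) {m : M} {f : MvPolynomial ℕ R}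
    (hf : IsWeightedHomogeneous w f m) :
    IsWeightedHomogeneous (fun k => w (k + 1)) (separateZeroth R f) m := by
  refine weightedHomogeneous_induction_on_min (w := w) (P := fun m f =>
    IsWeightedHomogeneous (fun k => w (k + 1)) (separateZeroth R f) m) ?_ ?_ ?_ ?_ ?_ hf
  · rw [map_one]
    exact isWeightedHomogeneous_one _ _
  · rintro m (_ | k) s _ hs
    · rw [map_mul, hw, separateZeroth_X_zero]
      exact (isWeightedHomogeneous_C _ _).mul hs
    · rw [map_mul, separateZeroth_X_succ]
      exact (isWeightedHomogeneous_X _ _ k).mul hs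
  · exact fun m => map_zero (separateZeroth R) ▸ isWeightedHomogeneous_zero _ _ m
  · intro m p q hp hq
    rw [map_add]
    exact hp.add hq
  · intro m c p hp
    rw [map_smul]
    exact ((weightedHomogeneousSubmodule R[X] _ m).restrictScalars R).smul_mem c hp

theorem isWeightedHomogeneous_aeval_X (hw : w 0 = 0) (p : R[X]) :
    IsWeightedHomogeneous w (Polynomial.aeval (X 0) p : MvPolynomial ℕ R) 0 := by
  induction p using Polynomial.induction_on' with
  | add p q hp hq =>
    rw [map_add]
    exact hp.add hq
  | monomial n c =>
    rw [Polynomial.aeval_monomial]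
    have h := (isWeightedHomogeneous_C w c).mul ((isWeightedHomogeneous_X R w 0).pow n)
    rwa [hw, smul_zero, add_zero] at h

theorem isWeightedHomogeneous_separateZeroth_symm (hw : w 0 = 0) {m : M} {f : MvPolynomial ℕ R[X]}
    (hf : IsWeightedHomogeneous (fun k => w (k + 1)) f m) :
    IsWeightedHomogeneous w ((separateZeroth R).symm f) m := by
  refine weightedHomogeneous_induction_on_min (w := fun k => w (k + 1)) (P := fun m f =>
    IsWeightedHomogeneous w ((separateZeroth R).symm f) m) ?_ ?_ ?_ ?_ ?_ hf
  · rw [map_one]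
    exact isWeightedHomogeneous_one _ _
  · intro m k s _ hs
    rw [map_mul, ← separateZeroth_X_succ, AlgEquiv.symm_apply_apply]
    exact (isWeightedHomogeneous_X _ _ (k + 1)).mul hs
  · exact fun m => map_zero (separateZeroth R).symm ▸ isWeightedHomogeneous_zero _ _ m
  · intro m p q hp hq
    rw [map_add]
    exact hp.add hq
  · intro m c p hp
    rw [smul_eq_C_mul, map_mul, separateZeroth_symm_C]
    exact zero_add m ▸ (isWeightedHomogeneous_aeval_X hw c).mul hp

end SeparateZeroth

theorem map_aeval_mul {R A : Type*} [CommSemiring R] [Semiring A] [Algebra R A] {a : A}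
    {f : Module.End R A} (hf : ∀ v, f (a * v) = a * f v) (p : R[X]) (v : A) :
    f (Polynomial.aeval a p * v) = Polynomial.aeval a p * f v := by
  have hcomm : Commute (Polynomial.aeval (Algebra.lmul R A a) p) f :=
    (Algebra.commute_of_mem_adjoin_singleton_of_commute
      (Polynomial.aeval_mem_adjoin_singleton R _) (LinearMap.ext hf)).symm
  rw [Polynomial.aeval_algHom_apply] at hcomm
  exact (LinearMap.congr_fun hcomm v).symm

/-! ### Matrices over `ℂ[x]` -/

theorem ueaAct_creation (f v : Fock) : ueaAct (creation f) v = f * v := by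
  induction f using MvPolynomial.induction_on generalizing v with
  | C c =>
    rw [← algebraMap_eq, AlgHom.commutes, AlgHom.commutes, Module.algebraMap_end_apply,
      Algebra.smul_def]
  | add p q hp hq => rw [map_add, map_add, LinearMap.add_apply, hp, hq, add_mul]
  | mul_X p k hp =>
    rw [map_mul, map_mul, Module.End.mul_apply, hp, creation_X, ueaOscillator, ueaAct_toUEA,
      envelopingAct_mode, OscillatorFamily.act_X_zero, mul_assoc]
    congr 1
    cases k <;> rfl

theorem ueaAct_annihilation_X (k : ℕ) (v : Fock) :
    ueaAct (annihilation (X k)) v = ((k : ℂ) + 1) • pderiv (k + 1) v := by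
  rw [annihilation_X, ueaOscillator, ueaAct_toUEA, envelopingAct_mode, OscillatorFamily.act_X_zero]
  rfl

/-- The action of the universal enveloping algebra of `π` on the universal Fock module, viewed as
the polynomial ring over `ℂ[x]`, where `x` stands for the central element `b₀`. -/
def polynomialAct : UEA →ₐ[ℂ] Module.End ℂ[X] (MvPolynomial ℕ ℂ[X]) :=
  AlgHom.ofLinearMap
    { toFun x :=
        { toFun v := separateZeroth ℂ (ueaAct x ((separateZeroth ℂ).symm v))
          map_add' u v := by simp only [map_add]
          map_smul' p v := by
            rw [smul_eq_C_mul, map_mul, separateZeroth_symm_C, map_aeval_mul (ueaAct_X_zero_mul x),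
              map_mul, ← separateZeroth_symm_C, AlgEquiv.apply_symm_apply, ← smul_eq_C_mul,
              RingHom.id_apply] }
      map_add' x y := LinearMap.ext fun v => by
        simp only [map_add, LinearMap.add_apply, LinearMap.coe_mk, AddHom.coe_mk]
      map_smul' c x := LinearMap.ext fun v => by
        simp only [map_smul, LinearMap.smul_apply, LinearMap.coe_mk, AddHom.coe_mk,
          RingHom.id_apply] }
    (LinearMap.ext fun v => by simp)
    (fun x y => LinearMap.ext fun v => by simp)

theorem polynomialAct_apply (x : UEA) (v : MvPolynomial ℕ ℂ[X]) :
    polynomialAct x v = separateZeroth ℂ (ueaAct x ((separateZeroth ℂ).symm v)) := rfl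

theorem isWeightedHomogeneous_separateZeroth_iff {z : ℤ} {v : Fock} :
    IsWeightedHomogeneous conformalWeight (separateZeroth ℂ v) z ↔
      IsWeightedHomogeneous ((↑) : ℕ → ℤ) v z := by
  rw [conformalWeight_eq_natCast]
  refine ⟨fun hv => ?_, isWeightedHomogeneous_separateZeroth Nat.cast_zero⟩
  rw [← (separateZeroth ℂ).symm_apply_apply v]
  exact isWeightedHomogeneous_separateZeroth_symm Nat.cast_zero hv

theorem isWeightedHomogeneous_separateZeroth_symm_iff {z : ℤ} {v : MvPolynomial ℕ ℂ[X]} :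
    IsWeightedHomogeneous ((↑) : ℕ → ℤ) ((separateZeroth ℂ).symm v) z ↔
      IsWeightedHomogeneous conformalWeight v z := by
  rw [← isWeightedHomogeneous_separateZeroth_iff, AlgEquiv.apply_symm_apply]

theorem isWeightedHomogeneous_polynomialAct {x : UEA} (hx : x ∈ UEAZero) {z : ℤ}
    {v : MvPolynomial ℕ ℂ[X]} (hv : IsWeightedHomogeneous conformalWeight v z) :
    IsWeightedHomogeneous conformalWeight (polynomialAct x v) z :=
  isWeightedHomogeneous_separateZeroth_iff.2
    (isWeightedHomogeneous_ueaAct hx (isWeightedHomogeneous_separateZeroth_symm_iff.2 hv))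

theorem polynomialAct_eq_zero_of_mem_ueaNhd {n z : ℤ} (hz : z < n) {x : UEA} (hx : x ∈ ueaNhd n)
    {v : MvPolynomial ℕ ℂ[X]} (hv : IsWeightedHomogeneous conformalWeight v z) :
    polynomialAct x v = 0 := by
  rw [polynomialAct_apply, ueaAct_eq_zero_of_mem_ueaNhd hz hx
    (isWeightedHomogeneous_separateZeroth_symm_iff.2 hv), map_zero]

theorem polynomialAct_creation (f : Fock) (v : MvPolynomial ℕ ℂ[X]) :
    polynomialAct (creation f) v = separateZeroth ℂ f * v := by
  rw [polynomialAct_apply, ueaAct_creation, map_mul, AlgEquiv.apply_symm_apply]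

theorem polynomialAct_annihilation_X (k : ℕ) (v : MvPolynomial ℕ ℂ[X]) :
    polynomialAct (annihilation (X k)) v = ((k : ℂ) + 1) • pderiv k v := by
  rw [polynomialAct_apply, ueaAct_annihilation_X, map_smul, ← pderiv_separateZeroth,
    AlgEquiv.apply_symm_apply]

theorem polynomialAct_annihilation_X_monomial (k : ℕ) (t : ℕ →₀ ℕ) :
    polynomialAct (annihilation (X k)) (monomial t 1) =
      (((k : ℂ) + 1) * t k) • monomial (t - Finsupp.single k 1) 1 := by
  rw [polynomialAct_annihilation_X, pderiv_monomial, one_mul, mul_smul, smul_monomial,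
    smul_monomial, smul_monomial, Algebra.smul_def (t k : ℂ), map_natCast, mul_one]

theorem exists_polynomialAct_annihilation_monomial (s : ℕ →₀ ℕ) : ∃ c : ℂ, c ≠ 0 ∧ ∀ t,
    Finsupp.weight conformalWeight t = Finsupp.weight conformalWeight s →
      polynomialAct (annihilation (monomial s 1)) (monomial t 1) =
        if s = t then algebraMap ℂ _ c else 0 := by
  induction s using exponent_induction_on_min with
  | zero =>
    refine ⟨1, one_ne_zero, fun t ht => ?_⟩
    have hone : annihilation (monomial 0 1) = 1 := map_one annihilation
    rw [map_zero] at ht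
    rw [eq_zero_of_weight_eq_zero ht, if_pos rfl, hone, map_one polynomialAct,
      Module.End.one_apply, map_one (algebraMap ℂ _)]
    rfl
  | single_add k s _ ih =>
    obtain ⟨c, hc, h⟩ := ih
    refine ⟨((k : ℂ) + 1) * (s k + 1) * c,
      mul_ne_zero (mul_ne_zero k.cast_add_one_ne_zero (s k).cast_add_one_ne_zero) hc,
      fun t ht => ?_⟩
    rw [← X_mul_monomial, mul_comm, map_mul, map_mul, Module.End.mul_apply,
      polynomialAct_annihilation_X_monomial]
    obtain h0 | h0 := Nat.eq_zero_or_pos (t k)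
    · rw [h0, Nat.cast_zero, mul_zero, zero_smul, map_zero, if_neg]
      rintro rfl
      simp at h0
    · obtain ⟨t, rfl⟩ : ∃ t', t = Finsupp.single k 1 + t' :=
        ⟨t - Finsupp.single k 1, (add_tsub_cancel_of_le (Finsupp.single_le_iff.2 h0)).symm⟩
      rw [map_add, map_add, add_right_inj] at ht
      simp only [add_right_inj]
      rw [add_tsub_cancel_left, LinearMap.map_smul_of_tower, h t ht, smul_ite, smul_zero]
      refine ite_congr rfl (fun hst => ?_) fun _ => rfl
      rw [Algebra.smul_def, ← map_mul, hst]
      simp [add_comm]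

/-- The matrix of an element of `𝒰₀` on the piece of degree `j` of the universal Fock module, with
respect to the basis of monomials over `ℂ[x]`. -/
def entries (j : ℕ) : UEA →ₗ[ℂ] Matrix (Exponents j) (Exponents j) ℂ[X] where
  toFun x := Matrix.of fun s t => coeff s.1 (polynomialAct x (monomial t.1 1))
  map_add' x y := by
    ext1 s t
    simp only [Matrix.of_apply, Matrix.add_apply, map_add, LinearMap.add_apply, coeff_add]
  map_smul' c x := by
    ext1 s t
    simp only [Matrix.of_apply, Matrix.smul_apply, map_smul, LinearMap.smul_apply, coeff_smul,
      RingHom.id_apply]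

theorem entries_apply (j : ℕ) (x : UEA) (s t : Exponents j) :
    entries j x s t = coeff s.1 (polynomialAct x (monomial t.1 1)) := rfl

theorem isWeightedHomogeneous_monomial_exponents {R : Type*} [CommSemiring R] {j : ℕ}
    (s : Exponents j) (c : R) : IsWeightedHomogeneous conformalWeight (monomial s.1 c) (j : ℤ) :=
  isWeightedHomogeneous_monomial _ _ _ s.2

theorem polynomialAct_monomial {j : ℕ} {x : UEA} (hx : x ∈ UEAZero) (t : Exponents j) :
    polynomialAct x (monomial t.1 1) = ∑ s : Exponents j, monomial s.1 (entries j x s t) :=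
  eq_sum_monomial
    (isWeightedHomogeneous_polynomialAct hx (isWeightedHomogeneous_monomial_exponents t 1))

theorem entries_one (j : ℕ) : entries j 1 = 1 := by
  ext1 s t
  rw [entries_apply, map_one, Module.End.one_apply, coeff_monomial, Matrix.one_apply]
  exact if_congr (eq_comm.trans Subtype.ext_iff.symm) rfl rfl

theorem entries_mul (j : ℕ) (x : UEA) {y : UEA} (hy : y ∈ UEAZero) :
    entries j (x * y) = entries j x * entries j y := by
  ext1 s t
  rw [entries_apply, map_mul, Module.End.mul_apply, polynomialAct_monomial hy, map_sum, coeff_sum,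
    Matrix.mul_apply]
  refine sum_congr rfl fun r _ => ?_
  rw [monomial_eq_smul_monomial_one, map_smul, coeff_smul, smul_eq_mul, mul_comm, entries_apply j x]

theorem entries_eq_zero_of_mem_ueaNhd {j : ℕ} {n : ℤ} (hj : j < n) {x : UEA} (hx : x ∈ ueaNhd n) :
    entries j x = 0 := by
  ext1 s t
  rw [entries_apply, polynomialAct_eq_zero_of_mem_ueaNhd hj hx
    (isWeightedHomogeneous_monomial_exponents t 1), coeff_zero, Matrix.zero_apply]

theorem polynomialAct_monomial_eq_zero {j : ℕ} {x : UEA} (hx : x ∈ UEAZero) (h : entries j x = 0)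
    (t : Exponents j) : polynomialAct x (monomial t.1 1) = 0 := by
  simp [polynomialAct_monomial hx, h]

/-- The normally ordered element `∑ₜ f_t b_t` of `𝒰`, where `b_t` is the product of annihilation
operators with exponent `t`. Modulo annihilation operators of higher degree, the elements of degree
zero that kill the pieces of degree less than `j` are of this form. -/
def leadingTerm (j : ℕ) : (Exponents j → Fock) →ₗ[ℂ] UEA :=
  ∑ t, LinearMap.mulRight ℂ (annihilation (monomial t.1 1)) ∘ₗ creation.toLinearMap ∘ₗ
    LinearMap.proj t

theorem leadingTerm_apply (j : ℕ) (f : Exponents j → Fock) :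
    leadingTerm j f = ∑ t, creation (f t) * annihilation (monomial t.1 1) := by
  simp [leadingTerm]

theorem leadingTerm_mem_normallyOrdered {j : ℕ} {f : Exponents j → Fock}
    (hf : ∀ t, IsWeightedHomogeneous ((↑) : ℕ → ℤ) (f t) j) :
    leadingTerm j f ∈ normallyOrdered j 0 := by
  rw [leadingTerm_apply]
  exact sum_mem fun t _ => creation_mul_annihilation_mem_normallyOrdered (sub_self _) le_rfl (hf t)
    (isWeightedHomogeneous_monomial_exponents t 1)

theorem exists_polynomialAct_leadingTerm (j : ℕ) : ∃ c : Exponents j → ℂ, (∀ t, c t ≠ 0) ∧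
    ∀ f t, polynomialAct (leadingTerm j f) (monomial t.1 1) = c t • separateZeroth ℂ (f t) := by
  choose c hc h using fun s : Exponents j => exists_polynomialAct_annihilation_monomial s.1
  refine ⟨c, hc, fun f t => ?_⟩
  rw [leadingTerm_apply, map_sum, LinearMap.sum_apply, sum_eq_single_of_mem t (mem_univ t)]
  · rw [map_mul, Module.End.mul_apply, h t _ rfl, if_pos rfl, polynomialAct_creation, mul_comm,
      Algebra.smul_def]
  · intro s _ hst
    rw [map_mul, Module.End.mul_apply, h s _ (t.2.trans s.2.symm),
      if_neg fun h => hst (Subtype.ext h), map_zero]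

theorem exists_entries_eq (j : ℕ) (A : Matrix (Exponents j) (Exponents j) ℂ[X]) :
    ∃ x ∈ normallyOrdered j 0, entries j x = A := by
  obtain ⟨c, hc, h⟩ := exists_polynomialAct_leadingTerm j
  refine ⟨leadingTerm j fun t => (c t)⁻¹ • (separateZeroth ℂ).symm (∑ s, monomial s.1 (A s t)),
    leadingTerm_mem_normallyOrdered fun t => ?_, ?_⟩
  · refine (weightedHomogeneousSubmodule ℂ _ _).smul_mem _
      (isWeightedHomogeneous_separateZeroth_symm_iff.2 ?_)
    exact sum_mem (S := weightedHomogeneousSubmodule ℂ[X] _ _) fun s _ =>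
      isWeightedHomogeneous_monomial_exponents s _
  · ext1 s t
    rw [entries_apply, h, map_smul, smul_inv_smul₀ (hc t), AlgEquiv.apply_symm_apply, coeff_sum]
    simp [coeff_monomial, ← Subtype.ext_iff]

theorem exists_forall_entries_eq (m : ℕ) (A : ∀ j : ℕ, Matrix (Exponents j) (Exponents j) ℂ[X]) :
    ∃ x ∈ normallyOrdered 0 0, ∀ j < m, entries j x = A j := by
  induction m with
  | zero => exact ⟨0, zero_mem _, fun j hj => absurd hj j.not_lt_zero⟩
  | succ m ih =>
    obtain ⟨x, hx, h⟩ := ih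
    obtain ⟨y, hy, hym⟩ := exists_entries_eq m (A m - entries m x)
    refine ⟨x + y, add_mem hx (normallyOrdered_anti m.cast_nonneg 0 hy), fun j hj => ?_⟩
    rw [map_add]
    obtain hj | rfl := Nat.lt_succ_iff_lt_or_eq.1 hj
    · rw [h j hj, entries_eq_zero_of_mem_ueaNhd (Nat.cast_lt.2 hj)
        (normallyOrdered_le_ueaNhd _ _ hy), add_zero]
    · rw [hym, add_sub_cancel]

theorem normallyOrdered_le_range_leadingTerm_sup (j : ℕ) :
    normallyOrdered j 0 ≤ LinearMap.range (leadingTerm j) ⊔ normallyOrdered (j + 1) 0 := by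
  refine Submodule.span_le.2 ?_
  rintro _ ⟨i, k, hik, hk, f, g, hf, hg, rfl⟩
  obtain rfl | hk := hk.eq_or_lt
  · refine Submodule.mem_sup_left ⟨fun t => coeff t.1 g • f, ?_⟩
    conv_rhs => rw [eq_sum_monomial hg]
    rw [leadingTerm_apply, map_sum, mul_sum]
    refine sum_congr rfl fun t _ => ?_
    rw [map_smul, smul_mul_assoc, monomial_eq_smul_monomial_one t.1 (coeff t.1 g), map_smul,
      mul_smul_comm]
  · exact Submodule.mem_sup_right
      (creation_mul_annihilation_mem_normallyOrdered hik hk hf hg)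

theorem mem_normallyOrdered_succ_of_entries_eq_zero {j : ℕ} {x : UEA}
    (hx : x ∈ normallyOrdered j 0) (h : entries j x = 0) : x ∈ normallyOrdered (j + 1) 0 := by
  obtain ⟨_, ⟨f, rfl⟩, y, hy, rfl⟩ :=
    Submodule.mem_sup.1 (normallyOrdered_le_range_leadingTerm_sup j hx)
  obtain ⟨c, hc, hact⟩ := exists_polynomialAct_leadingTerm j
  have hf : f = 0 := _root_.funext fun t => by
    have hzero := polynomialAct_monomial_eq_zero (mem_UEAZero_of_mem_normallyOrdered hx) h t
    rw [map_add, LinearMap.add_apply, hact, polynomialAct_eq_zero_of_mem_ueaNhd (Int.lt_succ j)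
      (normallyOrdered_le_ueaNhd _ _ hy) (isWeightedHomogeneous_monomial_exponents t 1),
      add_zero] at hzero
    exact (map_eq_zero_iff _ (separateZeroth ℂ).injective).1
      ((smul_eq_zero.1 hzero).resolve_left (hc t))
  rwa [hf, map_zero, zero_add]

theorem mem_normallyOrdered_of_forall_entries_eq_zero {m : ℕ} {x : UEA}
    (hx : x ∈ normallyOrdered 0 0) (h : ∀ j < m, entries j x = 0) : x ∈ normallyOrdered m 0 := by
  induction m with
  | zero => exact hx
  | succ m ih =>
    rw [Nat.cast_succ]
    exact mem_normallyOrdered_succ_of_entries_eq_zero (ih fun j hj => h j (hj.trans m.lt_succ_self))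
      (h m m.lt_succ_self)

/-! ### The higher level Zhu algebras -/

theorem mem_ueaNhd_of_forall_entries_eq_zero {m : ℕ} {x : UEA} (hx : x ∈ UEAZero)
    (h : ∀ j < m, entries j x = 0) : x ∈ ueaNhd m := by
  obtain ⟨p, hp, hxp⟩ := exists_mem_normallyOrdered_sub_mem_ueaNhd hx m
  have hpm : p ∈ normallyOrdered m 0 :=
    mem_normallyOrdered_of_forall_entries_eq_zero hp fun j hj => by
      have h' := entries_eq_zero_of_mem_ueaNhd (Nat.cast_lt.2 hj) hxp
      rwa [map_sub, h j hj, zero_sub, neg_eq_zero] at h'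
  exact sub_add_cancel x p ▸ add_mem hxp (normallyOrdered_le_ueaNhd _ _ hpm)

/-- The action of `𝒰₀` by matrices over `ℂ[x]` on the pieces of degree less than `m` of the
universal Fock module. -/
def matrixAct (m : ℕ) :
    UEAZero →ₐ[ℂ] ∀ j : Fin m, Matrix (Exponents j) (Exponents j) ℂ[X] :=
  AlgHom.pi fun j => AlgHom.ofLinearMap (entries j ∘ₗ UEAZero.val.toLinearMap) (entries_one j)
    fun x y => entries_mul j x y.2

theorem matrixAct_surjective (m : ℕ) : Function.Surjective (matrixAct m) := by
  intro A
  obtain ⟨x, hx, h⟩ := exists_forall_entries_eq m fun j => if hj : j < m then A ⟨j, hj⟩ else 0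
  exact ⟨⟨x, mem_UEAZero_of_mem_normallyOrdered hx⟩,
    _root_.funext fun j => (h j j.2).trans (dif_pos j.2)⟩

theorem ker_matrixAct (m : ℕ) : RingHom.ker (matrixAct m) = nhdZero m := by
  ext x
  rw [RingHom.mem_ker, mem_nhdZero]
  exact ⟨fun h => mem_ueaNhd_of_forall_entries_eq_zero x.2 fun j hj => congrFun h ⟨j, hj⟩,
    fun h => _root_.funext fun j => entries_eq_zero_of_mem_ueaNhd (Nat.cast_lt.2 j.2) h⟩

/-- The first isomorphism theorem for the quotient of an algebra by an ideal that is equal, though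
not syntactically, to the kernel of a surjection. -/
def quotientAlgEquivOfKerEq {R A B : Type*} [CommSemiring R] [Ring A] [Algebra R A] [Semiring B]
    [Algebra R B] {I : Ideal A} [I.IsTwoSided] {f : A →ₐ[R] B} (hf : Function.Surjective f)
    (hI : RingHom.ker f = I) : (A ⧸ I) ≃ₐ[R] B :=
  (Ideal.quotientEquivAlgOfEq R hI.symm).trans (Ideal.quotientKerAlgEquivOfSurjective hf)

/-- The `n`-th higher level Zhu algebra as a product of matrix algebras. -/
def higherZhuEquiv {m : ℕ} {n : ℤ} (h : n + 1 = m) :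
    HigherZhu n ≃ₐ[ℂ] ∀ j : Fin m, Matrix (Fin (Fintype.card (Nat.Partition j)))
      (Fin (Fintype.card (Nat.Partition j))) ℂ[X] :=
  have hker : RingHom.ker (matrixAct m) = nhdZero (n + 1) := h ▸ ker_matrixAct m
  (quotientAlgEquivOfKerEq (matrixAct_surjective m) hker).trans <|
    AlgEquiv.piCongrRight fun j => Matrix.reindexAlgEquiv ℂ ℂ[X]
      ((exponentsEquivPartition j).trans (Fintype.equivFin _))

/-- Splitting off the last factor of a product of algebras. -/
def splitLast {R : Type*} [CommSemiring R] {m : ℕ} (A : Fin (m + 1) → Type*) [∀ j, Semiring (A j)]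
    [∀ j, Algebra R (A j)] : (∀ j, A j) ≃ₐ[R] A (Fin.last m) × ∀ j : Fin m, A j.castSucc :=
  { (Fin.snocEquiv A).symm with
    map_mul' := fun _ _ => rfl
    map_add' := fun _ _ => rfl
    commutes' := fun _ => rfl }

end Heisenberg

end

/-- For every `d`, the `d`-th higher level Zhu algebra of the Heisenberg vertex algebra `π` is
`Mat_{p(d)}(ℂ[x]) ⊕ A_{d-1}(π)`, and hence `∏_{j=0}^d Mat_{p(j)}(ℂ[x])`, where `p(j)` is the number
of partitions of `j`. -/
theorem corollary7p3p1 (d : ℕ) :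
    Nonempty (Heisenberg.HigherZhu d ≃ₐ[ℂ]
      Matrix (Fin (Fintype.card (Nat.Partition d))) (Fin (Fintype.card (Nat.Partition d))) ℂ[X] ×
        Heisenberg.HigherZhu (d - 1)) ∧
    Nonempty (Heisenberg.HigherZhu d ≃ₐ[ℂ]
      ∀ j : Fin (d + 1), Matrix (Fin (Fintype.card (Nat.Partition j)))
        (Fin (Fintype.card (Nat.Partition j))) ℂ[X]) := by
  let zhuTop := Heisenberg.higherZhuEquiv (m := d + 1) (n := d) (Nat.cast_succ d).symm
  let zhuBelow := Heisenberg.higherZhuEquiv (m := d) (n := d - 1) (sub_add_cancel _ _)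
  exact ⟨⟨(zhuTop.trans (Heisenberg.splitLast _)).trans
    (AlgEquiv.prodCongr AlgEquiv.refl zhuBelow.symm)⟩, ⟨zhuTop⟩⟩
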